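/- Let $(X,R,X^\vee,R^\vee)$ be a root datum with $X$ a free abelian group of finite rank and $R$ finite and reduced, let $\Delta$ be a base of $R$, $W$ the Weyl group and $l$ its length function with respect to $\Delta$. Let $q>0$ be a real number. The affine Hecke algebra $\mathcal H=\mathcal H(X,R,\Delta,q)$ is the $\mathbb C$-algebra generated by $T_w$ $(w\in W)$ and the group algebra $\mathcal A=\mathbb C[X]$ (basis $\theta_x$, $x\in X$), with the relations $T_1=1$; $T_wT_{w'}=T_{ww'}$ if $l(ww')=l(w)+l(w')$; and, for $s=s_\alpha$ with $\alpha\in\Delta$ and $x\in X$, $(T_s+1)(T_s-q)=0$ and $T_s\theta_x-\theta_{s(x)}T_s=(q-1)\frac{\theta_x-\theta_{s(x)}}{1-\theta_{-\alpha}}$. Let $V=X\otimes_{\mathbb Z}\mathbb C$. The graded affine Hecke algebra $\mathbb H=\mathbb H(V,R,\Delta,\log q)$ is the $\mathbb C$-algebra generated by $t_w$ $(w\in W)$ and the symmetric algebra $\mathbb A=S(V)$, with the relations $t_1=1$, $t_wt_{w'}=t_{ww'}$ and $v\,t_{s_\alpha}-t_{s_\alpha}s_\alpha(v)=\log q\cdot\langle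 v,\alpha^\vee\rangle$ for $\alpha\in\Delta$, $v\in V$. Their centers are $\mathcal Z=\mathcal A^W$ and $\mathbb Z=\mathbb A^W$. Let $\zeta\in\mathrm{Hom}(X,\mathbb C)$ satisfy $\alpha(\zeta)\in\mathbb R$ for all $\alpha\in R$, and let $t=\exp(\zeta)\in\mathrm{Hom}(X,\mathbb C^\times)$. Let $\widehat{\mathcal Z}$ be the completion of $\mathcal Z$ at the maximal ideal of functions vanishing at $t$, and $\widehat{\mathbb Z}$ the completion of $\mathbb Z$ at the maximal ideal of functions vanishing at $\zeta$. Put $\widehat{\mathcal A}=\widehat{\mathcal Z}\otimes_{\mathcal Z}\mathcal A$, $\widehat{\mathcal H}=\widehat{\mathcal Z}\otimes_{\mathcal Z}\mathcal H$, $\widehat{\mathcal H}_F=\mathrm{Frac}(\widehat{\mathcal Z})\otimes_{\mathcal Z}\mathcal H$, and likewise $\widehat{\mathbb A}$, $\widehat{\mathbb H}$, $\widehat{\mathbb H}_F$. For $\alpha\in\Delta$ define $\tau_{s_\alpha}\in\widehat{\mathcal H}_F$ and $\overline\tau_{s_\alpha}\in\widehat{\mathbb H}_F$ by $$\tau_{s_\alpha}+1=(T_{s_\alpha}+1)\Big(\frac{\theta_\alpha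 q-1}{\theta_\alpha-1}\Big)^{-1},\qquad \overline\tau_{s_\alpha}+1=(t_{s_\alpha}+1)\Big(\frac{\alpha+\log q}{\alpha}\Big)^{-1}.$$ For $x\in X$ let $e^x\in\widehat{\mathbb A}$ be the sum of the exponential series of $x$ (convergent in every finite-dimensional quotient of $\mathbb A$ by a power of the maximal ideal of $\mathbb Z$ at $\zeta$). Lusztig's isomorphism is the algebra isomorphism $j:\widehat{\mathcal H}_F\to\widehat{\mathbb H}_F$ with $j(\tau_{s_\alpha})=\overline\tau_{s_\alpha}$ for $\alpha\in\Delta$ and $j(\theta_x)=e^x$ for $x\in X$, which restricts to isomorphisms $\widehat{\mathcal Z}\cong\widehat{\mathbb Z}$, $\widehat{\mathcal A}\cong\widehat{\mathbb A}$ and $\widehat{\mathcal H}\cong\widehat{\mathbb H}$. **Proposition.** Such an isomorphism $j$ exists. For every such $j$, the sign projectors $$\mathbf S=\Big(\sum_{w\in W}(1/q)^{l(w)}\Big)^{-1}\sum_{w\in W}(-1/q)^{l(w)}T_w\in\mathcal H,\qquad \mathbf s=|W|^{-1}\sum_{w\in W}(-1)^{l(w)}t_w\in\mathbb H$$ satisfy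 $j(\mathbf S)=a\cdot\mathbf s$ for some invertible element $a$ of $\widehat{\mathbb A}$. -/

import Mathlib

open scoped TensorProduct

noncomputable section

namespace LusztigReduction

variable {ι X Y : Type*} [AddCommGroup X] [AddCommGroup Y] (P : RootDatum ι X Y)

/-! ### The Weyl group and its length function -/

/-- The reflection in the root with index `i`, as an element of the Weyl group `W`. -/
abbrev refl (i : ι) : P.weylGroup := RootPairing.weylGroup.ofIdx P i

variable {P} in
/-- The length of `w`: the least length of a word in the simple reflections representing `w`. -/
def len (b : P.Base) (w : P.weylGroup) : ℕ :=
  sInf {n | ∃ L : List ι, (∀ i ∈ L, i ∈ b.support) ∧ L.length = n ∧ (L.map (refl P)).prod = w}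

lemma refl_smul (i : ι) (x : X) : refl P i • x = x - P.toLinearMap x (P.coroot i) • P.root i := by
  change P.reflection i x = _
  rw [RootPairing.reflection_apply]
  rfl

lemma refl_mul_self (i : ι) : refl P i * refl P i = 1 := by
  apply Subtype.ext
  change RootPairing.Equiv.reflection P i * RootPairing.Equiv.reflection P i = 1
  rw [mul_eq_one_iff_inv_eq, RootPairing.Equiv.reflection_inv]

/-- The Weyl group of a root datum is finite. -/
instance finite_weylGroup [Finite ι] : Finite P.weylGroup := by
  have : Fintype ι := Fintype.ofFinite ι
  have hspan : ∀ w : P.weylGroup, ∀ x : X, w • x - x ∈ P.rootSpan ℤ := by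
    rintro ⟨w, hw⟩
    induction hw using RootPairing.weylGroup.induction with
    | mem i =>
      intro x
      change refl P i • x - x ∈ _
      rw [refl_smul, sub_sub_cancel_left, ← neg_smul]
      exact Submodule.smul_mem _ _ (Submodule.subset_span ⟨i, rfl⟩)
    | one => intro x; change x - x ∈ _; simp
    | mul u v hu hv hu' hv' =>
      intro x
      have := add_mem (hu' ((⟨v, hv⟩ : P.weylGroup) • x)) (hv' x)
      rw [sub_add_sub_cancel] at this
      exact this
  refine Finite.of_injective P.weylGroupToPerm ?_
  rw [injective_iff_map_eq_one]
  rintro g hg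
  have hco : ∀ (x : X) (i : ι),
      P.toLinearMap (g • x) (P.coroot i) = P.toLinearMap x (P.coroot i) := by
    intro x i
    have h1 := congrArg (fun F => F (P.coroot i) x) g.1.weight_coweight_transpose
    have h2 := RootPairing.Hom.coroot_coweightMap_apply P P i g.1.toHom
    have h3 : g.1.toHom.indexEquiv = Equiv.refl ι := hg
    rw [h3] at h2
    change g.1.coweightMap (P.coroot i) = P.coroot i at h2
    simp only [LinearMap.coe_comp, Function.comp_apply, LinearMap.dualMap_apply] at h1
    rw [h2] at h1
    exact h1
  have hfix : ∀ x : X, g • x = x := by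
    intro x
    rw [← sub_eq_zero]
    refine P.eq_zero_of_mem_rootSpan_of_rootForm_self_eq_zero (hspan g x) ?_
    rw [RootPairing.rootForm_apply_apply]
    refine Finset.sum_eq_zero fun i _ => ?_
    have : P.coroot' i (g • x - x) = 0 := by
      rw [map_sub, sub_eq_zero]
      exact hco x i
    rw [this, zero_mul]
  apply Subtype.ext
  apply RootPairing.Equiv.weightHom_injective P
  ext x
  exact hfix x

instance fintype_weylGroup [Finite ι] : Fintype P.weylGroup := Fintype.ofFinite _

lemma refl_reflectionPerm (i j : ι) :
    refl P (P.reflectionPerm j i) = refl P j * refl P i * refl P j := by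
  apply Subtype.ext
  apply RootPairing.Equiv.weightHom_injective P
  ext x
  exact congrArg (fun f => f x) (P.reflection_reflectionPerm (i := i) (j := j))

variable {P} in
/-- Every element of the Weyl group is a product of simple reflections. -/
lemma exists_word [Finite ι] [P.IsReduced] (b : P.Base) (w : P.weylGroup) :
    ∃ L : List ι, (∀ i ∈ L, i ∈ b.support) ∧ (L.map (refl P)).prod = w := by
  have hmul : ∀ u v : P.weylGroup,
      (∃ L : List ι, (∀ i ∈ L, i ∈ b.support) ∧ (L.map (refl P)).prod = u) →
      (∃ L : List ι, (∀ i ∈ L, i ∈ b.support) ∧ (L.map (refl P)).prod = v) →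
      ∃ L : List ι, (∀ i ∈ L, i ∈ b.support) ∧ (L.map (refl P)).prod = u * v := by
    rintro u v ⟨L, hL, rfl⟩ ⟨M, hM, rfl⟩
    refine ⟨L ++ M, fun i hi => ?_, by simp⟩
    rcases List.mem_append.mp hi with h | h
    exacts [hL i h, hM i h]
  have hsimple : ∀ i ∈ b.support,
      ∃ L : List ι, (∀ i ∈ L, i ∈ b.support) ∧ (L.map (refl P)).prod = refl P i :=
    fun i hi => ⟨[i], by simpa using hi, by simp⟩
  have hrefl : ∀ i, ∃ L : List ι, (∀ i ∈ L, i ∈ b.support) ∧ (L.map (refl P)).prod = refl P i := by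
    intro i
    induction i using b.induction_reflect with
    | h₀ i hi =>
      rw [refl_reflectionPerm, refl_mul_self, one_mul]
      exact hi
    | h₁ i hi => exact hsimple i hi
    | h₂ i j hi hj =>
      rw [refl_reflectionPerm]
      exact hmul _ _ (hmul _ _ (hsimple j hj) hi) (hsimple j hj)
  obtain ⟨w, hw⟩ := w
  induction hw using RootPairing.weylGroup.induction with
  | mem i => exact hrefl i
  | one => exact ⟨[], by simp, rfl⟩
  | mul u v hu hv hu' hv' => exact hmul _ _ hu' hv'

variable {P} in
lemma exists_word_len [Finite ι] [P.IsReduced] (b : P.Base) (w : P.weylGroup) :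
    ∃ L : List ι, (∀ i ∈ L, i ∈ b.support) ∧ L.length = len b w ∧ (L.map (refl P)).prod = w := by
  obtain ⟨L, hL, hw⟩ := exists_word b w
  exact Nat.sInf_mem (s := {n | ∃ L : List ι, (∀ i ∈ L, i ∈ b.support) ∧ L.length = n ∧
    (L.map (refl P)).prod = w}) ⟨_, L, hL, rfl, hw⟩

variable {P} in
lemma len_le (b : P.Base) (L : List ι) (hL : ∀ i ∈ L, i ∈ b.support) :
    len b (L.map (refl P)).prod ≤ L.length :=
  Nat.sInf_le ⟨L, hL, rfl, rfl⟩

lemma refl_ne_one (i : ι) : refl P i ≠ 1 := by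
  intro h
  have h1 : refl P i • P.root i = P.root i := by rw [h, one_smul]
  rw [refl_smul] at h1
  have h2 := congrArg (fun x => P.toLinearMap x (P.coroot i)) h1
  have h3 : P.toLinearMap (P.root i) (P.coroot i) = 2 := P.root_coroot_two i
  simp only [map_sub, map_smul, LinearMap.sub_apply, LinearMap.smul_apply, h3] at h2
  norm_num at h2

variable {P} in
/-- A nontrivial Weyl group element can be shortened by a simple reflection on the left. -/
lemma exists_len_succ [Finite ι] [P.IsReduced] (b : P.Base) (w : P.weylGroup) (hw : w ≠ 1) :
    ∃ i ∈ b.support, ∃ v : P.weylGroup, w = refl P i * v ∧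
      len b w = len b (refl P i) + len b v ∧ len b v < len b w := by
  obtain ⟨L, hL, hlen, hprod⟩ := exists_word_len b w
  cases L with
  | nil => exact absurd (by simpa using hprod.symm) hw
  | cons i L =>
    have hi : i ∈ b.support := hL i (by simp)
    have hL' : ∀ j ∈ L, j ∈ b.support := fun j hj => hL j (by simp [hj])
    obtain ⟨M, hM, hMlen, hMprod⟩ := exists_word_len b (L.map (refl P)).prod
    obtain ⟨N, hN, hNlen, hNprod⟩ := exists_word_len b (refl P i)
    have h1 := len_le b L hL'
    have h2 := len_le b [i] (by simpa using hi)
    have h3 := len_le b (N ++ M) (by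
      intro j hj
      rcases List.mem_append.mp hj with h | h
      exacts [hN j h, hM j h])
    have h4 : N ≠ [] := by
      rintro rfl
      exact refl_ne_one P i (by simpa using hNprod.symm)
    have h5 : 0 < N.length := List.length_pos_iff.mpr h4
    simp only [List.map_cons, List.prod_cons, List.map_nil, List.prod_nil, mul_one, List.length_cons,
      List.length_nil, List.map_append, List.prod_append, List.length_append, hNprod, hMprod]
      at h1 h2 h3 hlen hprod
    rw [hprod] at h3
    exact ⟨i, hi, _, hprod.symm, by omega, by omega⟩

/-! ### The two commutative algebras -/

/-- The group algebra `ℂ[X]`. -/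
abbrev GrpAlg (X : Type*) [AddCommGroup X] : Type _ := AddMonoidAlgebra ℂ X

/-- The basis element `θ_x` of `ℂ[X]`. -/
def θ (x : X) : GrpAlg X := AddMonoidAlgebra.single x 1

/-- The complex vector space `V = X ⊗ ℂ`. -/
abbrev VC (X : Type*) [AddCommGroup X] : Type _ := ℂ ⊗[ℤ] X

/-- The symmetric algebra `S(V)`. -/
abbrev PolyAlg (X : Type*) [AddCommGroup X] : Type _ := SymmetricAlgebra ℂ (VC X)

/-- The inclusion `V → S(V)`. -/
abbrev vec (v : VC X) : PolyAlg X := SymmetricAlgebra.ι ℂ (VC X) v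

/-- The element of `S(V)` defined by `x ∈ X`. -/
abbrev lin (x : X) : PolyAlg X := vec (1 ⊗ₜ[ℤ] x)

/-- The action of `w` on `ℂ[X]`, with `w(θ_x) = θ_{w(x)}`. -/
def actGrp (w : P.weylGroup) : GrpAlg X →ₐ[ℂ] GrpAlg X :=
  AddMonoidAlgebra.mapDomainAlgHom ℂ ℂ (DistribSMul.toAddMonoidHom X w)

/-- The complexified action of `w` on `V`. -/
def actVC (w : P.weylGroup) : VC X →ₗ[ℂ] VC X := (P.weylGroupRootRep w).baseChange ℂ

/-- The action of `w` on `S(V)`. -/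
def actSym (w : P.weylGroup) : PolyAlg X →ₐ[ℂ] PolyAlg X :=
  SymmetricAlgebra.lift (SymmetricAlgebra.ι ℂ (VC X) ∘ₗ actVC P w)

/-- The complexified pairing `v ↦ ⟨v, α^∨⟩` with the coroot of index `i`. -/
def corootC (i : ι) : VC X →ₗ[ℂ] ℂ :=
  LinearMap.liftBaseChange ℂ (Algebra.linearMap ℤ ℂ ∘ₗ P.coroot' i)

/-- The invariants `ℂ[X]^W`, that is, the center `𝒵` of the affine Hecke algebra. -/
def invGrp : Subalgebra ℂ (GrpAlg X) :=
  ⨅ w : P.weylGroup, AlgHom.equalizer (actGrp P w) (AlgHom.id ℂ _)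

/-- The invariants `S(V)^W`, that is, the center of the graded affine Hecke algebra. -/
def invSym : Subalgebra ℂ (PolyAlg X) :=
  ⨅ w : P.weylGroup, AlgHom.equalizer (actSym P w) (AlgHom.id ℂ _)

/-! ### The affine Hecke algebra -/

section Affine

variable {P} (b : P.Base) (q : ℂ)

/-- The free algebra on the symbols `T_w` and the elements of `ℂ[X]`. -/
abbrev AffFree : Type _ := FreeAlgebra ℂ (P.weylGroup ⊕ GrpAlg X)

/-- The defining relations of the affine Hecke algebra. The first three say that `ℂ[X]` maps to it
by an algebra homomorphism. In the last one `g` is `(θ_x - θ_{s(x)}) / (1 - θ_{-α})`. -/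
inductive AffRel : AffFree (P := P) → AffFree (P := P) → Prop
  | add (f g : GrpAlg X) : AffRel (FreeAlgebra.ι ℂ (.inr (f + g)))
      (FreeAlgebra.ι ℂ (.inr f) + FreeAlgebra.ι ℂ (.inr g))
  | mul (f g : GrpAlg X) : AffRel (FreeAlgebra.ι ℂ (.inr (f * g)))
      (FreeAlgebra.ι ℂ (.inr f) * FreeAlgebra.ι ℂ (.inr g))
  | scalar (c : ℂ) : AffRel (FreeAlgebra.ι ℂ (.inr (algebraMap ℂ (GrpAlg X) c)))
      (algebraMap ℂ _ c)
  | T_one : AffRel (FreeAlgebra.ι ℂ (.inl 1)) 1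
  | T_mul (w w' : P.weylGroup) (h : len b (w * w') = len b w + len b w') :
      AffRel (FreeAlgebra.ι ℂ (.inl w) * FreeAlgebra.ι ℂ (.inl w'))
        (FreeAlgebra.ι ℂ (.inl (w * w')))
  | quadratic (i : ι) (hi : i ∈ b.support) :
      AffRel ((FreeAlgebra.ι ℂ (.inl (refl P i)) + 1) *
        (FreeAlgebra.ι ℂ (.inl (refl P i)) - algebraMap ℂ _ q)) 0
  | bernstein (i : ι) (hi : i ∈ b.support) (x : X) (g : GrpAlg X)
      (hg : g * (1 - θ (-P.root i)) = θ x - θ (refl P i • x)) :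
      AffRel (FreeAlgebra.ι ℂ (.inl (refl P i)) * FreeAlgebra.ι ℂ (.inr (θ x)) -
          FreeAlgebra.ι ℂ (.inr (θ (refl P i • x))) * FreeAlgebra.ι ℂ (.inl (refl P i)))
        (algebraMap ℂ _ (q - 1) * FreeAlgebra.ι ℂ (.inr g))

/-- The affine Hecke algebra `ℋ(X, R, Δ, q)`. -/
def AffineHecke : Type _ := RingQuot (AffRel b q)

instance : Ring (AffineHecke b q) := inferInstanceAs (Ring (RingQuot (AffRel b q)))

instance : Algebra ℂ (AffineHecke b q) := inferInstanceAs (Algebra ℂ (RingQuot (AffRel b q)))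

/-- The quotient map from the free algebra. -/
def AffineHecke.mk : AffFree (P := P) →ₐ[ℂ] AffineHecke b q := RingQuot.mkAlgHom ℂ (AffRel b q)

/-- The generator `T_w`. -/
def T (w : P.weylGroup) : AffineHecke b q := AffineHecke.mk b q (FreeAlgebra.ι ℂ (.inl w))

/-- The canonical homomorphism `ℂ[X] → ℋ`. -/
def grpToHecke : GrpAlg X →ₐ[ℂ] AffineHecke b q :=
  AlgHom.ofLinearMap
    { toFun := fun f => AffineHecke.mk b q (FreeAlgebra.ι ℂ (.inr f))
      map_add' := fun f g => by
        rw [← map_add]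
        exact RingQuot.mkAlgHom_rel ℂ (AffRel.add f g)
      map_smul' := fun c f => by
        have h1 : AffineHecke.mk b q (FreeAlgebra.ι ℂ (.inr (c • f))) =
            AffineHecke.mk b q (FreeAlgebra.ι ℂ (.inr (algebraMap ℂ (GrpAlg X) c)) *
              FreeAlgebra.ι ℂ (.inr f)) := by
          rw [Algebra.smul_def]
          exact RingQuot.mkAlgHom_rel ℂ (AffRel.mul _ f)
        have h2 : AffineHecke.mk b q (FreeAlgebra.ι ℂ (.inr (algebraMap ℂ (GrpAlg X) c))) =
            AffineHecke.mk b q (algebraMap ℂ _ c) :=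
          RingQuot.mkAlgHom_rel ℂ (AffRel.scalar c)
        rw [h1, map_mul, h2, AlgHom.commutes, RingHom.id_apply, Algebra.smul_def] }
    (by
      have h := RingQuot.mkAlgHom_rel ℂ (AffRel.scalar (b := b) (q := q) 1)
      rw [map_one, map_one, map_one] at h
      exact h)
    (fun f g => by
      change AffineHecke.mk b q _ = AffineHecke.mk b q _ * AffineHecke.mk b q _
      rw [← map_mul]
      exact RingQuot.mkAlgHom_rel ℂ (AffRel.mul f g))

lemma T_one : T b q 1 = 1 := by
  have h := RingQuot.mkAlgHom_rel ℂ (AffRel.T_one (b := b) (q := q))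
  rwa [map_one] at h

lemma T_mul (w w' : P.weylGroup) (h : len b (w * w') = len b w + len b w') :
    T b q w * T b q w' = T b q (w * w') := by
  have h := RingQuot.mkAlgHom_rel ℂ (AffRel.T_mul (b := b) (q := q) w w' h)
  rwa [map_mul] at h

lemma θ_add (x y : X) : θ (x + y) = θ x * θ y := by
  simp [θ, AddMonoidAlgebra.single_mul_single]

lemma exists_demazure_θ (i : ι) (x : X) :
    ∃ g : GrpAlg X, g * (1 - θ (-P.root i)) = θ x - θ (refl P i • x) := by
  have key : ∀ (n : ℕ) (x : X), (1 - θ (-P.root i)) ∣ θ x - θ (x - n • P.root i) := by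
    intro n
    induction n with
    | zero => intro x; simp
    | succ n ih =>
      intro x
      have h2 : θ (x - n • P.root i) - θ (x - (n + 1) • P.root i) =
          (1 - θ (-P.root i)) * θ (x - n • P.root i) := by
        have h3 : x - (n + 1) • P.root i = -P.root i + (x - n • P.root i) := by
          rw [succ_nsmul]; abel
        rw [h3, θ_add, sub_mul, one_mul]
      rw [← sub_add_sub_cancel (θ x) (θ (x - n • P.root i)), h2]
      exact dvd_add (ih x) (dvd_mul_right _ _)
  suffices h : (1 - θ (-P.root i)) ∣ θ x - θ (refl P i • x) by
    obtain ⟨g, hg⟩ := h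
    exact ⟨g, by rw [hg, mul_comm]⟩
  rw [refl_smul]
  generalize P.toLinearMap x (P.coroot i) = m
  obtain ⟨n, rfl | rfl⟩ := m.eq_nat_or_neg
  · simpa using key n x
  · have h := key n (x + n • P.root i)
    rw [add_sub_cancel_right, ← neg_sub (θ x), dvd_neg] at h
    simpa using h

lemma actGrp_θ (w : P.weylGroup) (x : X) : actGrp P w (θ x) = θ (w • x) := by
  simp [actGrp, θ]

/-- The Bernstein relation holds for all elements of `ℂ[X]`. -/
lemma bernstein_general (i : ι) (hi : i ∈ b.support) (f : GrpAlg X) :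
    ∃ g : GrpAlg X, g * (1 - θ (-P.root i)) = f - actGrp P (refl P i) f ∧
      T b q (refl P i) * grpToHecke b q f -
        grpToHecke b q (actGrp P (refl P i) f) * T b q (refl P i) =
        algebraMap ℂ _ (q - 1) * grpToHecke b q g := by
  induction f using AddMonoidAlgebra.induction_linear with
  | zero => exact ⟨0, by simp, by simp⟩
  | add f₁ f₂ h₁ h₂ =>
    obtain ⟨g₁, h₁, h₁'⟩ := h₁
    obtain ⟨g₂, h₂, h₂'⟩ := h₂
    refine ⟨g₁ + g₂, ?_, ?_⟩
    · rw [add_mul, h₁, h₂, map_add]; abel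
    · rw [map_add, map_add, map_add, map_add, mul_add, mul_add, ← h₁', ← h₂', add_mul]; abel
  | single x c =>
    obtain ⟨g, hg⟩ := exists_demazure_θ (P := P) i x
    have h := RingQuot.mkAlgHom_rel ℂ (AffRel.bernstein (b := b) (q := q) i hi x g hg)
    rw [map_sub, map_mul, map_mul, map_mul, AlgHom.commutes] at h
    change T b q (refl P i) * grpToHecke b q (θ x) -
      grpToHecke b q (θ (refl P i • x)) * T b q (refl P i) =
        algebraMap ℂ _ (q - 1) * grpToHecke b q g at h
    have hs : AddMonoidAlgebra.single x c = c • θ x := by simp [θ]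
    rw [hs, map_smul, actGrp_θ, map_smul, map_smul]
    refine ⟨c • g, ?_, ?_⟩
    · rw [smul_mul_assoc, hg, smul_sub]
    · rw [map_smul, mul_smul_comm, mul_smul_comm, smul_mul_assoc, ← smul_sub, h]

lemma one_sub_θ_ne_zero (i : ι) : (1 - θ (-P.root i) : GrpAlg X) ≠ 0 := by
  intro h
  rw [sub_eq_zero] at h
  have h0 : (1 : GrpAlg X) = AddMonoidAlgebra.single 0 1 := rfl
  rw [h0, θ] at h
  have h2 := congrArg (AddMonoidAlgebra.coeff · 0) h
  simp [P.ne_zero i] at h2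

instance isDomain_grpAlg [Module.Free ℤ X] : IsDomain (GrpAlg X) := by
  have : TwoUniqueSums X := TwoUniqueSums.of_injective_addHom
    (Module.Free.chooseBasis ℤ X).repr.toLinearMap.toAddMonoidHom.toAddHom
    (Module.Free.chooseBasis ℤ X).repr.injective inferInstance
  infer_instance

lemma mem_invGrp {f : GrpAlg X} : f ∈ invGrp P ↔ ∀ w, actGrp P w f = f := by
  simp [invGrp, Algebra.mem_iInf, AlgHom.mem_equalizer]

/-- The invariants are central in the affine Hecke algebra. -/
lemma invGrp_central [Finite ι] [P.IsReduced] [Module.Free ℤ X] (f : invGrp P)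
    (h : AffineHecke b q) :
    grpToHecke b q f * h = h * grpToHecke b q f := by
  have hT : ∀ n (w : P.weylGroup), len b w = n →
      Commute (grpToHecke b q f) (T b q w) := by
    intro n
    induction n using Nat.strong_induction_on with
    | _ n ih =>
      rintro w rfl
      by_cases hw : w = 1
      · rw [hw, T_one]; exact Commute.one_right _
      obtain ⟨i, hi, v, rfl, hlen, hlt⟩ := exists_len_succ b w hw
      rw [← T_mul b q _ _ hlen]
      refine Commute.mul_right ?_ (ih _ hlt v rfl)
      obtain ⟨g, hg, hg'⟩ := bernstein_general b q i hi f
      rw [mem_invGrp.mp f.2, sub_self] at hg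
      have hg0 : g = 0 := (mul_eq_zero.mp hg).resolve_right (one_sub_θ_ne_zero i)
      rw [mem_invGrp.mp f.2, hg0, map_zero, mul_zero, sub_eq_zero] at hg'
      exact hg'.symm
  obtain ⟨h, rfl⟩ := RingQuot.mkAlgHom_surjective ℂ (AffRel b q) h
  change Commute (grpToHecke b q f) (AffineHecke.mk b q h)
  induction h using FreeAlgebra.induction with
  | grade0 c => rw [AlgHom.commutes]; exact Algebra.commutes' c _ |>.symm
  | grade1 x =>
    rcases x with w | g
    · exact hT _ w rfl
    · change Commute (grpToHecke b q f) (grpToHecke b q g)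
      exact (Commute.all (f : GrpAlg X) g).map (grpToHecke b q)
  | mul x y hx hy => rw [map_mul]; exact hx.mul_right hy
  | add x y hx hy => rw [map_add]; exact hx.add_right hy

/-- The affine Hecke algebra as an algebra over the invariants. -/
instance [Finite ι] [P.IsReduced] [Module.Free ℤ X] : Algebra (invGrp P) (AffineHecke b q) :=
  RingHom.toAlgebra' ((grpToHecke b q).toRingHom.comp (invGrp P).val.toRingHom)
    (invGrp_central b q)

instance [Finite ι] [P.IsReduced] [Module.Free ℤ X] :
    IsScalarTower ℂ (invGrp P) (AffineHecke b q) :=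
  IsScalarTower.of_algebraMap_eq' (by
    ext c
    exact ((grpToHecke b q).commutes c).symm)

/-- The canonical homomorphism `ℂ[X] → ℋ`, linear over the invariants. -/
def grpToHeckeInv [Finite ι] [P.IsReduced] [Module.Free ℤ X] :
    GrpAlg X →ₐ[invGrp P] AffineHecke b q :=
  { (grpToHecke b q).toRingHom with commutes' := fun _ => rfl }

end Affine

/-! ### The graded affine Hecke algebra -/

section Graded

variable {P} (b : P.Base) (k : ℂ)

/-- The free algebra on the symbols `t_w` and the elements of `S(V)`. -/
abbrev GrFree : Type _ := FreeAlgebra ℂ (P.weylGroup ⊕ PolyAlg X)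

/-- The defining relations of the graded affine Hecke algebra with parameter `k`. The first three
say that `S(V)` maps to it by an algebra homomorphism, the next two that `ℂ[W]` does. -/
inductive GrRel : GrFree (P := P) → GrFree (P := P) → Prop
  | add (f g : PolyAlg X) : GrRel (FreeAlgebra.ι ℂ (.inr (f + g)))
      (FreeAlgebra.ι ℂ (.inr f) + FreeAlgebra.ι ℂ (.inr g))
  | mul (f g : PolyAlg X) : GrRel (FreeAlgebra.ι ℂ (.inr (f * g)))
      (FreeAlgebra.ι ℂ (.inr f) * FreeAlgebra.ι ℂ (.inr g))
  | scalar (c : ℂ) : GrRel (FreeAlgebra.ι ℂ (.inr (algebraMap ℂ (PolyAlg X) c)))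
      (algebraMap ℂ _ c)
  | t_one : GrRel (FreeAlgebra.ι ℂ (.inl 1)) 1
  | t_mul (w w' : P.weylGroup) :
      GrRel (FreeAlgebra.ι ℂ (.inl w) * FreeAlgebra.ι ℂ (.inl w'))
        (FreeAlgebra.ι ℂ (.inl (w * w')))
  | cross (i : ι) (hi : i ∈ b.support) (v : VC X) :
      GrRel (FreeAlgebra.ι ℂ (.inr (vec v)) * FreeAlgebra.ι ℂ (.inl (refl P i)) -
          FreeAlgebra.ι ℂ (.inl (refl P i)) * FreeAlgebra.ι ℂ (.inr (vec (actVC P (refl P i) v))))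
        (algebraMap ℂ _ (k * corootC P i v))

/-- The graded affine Hecke algebra `ℍ(V, R, Δ, k)`. -/
def GradedHecke : Type _ := RingQuot (GrRel b k)

instance : Ring (GradedHecke b k) := inferInstanceAs (Ring (RingQuot (GrRel b k)))

instance : Algebra ℂ (GradedHecke b k) := inferInstanceAs (Algebra ℂ (RingQuot (GrRel b k)))

/-- The quotient map from the free algebra. -/
def GradedHecke.mk : GrFree (P := P) →ₐ[ℂ] GradedHecke b k := RingQuot.mkAlgHom ℂ (GrRel b k)

/-- The generator `t_w`. -/
def t (w : P.weylGroup) : GradedHecke b k := GradedHecke.mk b k (FreeAlgebra.ι ℂ (.inl w))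

/-- The canonical homomorphism `S(V) → ℍ`. -/
def symToHecke : PolyAlg X →ₐ[ℂ] GradedHecke b k :=
  AlgHom.ofLinearMap
    { toFun := fun f => GradedHecke.mk b k (FreeAlgebra.ι ℂ (.inr f))
      map_add' := fun f g => by
        rw [← map_add]
        exact RingQuot.mkAlgHom_rel ℂ (GrRel.add f g)
      map_smul' := fun c f => by
        have h1 : GradedHecke.mk b k (FreeAlgebra.ι ℂ (.inr (c • f))) =
            GradedHecke.mk b k (FreeAlgebra.ι ℂ (.inr (algebraMap ℂ (PolyAlg X) c)) *
              FreeAlgebra.ι ℂ (.inr f)) := by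
          rw [Algebra.smul_def]
          exact RingQuot.mkAlgHom_rel ℂ (GrRel.mul _ f)
        have h2 : GradedHecke.mk b k (FreeAlgebra.ι ℂ (.inr (algebraMap ℂ (PolyAlg X) c))) =
            GradedHecke.mk b k (algebraMap ℂ _ c) :=
          RingQuot.mkAlgHom_rel ℂ (GrRel.scalar c)
        rw [h1, map_mul, h2, AlgHom.commutes, RingHom.id_apply, Algebra.smul_def] }
    (by
      have h := RingQuot.mkAlgHom_rel ℂ (GrRel.scalar (b := b) (k := k) 1)
      rw [map_one, map_one, map_one] at h
      exact h)
    (fun f g => by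
      change GradedHecke.mk b k _ = GradedHecke.mk b k _ * GradedHecke.mk b k _
      rw [← map_mul]
      exact RingQuot.mkAlgHom_rel ℂ (GrRel.mul f g))

lemma t_one : t b k 1 = 1 := by
  have h := RingQuot.mkAlgHom_rel ℂ (GrRel.t_one (b := b) (k := k))
  rwa [map_one] at h

lemma t_mul (w w' : P.weylGroup) : t b k w * t b k w' = t b k (w * w') := by
  have h := RingQuot.mkAlgHom_rel ℂ (GrRel.t_mul (b := b) (k := k) w w')
  rwa [map_mul] at h

lemma actSym_vec (w : P.weylGroup) (v : VC X) : actSym P w (vec v) = vec (actVC P w v) := by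
  simp [actSym]

lemma corootC_smul_root (i : ι) (v : VC X) :
    v - actVC P (refl P i) v = corootC P i v • (1 ⊗ₜ[ℤ] P.root i) := by
  induction v using TensorProduct.induction_on with
  | zero => simp
  | add u v hu hv => rw [map_add, map_add, add_smul, ← hu, ← hv]; abel
  | tmul c x =>
    have h1 : actVC P (refl P i) (c ⊗ₜ[ℤ] x) = c ⊗ₜ[ℤ] (refl P i • x) := rfl
    have h2 : corootC P i (c ⊗ₜ[ℤ] x) = c * (P.toLinearMap x (P.coroot i) : ℤ) := by
      simp [corootC]
    rw [h1, h2, refl_smul, TensorProduct.tmul_sub, sub_sub_cancel, TensorProduct.tmul_smul,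
      mul_comm, mul_smul, Int.cast_smul_eq_zsmul, TensorProduct.smul_tmul', TensorProduct.smul_tmul',
      TensorProduct.smul_tmul', smul_eq_mul, mul_one]

/-- The cross relation for all elements of `S(V)`. -/
lemma cross_general (i : ι) (hi : i ∈ b.support) (f : PolyAlg X) :
    ∃ g : PolyAlg X, g * lin (P.root i) = f - actSym P (refl P i) f ∧
      symToHecke b k f * t b k (refl P i) -
        t b k (refl P i) * symToHecke b k (actSym P (refl P i) f) =
        algebraMap ℂ _ k * symToHecke b k g := by
  induction f using SymmetricAlgebra.induction with
  | algebraMap c =>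
    refine ⟨0, by simp, ?_⟩
    rw [AlgHom.commutes (actSym P _), AlgHom.commutes (symToHecke b k), map_zero, mul_zero,
      Algebra.commutes, sub_self]
  | ι v =>
    have h := RingQuot.mkAlgHom_rel ℂ (GrRel.cross (b := b) (k := k) i hi v)
    rw [map_sub, map_mul, map_mul, AlgHom.commutes] at h
    change symToHecke b k (vec v) * t b k (refl P i) -
      t b k (refl P i) * symToHecke b k (vec (actVC P (refl P i) v)) = _ at h
    refine ⟨algebraMap ℂ _ (corootC P i v), ?_, ?_⟩
    · rw [actSym_vec, ← map_sub, corootC_smul_root, map_smul, Algebra.smul_def]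
    · rw [actSym_vec, h, AlgHom.commutes, map_mul]
      rfl
  | mul f₁ f₂ h₁ h₂ =>
    obtain ⟨g₁, h₁, h₁'⟩ := h₁
    obtain ⟨g₂, h₂, h₂'⟩ := h₂
    refine ⟨g₁ * actSym P (refl P i) f₂ + f₁ * g₂, ?_, ?_⟩
    · rw [map_mul, add_mul, mul_right_comm, h₁, mul_assoc, h₂]; ring
    · rw [sub_eq_iff_eq_add] at h₁' h₂'
      rw [map_mul, map_mul, map_mul, mul_assoc, h₂', mul_add, ← mul_assoc _ (t b k _), h₁',
        map_add, map_mul, map_mul, ← mul_assoc (symToHecke b k f₁), ← Algebra.commutes k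
          (symToHecke b k f₁)]
      noncomm_ring
  | add f₁ f₂ h₁ h₂ =>
    obtain ⟨g₁, h₁, h₁'⟩ := h₁
    obtain ⟨g₂, h₂, h₂'⟩ := h₂
    refine ⟨g₁ + g₂, ?_, ?_⟩
    · rw [add_mul, h₁, h₂, map_add]; abel
    · rw [map_add, map_add, map_add, map_add, mul_add, mul_add, ← h₁', ← h₂', add_mul]; abel

lemma lin_root_ne_zero [Module.Free ℤ X] (i : ι) : lin (P.root i) ≠ (0 : PolyAlg X) := by
  intro h
  have h1 : SymmetricAlgebra.lift (corootC P i) (lin (P.root i)) = 2 := by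
    simp [lin, vec, corootC]
  rw [h, map_zero] at h1
  norm_num at h1

lemma mem_invSym {f : PolyAlg X} : f ∈ invSym P ↔ ∀ w, actSym P w f = f := by
  simp [invSym, Algebra.mem_iInf, AlgHom.mem_equalizer]

/-- The invariants are central in the graded affine Hecke algebra. -/
lemma invSym_central [Finite ι] [P.IsReduced] [Module.Free ℤ X] (f : invSym P)
    (h : GradedHecke b k) :
    symToHecke b k f * h = h * symToHecke b k f := by
  have hT : ∀ n (w : P.weylGroup), len b w = n →
      Commute (symToHecke b k f) (t b k w) := by
    intro n
    induction n using Nat.strong_induction_on with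
    | _ n ih =>
      rintro w rfl
      by_cases hw : w = 1
      · rw [hw, t_one]; exact Commute.one_right _
      obtain ⟨i, hi, v, rfl, hlen, hlt⟩ := exists_len_succ b w hw
      rw [← t_mul b k]
      refine Commute.mul_right ?_ (ih _ hlt v rfl)
      obtain ⟨g, hg, hg'⟩ := cross_general b k i hi f
      rw [mem_invSym.mp f.2, sub_self] at hg
      have hg0 : g = 0 := (mul_eq_zero.mp hg).resolve_right (lin_root_ne_zero i)
      rw [mem_invSym.mp f.2, hg0, map_zero, mul_zero, sub_eq_zero] at hg'
      exact hg'
  obtain ⟨h, rfl⟩ := RingQuot.mkAlgHom_surjective ℂ (GrRel b k) h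
  change Commute (symToHecke b k f) (GradedHecke.mk b k h)
  induction h using FreeAlgebra.induction with
  | grade0 c => rw [AlgHom.commutes]; exact Algebra.commutes' c _ |>.symm
  | grade1 x =>
    rcases x with w | g
    · exact hT _ w rfl
    · change Commute (symToHecke b k f) (symToHecke b k g)
      exact (Commute.all (f : PolyAlg X) g).map (symToHecke b k)
  | mul x y hx hy => rw [map_mul]; exact hx.mul_right hy
  | add x y hx hy => rw [map_add]; exact hx.add_right hy

/-- The graded affine Hecke algebra as an algebra over the invariants. -/
instance [Finite ι] [P.IsReduced] [Module.Free ℤ X] : Algebra (invSym P) (GradedHecke b k) :=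
  RingHom.toAlgebra' ((symToHecke b k).toRingHom.comp (invSym P).val.toRingHom)
    (invSym_central b k)

instance [Finite ι] [P.IsReduced] [Module.Free ℤ X] :
    IsScalarTower ℂ (invSym P) (GradedHecke b k) :=
  IsScalarTower.of_algebraMap_eq' (by
    ext c
    exact ((symToHecke b k).commutes c).symm)

/-- The canonical homomorphism `S(V) → ℍ`, linear over the invariants. -/
def symToHeckeInv [Finite ι] [P.IsReduced] [Module.Free ℤ X] :
    PolyAlg X →ₐ[invSym P] GradedHecke b k :=
  { (symToHecke b k).toRingHom with commutes' := fun _ => rfl }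

end Graded

/-! ### Completions -/

section Completion

variable {Z : Type*} [CommRing Z] [Algebra ℂ Z] (J : Ideal Z)

/-- The `J`-adic completion `Ẑ` of `Z`. -/
abbrev ZHat : Type _ := AdicCompletion J Z

/-- The ring of fractions of `Ẑ`. -/
abbrev ZFrac : Type _ := FractionRing (AdicCompletion J Z)

variable (B : Type*) [Ring B] [Algebra Z B]

/-- The completion `Ẑ ⊗_Z B` of a `Z`-algebra `B`. -/
def Hat : Type _ := ZHat J ⊗[Z] B

/-- The localized completion `Frac(Ẑ) ⊗_Z B` of a `Z`-algebra `B`. -/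
def HatF : Type _ := ZFrac J ⊗[Z] B

instance : Ring (Hat J B) := inferInstanceAs (Ring (ZHat J ⊗[Z] B))

instance : Algebra Z (Hat J B) := inferInstanceAs (Algebra Z (ZHat J ⊗[Z] B))

instance : Algebra ℂ (Hat J B) := inferInstanceAs (Algebra ℂ (ZHat J ⊗[Z] B))

instance : Ring (HatF J B) := inferInstanceAs (Ring (ZFrac J ⊗[Z] B))

instance : Algebra Z (HatF J B) := inferInstanceAs (Algebra Z (ZFrac J ⊗[Z] B))

instance : Algebra ℂ (HatF J B) := inferInstanceAs (Algebra ℂ (ZFrac J ⊗[Z] B))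

instance (A : Type*) [CommRing A] [Algebra Z A] : CommRing (Hat J A) :=
  inferInstanceAs (CommRing (ZHat J ⊗[Z] A))

instance (A : Type*) [CommRing A] [Algebra Z A] : CommRing (HatF J A) :=
  inferInstanceAs (CommRing (ZFrac J ⊗[Z] A))

/-- The canonical map `Ẑ ⊗_Z B → Frac(Ẑ) ⊗_Z B`. -/
def hatToF : Hat J B →ₐ[Z] HatF J B :=
  Algebra.TensorProduct.map (IsScalarTower.toAlgHom Z (ZHat J) (ZFrac J)) (AlgHom.id Z B)

/-- The canonical map `Ẑ → Frac(Ẑ) ⊗_Z B`. -/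
def zHatToF : ZHat J →ₐ[Z] HatF J B :=
  Algebra.TensorProduct.includeLeft.comp (IsScalarTower.toAlgHom Z (ZHat J) (ZFrac J))

variable {B} in
/-- The canonical map `B → Ẑ ⊗_Z B`. -/
def toHat : B →ₐ[Z] Hat J B := Algebra.TensorProduct.includeRight

variable {B} in
/-- The canonical map `B → Frac(Ẑ) ⊗_Z B`. -/
def toF : B →ₐ[Z] HatF J B := Algebra.TensorProduct.includeRight

variable {B} {C : Type*} [Ring C] [Algebra Z C]

/-- Functoriality of the completion. -/
def hatMap (f : B →ₐ[Z] C) : Hat J B →ₐ[Z] Hat J C :=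
  Algebra.TensorProduct.map (AlgHom.id Z (ZHat J)) f

/-- Functoriality of the localized completion. -/
def fMap (f : B →ₐ[Z] C) : HatF J B →ₐ[Z] HatF J C :=
  Algebra.TensorProduct.map (AlgHom.id Z (ZFrac J)) f

variable (B) in
/-- Reduction modulo `J ^ n`. -/
def hatReduce (n : ℕ) : Hat J B →ₐ[Z] (Z ⧸ J ^ n) ⊗[Z] B :=
  Algebra.TensorProduct.map (AdicCompletion.evalₐ J n) (AlgHom.id Z B)

/-- `e` is the exponential of `x ∈ B` in the completion of `B`: for every `n`, its image in the
quotient `B / J ^ n B` is the sum of the series `∑ x ^ m / m!`. That quotient is a finite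
dimensional complex vector space for the algebras considered here, so that convergence can be
tested on linear functionals. -/
def IsExp (x : B) (e : Hat J B) : Prop :=
  ∀ (n : ℕ) (φ : ((Z ⧸ J ^ n) ⊗[Z] B) →ₗ[ℂ] ℂ),
    HasSum (fun m : ℕ => (m.factorial : ℂ)⁻¹ * φ (hatReduce J B n (toHat J x) ^ m))
      (φ (hatReduce J B n e))

end Completion

/-! ### Central characters -/

/-- The point `t = exp(ζ)` of the torus `Hom(X, ℂˣ)`: `x(t) = e^{x(ζ)}`. -/
def expPoint (ζ : X →ₗ[ℤ] ℂ) : Multiplicative X →* ℂˣ where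
  toFun x := Units.mk0 (Complex.exp (ζ x.toAdd)) (Complex.exp_ne_zero _)
  map_one' := by ext; simp
  map_mul' x y := by ext; simp [Complex.exp_add]

/-- Evaluation of elements of `ℂ[X]` at a point `t` of the torus. -/
def evGrp (t : Multiplicative X →* ℂˣ) : GrpAlg X →ₐ[ℂ] ℂ :=
  AddMonoidAlgebra.lift ℂ ℂ X ((Units.coeHom ℂ).comp t)

/-- Evaluation of elements of `S(V)` at a point `ζ` of `V^* = Hom(X, ℂ)`. -/
def evSym (ζ : X →ₗ[ℤ] ℂ) : PolyAlg X →ₐ[ℂ] ℂ :=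
  SymmetricAlgebra.lift (LinearMap.liftBaseChange ℂ ζ)

/-- The maximal ideal `𝒥_{Wt}` of `ℂ[X]^W`. -/
def idealGrp (t : Multiplicative X →* ℂˣ) : Ideal (invGrp P) :=
  RingHom.ker ((evGrp t).comp (invGrp P).val)

/-- The maximal ideal `𝕁_{Wζ}` of `S(V)^W`. -/
def idealSym (ζ : X →ₗ[ℤ] ℂ) : Ideal (invSym P) :=
  RingHom.ker ((evSym ζ).comp (invSym P).val)

/-- `ζ` is real for the root system: `α(ζ) ∈ ℝ` for all roots `α`. -/
def IsReal (ζ : X →ₗ[ℤ] ℂ) : Prop := ∀ i, ∃ r : ℝ, ζ (P.root i) = r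

/-! ### The sign projectors and Lusztig's isomorphism -/

section Main

variable {P} [Finite ι] (b : P.Base)

/-- The sign projector `𝐒 = (∑ (1/q)^{l(w)})⁻¹ ∑ (-1/q)^{l(w)} T_w`. -/
def signAff (q : ℂ) : AffineHecke b q :=
  (∑ w : P.weylGroup, (1 / q) ^ len b w)⁻¹ • ∑ w : P.weylGroup, (-1 / q) ^ len b w • T b q w

/-- The sign projector `𝐬 = |W|⁻¹ ∑ (-1)^{l(w)} t_w`. -/
def signGr (k : ℂ) : GradedHecke b k :=
  (Nat.card P.weylGroup : ℂ)⁻¹ • ∑ w : P.weylGroup, (-1 : ℂ) ^ len b w • t b k w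

/-- `𝒢(α) = (θ_α q - 1) / (θ_α - 1)`. -/
def calG (J : Ideal (invGrp P)) (q : ℂ) (i : ι) : HatF J (GrpAlg X) :=
  toF J (q • θ (P.root i) - 1) * Ring.inverse (toF J (θ (P.root i) - 1))

/-- `g(α) = (α + k) / α`. -/
def smallG (J : Ideal (invSym P)) (k : ℂ) (i : ι) : HatF J (PolyAlg X) :=
  toF J (lin (P.root i) + algebraMap ℂ _ k) * Ring.inverse (toF J (lin (P.root i)))

variable [P.IsReduced] [Module.Free ℤ X]

/-- The element `τ_s`, defined by `τ_s + 1 = (T_s + 1) 𝒢(α)⁻¹`. -/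
def tauAff (J : Ideal (invGrp P)) (q : ℂ) (i : ι) : HatF J (AffineHecke b q) :=
  (toF J (T b q (refl P i)) + 1) * fMap J (grpToHeckeInv b q) (Ring.inverse (calG J q i)) - 1

/-- The element `τ̄_s`, defined by `τ̄_s + 1 = (t_s + 1) g(α)⁻¹`. -/
def tauGr (J : Ideal (invSym P)) (k : ℂ) (i : ι) : HatF J (GradedHecke b k) :=
  (toF J (t b k (refl P i)) + 1) * fMap J (symToHeckeInv b k) (Ring.inverse (smallG J k i)) - 1

/-- The canonical map `Ẑ ⊗ ℂ[X] → Frac(Ẑ) ⊗ ℋ`. -/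
def grpHatToF (J : Ideal (invGrp P)) (q : ℂ) : Hat J (GrpAlg X) →ₐ[invGrp P]
    HatF J (AffineHecke b q) :=
  (hatToF J (AffineHecke b q)).comp (hatMap J (grpToHeckeInv b q))

/-- The canonical map `Ẑ ⊗ S(V) → Frac(Ẑ) ⊗ ℍ`. -/
def symHatToF (J : Ideal (invSym P)) (k : ℂ) : Hat J (PolyAlg X) →ₐ[invSym P]
    HatF J (GradedHecke b k) :=
  (hatToF J (GradedHecke b k)).comp (hatMap J (symToHeckeInv b k))

/-- `j` is Lusztig's isomorphism: it maps `τ_s` to `τ̄_s` and `θ_x` to `e^x`, and it restricts to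
isomorphisms between the completions of the centers, of the commutative subalgebras, and of the
Hecke algebras. -/
structure IsLusztigIso (q k : ℂ) (I : Ideal (invGrp P)) (J : Ideal (invSym P))
    (j : HatF I (AffineHecke b q) ≃ₐ[ℂ] HatF J (GradedHecke b k)) : Prop where
  map_tau : ∀ i ∈ b.support, j (tauAff b I q i) = tauGr b J k i
  map_theta : ∀ x : X, ∃ e : Hat J (PolyAlg X), IsExp J (lin x) e ∧
    j (toF I (grpToHecke b q (θ x))) = symHatToF b J k e
  map_center : j '' Set.range (zHatToF I (AffineHecke b q)) =
    Set.range (zHatToF J (GradedHecke b k))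
  map_commutative : j '' Set.range (grpHatToF b I q) = Set.range (symHatToF b J k)
  map_hecke : j '' Set.range (hatToF I (AffineHecke b q)) =
    Set.range (hatToF J (GradedHecke b k))

end Main

end LusztigReduction

end

open LusztigReduction

open scoped TensorProduct

noncomputable section

/-! Both Hecke algebras act on their commutative subalgebras, ℂ[X] and S(V), by Demazure–Lusztig
operators. Over the fraction ring of the completed center the nonzero elements of these subalgebras
become invertible, T_s + 1 acts as (1 + s) ∘ 𝒢(α), and t_s + 1 acts as (1 + s) ∘ g(α). So τ_s and
τ̄_s both act as the reflection s itself. Each localized Hecke algebra therefore maps onto the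
twisted group algebra of W, and it does so injectively, because a surjective endomorphism of a
finite module is injective (`range_repBasis`, `repBasis_injective`). Any W-equivariant isomorphism κ
of the completed commutative algebras then yields j by conjugation (`exists_conj`), with τ_s going
to τ̄_s automatically.

The map κ is the exponential. Modulo a power of the maximal ideal of the center one has
finite-dimensional algebras, whose characters come from the W-translates of the base point. As ζ is
real on the roots, the values of x at these translates lie on the line ζ(x) + ℝ. There the logarithm
exists and is unique (`exists_log`, `log_unique`), and uniqueness makes it additive, equivariant and
inverse to the exponential (`exists_truncEquiv`).

No denominators appear between the completed Hecke algebras: with F(a) = (e^a - 1)/a one has κ(𝒢(α))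
= g(α) F(α + log q)/F(α), and F has no real zeros, so the quotient is a unit (`exists_unit_factor`,
`exists_hecke_iso`).

For the projectors, 𝐒(T_s + 1) = 0 and the invertibility of 𝒢(α) give 𝐒(τ_s + 1) = 0, hence j(𝐒)(t_s
+ 1) = 0 and j(𝐒) = j(𝐒)𝐬. Writing j(𝐒) = Σ f_w t_w with t_w 𝐬 = ±𝐬 gives j(𝐒) = a𝐬. The same
argument for the inverse of j gives an element b with j(b) a 𝐬 = 𝐬, and comparing coefficients at
t_1 shows j(b) a = 1 (`exists_sign_unit`).

It remains to see that the representations exist, that is, that the operators satisfy the braid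
relations. In the graded case the correction from moving a vector past a word depends only on the
Weyl group element (`grSum_eq`). In the affine case the relation is checked on the rank two root
lattice, type by type, and extended by independence of characters (`afWord_braid`); Matsumoto's
theorem then defines the operator of T_w. -/

namespace LusztigReduction

/-! ### Lengths, positive roots and the exchange property. -/

section Weyl

variable {ι X Y : Type*} [AddCommGroup X] [AddCommGroup Y] {P : RootDatum ι X Y}

/-- The product of the reflections in a word. -/
def wordProd (P : RootDatum ι X Y) (L : List ι) : P.weylGroup := (L.map (refl P)).prod

@[simp] lemma wordProd_nil : wordProd P [] = 1 := rfl

@[simp] lemma wordProd_cons (i : ι) (L : List ι) :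
    wordProd P (i :: L) = refl P i * wordProd P L := by simp [wordProd]

lemma wordProd_append (L M : List ι) :
    wordProd P (L ++ M) = wordProd P L * wordProd P M := by simp [wordProd]

lemma smul_ext {v w : P.weylGroup} (h : ∀ x : X, v • x = w • x) : v = w := by
  apply Subtype.ext
  apply RootPairing.Equiv.weightHom_injective P
  ext x
  exact h x

/-- `x` is a negative root. -/
def NegRoot (b : P.Base) (x : X) : Prop := ∃ k, P.root k = x ∧ ¬ b.IsPos k

/-- `x` is a positive root. -/
def PosRoot (b : P.Base) (x : X) : Prop := ∃ k, P.root k = x ∧ b.IsPos k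

lemma smul_root (w : P.weylGroup) (k : ι) : ∃ l, P.root l = w • P.root k :=
  ⟨_, (P.weylGroup_apply_root w k).symm⟩

lemma refl_smul_root_self (i : ι) : refl P i • P.root i = - P.root i := by
  have h3 : P.toLinearMap (P.root i) (P.coroot i) = 2 := P.root_coroot_two i
  rw [refl_smul, h3]; module

lemma refl_inv (i : ι) : (refl P i)⁻¹ = refl P i := inv_eq_of_mul_eq_one_left (refl_mul_self P i)

variable (b : P.Base)

/-- The height is the sum of the integer coordinates in the base, hence additive. This turns the
positivity questions below into integer arithmetic. -/
lemma height_combination {k l m : ι} (u v : ℤ)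
    (h : P.root k = u • P.root l + v • P.root m) :
    b.height k = u * b.height l + v * b.height m := by
  obtain ⟨f, -, -, hf⟩ := b.exists_root_eq_sum_int l
  obtain ⟨g, -, -, hg⟩ := b.exists_root_eq_sum_int m
  have hfg : P.root k = ∑ j ∈ b.support, (u • f + v • g) j • P.root j := by
    simp_rw [Pi.add_apply, Pi.smul_apply, add_smul, smul_assoc, Finset.sum_add_distrib,
      ← Finset.smul_sum, ← hf, ← hg, h]
  simp_rw [b.height_eq_sum hf, b.height_eq_sum hg, b.height_eq_sum hfg, Pi.add_apply,
    Pi.smul_apply, Finset.sum_add_distrib, smul_eq_mul, Finset.mul_sum]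

variable {b}

lemma NegRoot.not_posRoot {x : X} (h : NegRoot b x) : ¬ PosRoot b x := by
  rintro ⟨k, rfl, hk⟩
  obtain ⟨l, hl, hl'⟩ := h
  rw [P.root.injective hl] at hl'
  exact hl' hk

lemma negRoot_or_posRoot (b : P.Base) (w : P.weylGroup) (k : ι) :
    NegRoot b (w • P.root k) ∨ PosRoot b (w • P.root k) := by
  obtain ⟨l, hl⟩ := smul_root w k
  by_cases h : b.IsPos l
  · exact Or.inr ⟨l, hl, h⟩
  · exact Or.inl ⟨l, hl, h⟩

lemma PosRoot.neg {x : X} (h : PosRoot b x) : NegRoot b (-x) := by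
  obtain ⟨k, rfl, hk⟩ := h
  obtain ⟨l, hl⟩ := smul_root (refl P k) k
  rw [refl_smul_root_self] at hl
  refine ⟨l, hl, ?_⟩
  rw [RootPairing.Base.isPos_iff] at hk ⊢
  have := height_combination b (k := l) (l := k) (m := k) (-1) 0 (by rw [hl]; module)
  omega

lemma NegRoot.combination {x y z : X} (hx : NegRoot b x) (hy : NegRoot b y) (hz : ∃ k, P.root k = z)
    (u v : ℤ) (hu : 0 ≤ u) (hv : 0 ≤ v) (h : z = u • x + v • y) : NegRoot b z := by
  obtain ⟨k, rfl, hk⟩ := hx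
  obtain ⟨l, rfl, hl⟩ := hy
  obtain ⟨m, rfl⟩ := hz
  refine ⟨m, rfl, ?_⟩
  rw [RootPairing.Base.isPos_iff, not_lt] at *
  rw [height_combination b u v h]
  nlinarith

variable [Finite ι] [P.IsReduced]

/-- A simple reflection changes only the coordinate at its own simple root, so it cannot make
another positive root negative. -/
lemma PosRoot.refl_smul {i k : ι} (hi : i ∈ b.support) (hk : b.IsPos k) (hki : k ≠ i) :
    PosRoot b (refl P i • P.root k) := by
  have : Module.IsReflexive ℤ X := .of_isPerfPair P.toLinearMap
  refine ⟨P.reflectionPerm i k, ?_, hk.reflectionPerm hi hki⟩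
  rw [P.root_reflectionPerm]
  rfl

/-- The exchange property. -/
lemma exchange (L : List ι) (hL : ∀ i ∈ L, i ∈ b.support) (k : ι) (hk : b.IsPos k)
    (hneg : NegRoot b ((wordProd P L)⁻¹ • P.root k)) :
    ∃ L' : List ι, (∀ i ∈ L', i ∈ b.support) ∧ L'.length + 1 = L.length ∧
      wordProd P L' = refl P k * wordProd P L := by
  induction L generalizing k with
  | nil =>
    rw [wordProd_nil, inv_one, one_smul] at hneg
    exact absurd ⟨k, rfl, hk⟩ hneg.not_posRoot
  | cons j M ih =>
    by_cases hkj : k = j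
    -- When the root is the simple root of the first letter, multiplying by its reflection deletes
    -- that letter.
    · refine ⟨M, fun i hi => hL i (by simp [hi]), by simp, ?_⟩
      rw [wordProd_cons, ← mul_assoc, hkj, refl_mul_self, one_mul]
    -- Otherwise α_l = s_j(α_k) is still positive and induction applies to the tail; conjugation
    -- returns to k through s_j s_l = s_k s_j.
    · obtain ⟨l, hl, hl'⟩ := PosRoot.refl_smul (hL j (by simp)) hk hkj
      obtain ⟨M', hM', hlen, hprod⟩ := ih (fun i hi => hL i (by simp [hi])) l hl' (by
        rwa [hl, smul_smul, ← refl_inv j, ← mul_inv_rev, ← wordProd_cons])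
      refine ⟨j :: M', ?_, by simp [hlen], ?_⟩
      · intro i hi
        rcases List.mem_cons.mp hi with rfl | hi
        exacts [hL i (by simp), hM' i hi]
      · have h1 : l = P.reflectionPerm j k := by
          apply P.root.injective
          rw [hl, P.root_reflectionPerm]
          rfl
        rw [wordProd_cons, hprod, h1, refl_reflectionPerm, wordProd_cons, ← mul_assoc, ← mul_assoc,
          ← mul_assoc, refl_mul_self, one_mul, mul_assoc]

lemma exists_reduced (b : P.Base) (w : P.weylGroup) :
    ∃ L : List ι, (∀ i ∈ L, i ∈ b.support) ∧ L.length = len b w ∧ wordProd P L = w :=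
  exists_word_len b w

omit [Finite ι] [P.IsReduced] in
lemma len_wordProd_le {L : List ι} (hL : ∀ i ∈ L, i ∈ b.support) :
    len b (wordProd P L) ≤ L.length := len_le b L hL

lemma len_refl_mul_le {i : ι} (hi : i ∈ b.support) (w : P.weylGroup) :
    len b (refl P i * w) ≤ len b w + 1 := by
  obtain ⟨L, hL, hlen, rfl⟩ := exists_reduced b w
  rw [← wordProd_cons, ← hlen]
  refine len_wordProd_le (L := i :: L) ?_
  simpa using ⟨hi, hL⟩

/-- The exchange property removes a letter from a reduced word, and a simple reflection cannot
shorten by more than one. -/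
lemma len_refl_mul_of_neg {i : ι} (hi : i ∈ b.support) {w : P.weylGroup}
    (h : NegRoot b (w⁻¹ • P.root i)) : len b (refl P i * w) + 1 = len b w := by
  obtain ⟨L, hL, hlen, rfl⟩ := exists_reduced b w
  obtain ⟨L', hL', hlen', hprod⟩ := exchange L hL i (b.isPos_of_mem_support hi) h
  have h1 := len_wordProd_le hL'
  have h2 := len_refl_mul_le hi (refl P i * wordProd P L)
  rw [← mul_assoc, refl_mul_self, one_mul] at h2
  rw [hprod] at h1
  omega

lemma len_refl_mul_of_pos {i : ι} (hi : i ∈ b.support) {w : P.weylGroup}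
    (h : PosRoot b (w⁻¹ • P.root i)) : len b (refl P i * w) = len b w + 1 := by
  have h1 := len_refl_mul_of_neg hi (w := refl P i * w) (by
    rw [mul_inv_rev, refl_inv, mul_smul, refl_smul_root_self, smul_neg]
    exact h.neg)
  rwa [← mul_assoc, refl_mul_self, one_mul, eq_comm] at h1

lemma negRoot_of_len_lt {i : ι} (hi : i ∈ b.support) {w : P.weylGroup}
    (h : len b (refl P i * w) < len b w) : NegRoot b (w⁻¹ • P.root i) := by
  refine (negRoot_or_posRoot b _ _).resolve_right fun h1 => ?_
  have := len_refl_mul_of_pos hi h1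
  omega

lemma len_refl_mul_cases {i : ι} (hi : i ∈ b.support) (w : P.weylGroup) :
    len b (refl P i * w) = len b w + 1 ∨ len b (refl P i * w) + 1 = len b w :=
  (negRoot_or_posRoot b _ _).symm.imp (len_refl_mul_of_pos hi) (len_refl_mul_of_neg hi)

omit [Finite ι] [P.IsReduced] in
lemma len_one : len b (1 : P.weylGroup) = 0 := by
  have := len_wordProd_le (b := b) (L := []) (by simp)
  simpa using this

lemma len_refl {i : ι} (hi : i ∈ b.support) : len b (refl P i) = 1 := by
  have := len_refl_mul_cases hi (1 : P.weylGroup)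
  rw [mul_one, len_one] at this
  omega

end Weyl

/-! ### Alternating words in two letters. -/

section Words

variable {ι : Type*}

/-- The alternating word `i j i ...` of length `n`. -/
def alt (i j : ι) : ℕ → List ι
  | 0 => []
  | n + 1 => i :: alt j i n

@[simp] lemma alt_length (i j : ι) (n : ℕ) : (alt i j n).length = n := by
  induction n generalizing i j with
  | zero => rfl
  | succ n ih => simp [alt, ih]

lemma mem_alt {i j k : ι} {n : ℕ} (h : k ∈ alt i j n) : k = i ∨ k = j := by
  induction n generalizing i j with
  | zero => simp [alt] at h
  | succ n ih =>
    rcases List.mem_cons.mp h with h | h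
    exacts [Or.inl h, (ih h).symm]

end Words

/-! ### Rank two computations in the Weyl group and Matsumoto's theorem. -/

section Matsumoto

variable {ι X Y : Type*} [AddCommGroup X] [AddCommGroup Y] {P : RootDatum ι X Y}

/-- The roots `α_i, s_i(α_j), s_i s_j(α_i), ...`. -/
def altRoot (P : RootDatum ι X Y) (i j : ι) : ℕ → X
  | 0 => P.root i
  | n + 1 => refl P i • altRoot P j i n

lemma exists_altRoot (i j : ι) (n : ℕ) : ∃ k, P.root k = altRoot P i j n := by
  induction n generalizing i j with
  | zero => exact ⟨i, rfl⟩
  | succ n ih =>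
    obtain ⟨k, hk⟩ := ih j i
    rw [altRoot, ← hk]
    exact smul_root _ _

/-- The integer `⟨α_i, α_j^∨⟩`. -/
def pair (P : RootDatum ι X Y) (i j : ι) : ℤ := P.toLinearMap (P.root i) (P.coroot j)

lemma pair_self (i : ι) : pair P i i = 2 := P.root_coroot_two i

/-- The order of `s_i s_j`, in terms of the Cartan integers. -/
def braidLength (P : RootDatum ι X Y) (i j : ι) : ℕ :=
  if pair P i j * pair P j i = 0 then 2 else if pair P i j * pair P j i = 1 then 3
  -- The default 6 serves the product 3; no other product occurs for two distinct simple roots.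
  else if pair P i j * pair P j i = 2 then 4 else 6

lemma braidLength_comm (i j : ι) : braidLength P i j = braidLength P j i := by
  simp only [braidLength, mul_comm]

lemma refl_smul_left (i j : ι) (u v : ℤ) (x : X) :
    refl P i • (x + u • P.root i + v • P.root j) =
      x + (-u - v * pair P j i - P.toLinearMap x (P.coroot i)) • P.root i + v • P.root j := by
  rw [refl_smul]
  have h1 : P.toLinearMap (P.root i) (P.coroot i) = 2 := pair_self i
  have h2 : P.toLinearMap (P.root j) (P.coroot i) = pair P j i := rfl
  simp only [map_add, map_smul, LinearMap.add_apply, LinearMap.smul_apply, h1, h2, smul_eq_mul]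
  module

/-- The crystallographic restriction bounds the Cartan integers, and distinct simple roots pair
non-positively: only the types A₁ × A₁, A₂, B₂ and G₂ remain, the last two in both orientations. -/
lemma pair_cases [Finite ι] [P.IsReduced] (b : P.Base) {i j : ι} (hi : i ∈ b.support)
    (hj : j ∈ b.support) (hij : i ≠ j) :
    (pair P i j = 0 ∧ pair P j i = 0) ∨ (pair P i j = -1 ∧ pair P j i = -1) ∨
    (pair P i j = -1 ∧ pair P j i = -2) ∨ (pair P i j = -2 ∧ pair P j i = -1) ∨
    (pair P i j = -1 ∧ pair P j i = -3) ∨ (pair P i j = -3 ∧ pair P j i = -1) := by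
  have h1 := P.pairingIn_pairingIn_mem_set_of_isCrystal_of_isRed' i j
    (fun h => hij (P.root.injective h)) (b.root_ne_neg_of_ne hi hj hij)
  have h2 := b.pairingIn_le_zero_of_ne hij hi hj
  have e : ∀ i j, P.pairingIn ℤ i j = pair P i j := fun i j => P.algebraMap_pairingIn ℤ i j
  simp only [e] at h1 h2
  simp only [Set.mem_insert_iff, Set.mem_singleton_iff, Prod.mk.injEq] at h1
  omega

/-- The coordinates of the roots `altRoot`. -/
def altRootCoord (p q : ℤ) : ℕ → ℤ × ℤ
  | 0 => (1, 0)
  | n + 1 => (-(altRootCoord q p n).2 - (altRootCoord q p n).1 * q, (altRootCoord q p n).1)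

lemma altRoot_eq (i j : ι) (n : ℕ) :
    altRoot P i j n = (altRootCoord (pair P i j) (pair P j i) n).1 • P.root i +
      (altRootCoord (pair P i j) (pair P j i) n).2 • P.root j := by
  induction n generalizing i j with
  | zero => simp [altRoot, altRootCoord]
  | succ n ih =>
    rw [altRoot, ih j i, altRootCoord]
    have := refl_smul_left (P := P) i j (altRootCoord (pair P j i) (pair P i j) n).2
      (altRootCoord (pair P j i) (pair P i j) n).1 0
    simp only [map_zero, LinearMap.zero_apply, sub_zero, zero_add] at this
    rw [add_comm, this]

/-- The coordinates of the displacement of a vector under alternating words. -/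
def altCoord (p q x y : ℤ) : ℕ → ℤ × ℤ
  | 0 => (0, 0)
  | n + 1 => (-(altCoord q p y x n).2 - (altCoord q p y x n).1 * q - x, (altCoord q p y x n).1)

lemma alt_smul (i j : ι) (n : ℕ) (x : X) :
    wordProd P (alt i j n) • x = x +
      (altCoord (pair P i j) (pair P j i) (P.toLinearMap x (P.coroot i))
        (P.toLinearMap x (P.coroot j)) n).1 • P.root i +
      (altCoord (pair P i j) (pair P j i) (P.toLinearMap x (P.coroot i))
        (P.toLinearMap x (P.coroot j)) n).2 • P.root j := by
  induction n generalizing i j with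
  | zero => simp [alt, altCoord]
  | succ n ih =>
    rw [alt, wordProd_cons, mul_smul, ih j i, altCoord, add_right_comm, refl_smul_left]

variable [Finite ι] [P.IsReduced] {b : P.Base}

/-- The coordinates depend only on the two Cartan integers, so each of the six cases is a finite
numerical check. These are the positive roots of the rank two subsystem, and their number is the
braid length. -/
lemma altRoot_nonneg {i j : ι} (hi : i ∈ b.support) (hj : j ∈ b.support) (hij : i ≠ j)
    (n : ℕ) (hn : n < braidLength P i j) :
    ∃ u v : ℤ, 0 ≤ u ∧ 0 ≤ v ∧ altRoot P i j n = u • P.root i + v • P.root j := by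
  refine ⟨_, _, ?_, ?_, altRoot_eq i j n⟩ <;>
  · rcases pair_cases b hi hj hij with h | h | h | h | h | h <;>
    · rw [braidLength, h.1, h.2] at hn
      rw [h.1, h.2]
      norm_num at hn
      interval_cases n <;> decide

/-- The displacement of a vector x under an alternating word is a combination of the two roots whose
coefficients are linear in the two pairings of x. Comparing coefficients proves the relation on all
of X, not only on the root lattice. -/
lemma alt_braid {i j : ι} (hi : i ∈ b.support) (hj : j ∈ b.support) (hij : i ≠ j) :
    wordProd P (alt i j (braidLength P i j)) = wordProd P (alt j i (braidLength P i j)) := by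
  refine smul_ext fun x => ?_
  rw [alt_smul, alt_smul, add_right_comm _ (_ • P.root j)]
  congr 3 <;>
  · rcases pair_cases b hi hj hij with h | h | h | h | h | h <;>
    · rw [braidLength, h.1, h.2]
      simp [altCoord]
      try ring

/-- Peeling off the letters one at a time, each shortens what is left, since the root it tests is
the corresponding `altRoot`. -/
lemma len_alt {i j : ι} (hi : i ∈ b.support) (hj : j ∈ b.support) (n : ℕ) (w : P.weylGroup)
    (h : ∀ l < n, NegRoot b (w⁻¹ • altRoot P i j l)) :
    len b w = n + len b ((wordProd P (alt i j n))⁻¹ * w) := by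
  induction n generalizing i j w with
  | zero => simp [alt]
  | succ n ih =>
    have h1 := len_refl_mul_of_neg hi (h 0 (by omega))
    have h2 := ih hj hi (refl P i * w) fun l hl => by
      rw [mul_inv_rev, refl_inv, mul_smul]
      exact h (l + 1) (by omega)
    rw [alt, wordProd_cons, mul_inv_rev, refl_inv, mul_assoc]
    omega

/-- If `w` is shortened by two simple reflections, it has reduced words which start with the two
sides of the braid relation and agree afterwards. -/
lemma exists_braid_factor {i j : ι} (hi : i ∈ b.support) (hj : j ∈ b.support) (hij : i ≠ j)
    (w : P.weylGroup) (h1 : NegRoot b (w⁻¹ • P.root i)) (h2 : NegRoot b (w⁻¹ • P.root j)) :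
    ∃ v : P.weylGroup, w = wordProd P (alt i j (braidLength P i j)) * v ∧
      len b w = braidLength P i j + len b v := by
  refine ⟨(wordProd P (alt i j (braidLength P i j)))⁻¹ * w, by rw [mul_inv_cancel_left],
    len_alt hi hj _ _ fun l hl => ?_⟩
  -- Both simple roots become negative under w⁻¹, hence so does every root that is a non-negative
  -- combination of them.
  obtain ⟨u, v, hu, hv, huv⟩ := altRoot_nonneg hi hj hij l hl
  obtain ⟨k, hk⟩ := exists_altRoot (P := P) i j l
  refine h1.combination h2 ?_ u v hu hv ?_
  · rw [← hk]; exact smul_root _ _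
  · rw [huv, smul_add, smul_comm, smul_comm w⁻¹ v]

/-- Matsumoto's theorem: products over reduced words depend only on the Weyl group element. -/
theorem matsumoto {M : Type*} [Monoid M] (f : ι → M)
    (hf : ∀ i ∈ b.support, ∀ j ∈ b.support, i ≠ j →
      ((alt i j (braidLength P i j)).map f).prod = ((alt j i (braidLength P i j)).map f).prod)
    (L L' : List ι) (hL : ∀ i ∈ L, i ∈ b.support) (hL' : ∀ i ∈ L', i ∈ b.support)
    (h : wordProd P L = wordProd P L') (hlen : L.length = len b (wordProd P L))
    (hlen' : L'.length = len b (wordProd P L')) : (L.map f).prod = (L'.map f).prod := by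
  induction hn : L.length generalizing L L' with
  | zero =>
    have h1 : L'.length = 0 := by rw [hlen', ← h, ← hlen, hn]
    rw [List.length_eq_zero_iff] at hn h1
    rw [hn, h1]
  | succ n ih =>
    have hn' : L'.length = n + 1 := by rw [hlen', ← h, ← hlen, hn]
    obtain ⟨i, M, rfl⟩ := List.exists_cons_of_length_eq_add_one hn
    obtain ⟨j, M', rfl⟩ := List.exists_cons_of_length_eq_add_one hn'
    have hi : i ∈ b.support := hL i (by simp)
    have hj : j ∈ b.support := hL' j (by simp)
    have hM : ∀ i ∈ M, i ∈ b.support := fun i hi => hL i (by simp [hi])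
    have hM' : ∀ i ∈ M', i ∈ b.support := fun i hi => hL' i (by simp [hi])
    have reduced_tail : ∀ (k : ι) (N : List ι), k ∈ b.support → (∀ i ∈ N, i ∈ b.support) →
        (k :: N).length = len b (wordProd P (k :: N)) → N.length = len b (wordProd P N) := by
      intro k N hk hN h
      have h1 := len_wordProd_le (b := b) hN
      have h2 := len_refl_mul_le hk (wordProd P N)
      rw [List.length_cons, wordProd_cons] at h
      omega
    have hMlen := reduced_tail i M hi hM hlen
    have hMlen' := reduced_tail j M' hj hM' hlen'
    rw [List.length_cons, wordProd_cons] at hlen hlen'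
    simp only [List.length_cons, Nat.add_right_cancel_iff] at hn hn'
    rw [List.map_cons, List.prod_cons, List.map_cons, List.prod_cons]
    by_cases hij : i = j
    · subst hij
      rw [wordProd_cons, wordProd_cons, mul_right_inj] at h
      rw [ih M M' hM hM' h hMlen hMlen' hn]
    · rw [wordProd_cons, wordProd_cons] at h
      -- Both s_i and s_j shorten the element, so it has reduced words starting with either full
      -- side of the braid relation. Induction compares each tail with the tail of the word that has
      -- the same first letter, and `hf` compares these two words.
      obtain ⟨v, hv, hvlen⟩ := exists_braid_factor hi hj hij (refl P i * wordProd P M)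
        (negRoot_of_len_lt hi (by rw [← mul_assoc, refl_mul_self, one_mul]; omega))
        (by
          rw [h]
          exact negRoot_of_len_lt hj (by rw [← mul_assoc, refl_mul_self, one_mul]; omega))
      obtain ⟨N, hN, hNlen, rfl⟩ := exists_reduced b v
      have hpos : 0 < braidLength P i j := by
        unfold braidLength; split_ifs <;> omega
      obtain ⟨m, hm⟩ := Nat.exists_eq_add_one.mpr hpos
      have halt := alt_braid hi hj hij
      have hfij := hf i hi j hj hij
      rw [hm] at hv hvlen halt hfij
      have hv' := hv
      rw [halt, h] at hv'
      rw [alt, wordProd_cons, mul_assoc, mul_right_inj, ← wordProd_append] at hv hv'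
      have hmem : ∀ k l, k ∈ b.support → l ∈ b.support → ∀ a ∈ alt k l m ++ N, a ∈ b.support := by
        intro k l hk hl a ha
        rcases List.mem_append.mp ha with ha | ha
        · rcases mem_alt ha with rfl | rfl
          exacts [hk, hl]
        · exact hN a ha
      rw [ih M (alt j i m ++ N) hM (hmem j i hj hi) hv hMlen (by
          rw [← hv, ← hMlen, List.length_append, alt_length]; omega) hn,
        ih M' (alt i j m ++ N) hM' (hmem i j hi hj) hv' hMlen' (by
          rw [← hv', ← hMlen', List.length_append, alt_length]; omega) hn']
      rw [alt, alt, List.map_cons, List.prod_cons, List.map_cons, List.prod_cons] at hfij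
      rw [List.map_append, List.prod_append, List.map_append, List.prod_append, ← mul_assoc,
        ← mul_assoc, hfij]

end Matsumoto

/-! ### Divided differences and Demazure–Lusztig operators. -/

section Demazure

variable {Z A : Type*} [CommRing Z] [CommRing A] [IsDomain A] [Algebra Z A]

/-- The divided difference operator `f ↦ (f - s(f)) / δ`. -/
def demazure (s : A →ₐ[Z] A) (δ : A) (h0 : δ ≠ 0) (h : ∀ f, δ ∣ f - s f) : A →ₗ[Z] A where
  toFun f := (h f).choose
  map_add' f g := by
    apply mul_left_cancel₀ h0
    rw [mul_add, ← (h f).choose_spec, ← (h g).choose_spec, ← (h (f + g)).choose_spec, map_add]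
    abel
  map_smul' c f := by
    apply mul_left_cancel₀ h0
    rw [← (h (c • f)).choose_spec, map_smul, RingHom.id_apply, mul_smul_comm,
      ← (h f).choose_spec, smul_sub]

variable {s : A →ₐ[Z] A} {δ : A} {h0 : δ ≠ 0} {h : ∀ f, δ ∣ f - s f}

lemma mul_demazure (f : A) : δ * demazure s δ h0 h f = f - s f := (h f).choose_spec.symm

lemma demazure_eq {f g : A} (hg : δ * g = f - s f) : demazure s δ h0 h f = g :=
  mul_left_cancel₀ h0 (by rw [hg, mul_demazure])

/-- The twisted Leibniz rule, from fg - s(f)s(g) = (f - s(f))g + s(f)(g - s(g)). -/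
lemma demazure_mul (f g : A) :
    demazure s δ h0 h (f * g) = demazure s δ h0 h f * g + s f * demazure s δ h0 h g :=
  demazure_eq (by
    rw [mul_add, ← mul_assoc, mul_demazure, mul_left_comm, mul_demazure, map_mul]; ring)

lemma demazure_one : demazure s δ h0 h 1 = 0 := demazure_eq (by simp)

/-- The operator `f ↦ q s(f) + c (f - s(f)) / δ`. -/
def heckeOp (s : A →ₐ[Z] A) (δ : A) (h0 : δ ≠ 0) (h : ∀ f, δ ∣ f - s f) [Algebra ℂ Z] [Algebra ℂ A]
    [IsScalarTower ℂ Z A] (q c : ℂ) : Module.End Z A :=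
  q • s.toLinearMap + c • demazure s δ h0 h

variable [Algebra ℂ Z] [Algebra ℂ A] [IsScalarTower ℂ Z A] (q c : ℂ)

lemma heckeOp_apply (f : A) :
    heckeOp s δ h0 h q c f = q • s f + c • demazure s δ h0 h f := rfl

lemma heckeOp_mul (f g : A) : heckeOp s δ h0 h q c (f * g) =
    s f * heckeOp s δ h0 h q c g + c • (demazure s δ h0 h f * g) := by
  rw [heckeOp_apply, heckeOp_apply, demazure_mul, map_mul, smul_add, mul_add, mul_smul_comm,
    mul_smul_comm]
  abel

lemma heckeOp_one : heckeOp s δ h0 h q c 1 = algebraMap ℂ A q := by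
  rw [heckeOp_apply, map_one, demazure_one, smul_zero, add_zero, Algebra.algebraMap_eq_smul_one]

/-- The quadratic relation. -/
lemma heckeOp_quadratic (hs : ∀ f, s (s f) = f)
    (hδ : c • s δ + c • δ = (q - 1) • (δ * s δ)) (f : A) :
    heckeOp s δ h0 h q c (heckeOp s δ h0 h q c f) =
      (q - 1) • heckeOp s δ h0 h q c f + q • f := by
  have hsδ : s δ ≠ 0 := fun h' => h0 (by rw [← hs δ, h', map_zero])
  have hsc : ∀ (a : ℂ) (f : A), s (a • f) = a • s f := s.toLinearMap.map_smul_of_tower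
  have e1 := mul_demazure (s := s) (δ := δ) (h0 := h0) (h := h) f
  rw [heckeOp_apply, heckeOp_apply]
  set g := demazure s δ h0 h f
  have e2 : s δ * s g = s f - f := by rw [← map_mul, e1, map_sub, hs]
  have e3 := mul_demazure (s := s) (δ := δ) (h0 := h0) (h := h) (q • s f + c • g)
  set u := demazure s δ h0 h (q • s f + c • g)
  rw [map_add, hsc, hsc, hs] at e3 ⊢
  simp only [Algebra.smul_def, map_sub, map_one] at *
  -- The hypothesis `hδ` says c/δ + c/s(δ) = q - 1. After multiplication by δ s(δ) the claim is a
  -- polynomial identity modulo the defining equations of the divided differences.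
  apply mul_left_cancel₀ (mul_ne_zero h0 hsδ)
  set Q := algebraMap ℂ A q
  set C := algebraMap ℂ A c
  linear_combination (C * s δ) * e3 + (Q * C * δ - C ^ 2) * e2 - C ^ 2 * e1
    + (C * g + Q * (s f - f)) * hδ

end Demazure

/-! ### Coroots under the Weyl group, and signs of roots. -/

section Coroots

variable {ι X Y : Type*} [AddCommGroup X] [AddCommGroup Y] {P : RootDatum ι X Y}

lemma pairing_smul_perm (w : P.weylGroup) (x : X) (k : ι) :
    P.toLinearMap (w • x) (P.coroot (P.weylGroupToPerm w k)) = P.toLinearMap x (P.coroot k) := by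
  have h1 := congrArg (fun F => F (P.coroot (P.weylGroupToPerm w k)) x)
    w.1.weight_coweight_transpose
  have h2 := RootPairing.Hom.coroot_coweightMap_apply P P (P.weylGroupToPerm w k) w.1.toHom
  have h3 : w.1.toHom.indexEquiv.symm (P.weylGroupToPerm w k) = k :=
    w.1.toHom.indexEquiv.symm_apply_apply k
  rw [h3] at h2
  change w.1.coweightMap _ = P.coroot k at h2
  simp only [LinearMap.coe_comp, Function.comp_apply, LinearMap.dualMap_apply] at h1
  rw [h2] at h1
  exact h1

lemma perm_mul (v w : P.weylGroup) (k : ι) :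
    P.weylGroupToPerm (v * w) k = P.weylGroupToPerm v (P.weylGroupToPerm w k) := by
  rw [map_mul]; rfl

lemma root_perm (w : P.weylGroup) (k : ι) : P.root (P.weylGroupToPerm w k) = w • P.root k :=
  (P.weylGroup_apply_root w k).symm

lemma refl_perm (w : P.weylGroup) (k : ι) :
    refl P (P.weylGroupToPerm w k) = w * refl P k * w⁻¹ := by
  refine smul_ext fun x => ?_
  obtain ⟨y, rfl⟩ : ∃ y, x = w • y := ⟨w⁻¹ • x, (smul_inv_smul w x).symm⟩
  rw [refl_smul, pairing_smul_perm, mul_smul, mul_smul, inv_smul_smul, refl_smul, smul_sub,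
    root_perm, smul_comm w]

lemma actVC_mul (v w : P.weylGroup) (x : VC X) :
    actVC P (v * w) x = actVC P v (actVC P w x) := by
  rw [actVC, map_mul]
  exact LinearMap.congr_fun (LinearMap.baseChange_mul (R := ℤ) (A := ℂ) _ _) x

lemma actVC_one (x : VC X) : actVC P 1 x = x := by
  rw [actVC, map_one]
  exact LinearMap.congr_fun (LinearMap.baseChange_one (R := ℤ) (A := ℂ) (M := X)) x

lemma corootC_tmul (k : ι) (c : ℂ) (x : X) :
    corootC P k (c ⊗ₜ[ℤ] x) = c * (P.toLinearMap x (P.coroot k) : ℤ) := by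
  simp [corootC]

lemma actVC_tmul (w : P.weylGroup) (c : ℂ) (x : X) :
    actVC P w (c ⊗ₜ[ℤ] x) = c ⊗ₜ[ℤ] (w • x) := rfl

lemma corootC_perm (w : P.weylGroup) (v : VC X) (k : ι) :
    corootC P (P.weylGroupToPerm w k) (actVC P w v) = corootC P k v := by
  induction v using TensorProduct.induction_on with
  | zero => simp
  | add u v hu hv => rw [map_add, map_add, map_add, hu, hv]
  | tmul c x => rw [actVC_tmul, corootC_tmul, corootC_tmul, pairing_smul_perm]

/-- The index of the root `-α_k`. -/
def negIdx (P : RootDatum ι X Y) (k : ι) : ι := P.weylGroupToPerm (refl P k) k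

lemma root_negIdx (k : ι) : P.root (negIdx P k) = - P.root k := by
  rw [negIdx, root_perm, refl_smul_root_self]

lemma refl_negIdx (k : ι) : refl P (negIdx P k) = refl P k := by
  rw [negIdx, refl_perm, mul_inv_cancel_right]

lemma corootC_negIdx (k : ι) (v : VC X) : corootC P (negIdx P k) v = - corootC P k v := by
  have h1 := corootC_perm (refl P k) (actVC P (refl P k) v) k
  rw [← actVC_mul, refl_mul_self, actVC_one] at h1
  have h2 := congrArg (corootC P k) (corootC_smul_root (P := P) k v)
  have h3 : P.toLinearMap (P.root k) (P.coroot k) = 2 := P.root_coroot_two k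
  rw [map_sub, map_smul, corootC_tmul, h3, smul_eq_mul, Int.cast_ofNat] at h2
  rw [negIdx, h1]
  linear_combination -h2

/-- The sign of a root. -/
def rootSign (b : P.Base) (k : ι) : ℤ := by
  classical exact if b.IsPos k then 1 else -1

variable {b : P.Base}

lemma rootSign_of_pos {k : ι} (h : b.IsPos k) : rootSign b k = 1 := if_pos h

lemma rootSign_of_not_pos {k : ι} (h : ¬ b.IsPos k) : rootSign b k = -1 := if_neg h

lemma isPos_negIdx (k : ι) : b.IsPos (negIdx P k) ↔ ¬ b.IsPos k := by
  have := height_combination b (k := negIdx P k) (l := k) (m := k) (-1) 0 (by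
    rw [root_negIdx]; module)
  have h2 := b.height_ne_zero k
  rw [RootPairing.Base.isPos_iff, RootPairing.Base.isPos_iff]
  omega

lemma rootSign_negIdx (k : ι) : rootSign b (negIdx P k) = - rootSign b k := by
  by_cases h : b.IsPos k
  · rw [rootSign_of_pos h, rootSign_of_not_pos ((isPos_negIdx k).not.mpr (not_not.mpr h))]
  · rw [rootSign_of_not_pos h, rootSign_of_pos ((isPos_negIdx k).mpr h), neg_neg]

lemma isPos_perm_refl [Finite ι] [P.IsReduced] {i k : ι} (hi : i ∈ b.support) (hk : b.IsPos k)
    (hki : k ≠ i) : b.IsPos (P.weylGroupToPerm (refl P i) k) := by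
  obtain ⟨l, hl, hl'⟩ := PosRoot.refl_smul hi hk hki
  rw [← root_perm] at hl
  rwa [← P.root.injective hl]

lemma perm_negIdx (w : P.weylGroup) (k : ι) :
    P.weylGroupToPerm w (negIdx P k) = negIdx P (P.weylGroupToPerm w k) := by
  apply P.root.injective
  rw [root_perm, root_negIdx, root_negIdx, root_perm, smul_neg]

lemma negIdx_negIdx (k : ι) : negIdx P (negIdx P k) = k := by
  apply P.root.injective
  rw [root_negIdx, root_negIdx, neg_neg]

/-- Only ±α_i change sign under s_i, which reduces the inductive step of `grSum_eq` to two terms. -/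
lemma rootSign_perm_refl [Finite ι] [P.IsReduced] {i k : ι} (hi : i ∈ b.support)
    (hki : k ≠ i) (hki' : k ≠ negIdx P i) :
    rootSign b (P.weylGroupToPerm (refl P i) k) = rootSign b k := by
  by_cases h : b.IsPos k
  · rw [rootSign_of_pos h, rootSign_of_pos (isPos_perm_refl hi h hki)]
  · have h1 : negIdx P k ≠ i := fun h' => hki' (by rw [← h', negIdx_negIdx])
    have h2 := isPos_perm_refl hi ((isPos_negIdx k).mpr h) h1
    rw [perm_negIdx, isPos_negIdx] at h2
    rw [rootSign_of_not_pos h, rootSign_of_not_pos h2]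

end Coroots

/-! ### The polynomial representation of the graded algebra: the operators t_s form an action of W.
-/

section GradedRep

variable {ι X Y : Type*} [AddCommGroup X] [AddCommGroup Y] (P : RootDatum ι X Y)

lemma actSym_mul (v w : P.weylGroup) (f : PolyAlg X) :
    actSym P (v * w) f = actSym P v (actSym P w f) := by
  suffices h : actSym P (v * w) = (actSym P v).comp (actSym P w) from AlgHom.congr_fun h f
  apply SymmetricAlgebra.algHom_ext
  ext x
  exact (actSym_vec _ _).trans (by
    rw [actVC_mul, ← actSym_vec, ← actSym_vec]; rfl)

lemma actSym_one (f : PolyAlg X) : actSym P 1 f = f := by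
  suffices h : actSym P 1 = AlgHom.id ℂ _ from AlgHom.congr_fun h f
  apply SymmetricAlgebra.algHom_ext
  ext x
  exact (actSym_vec _ _).trans (by rw [actVC_one]; rfl)

/-- The action of `w` on `S(V)`, linear over the invariants. -/
def actSymInv (w : P.weylGroup) : PolyAlg X →ₐ[invSym P] PolyAlg X :=
  { (actSym P w).toRingHom with commutes' := fun z => mem_invSym.mp z.2 w }

lemma actSymInv_apply (w : P.weylGroup) (f : PolyAlg X) : actSymInv P w f = actSym P w f := rfl

lemma lin_root_dvd (i : ι) (f : PolyAlg X) : lin (P.root i) ∣ f - actSym P (refl P i) f := by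
  induction f using SymmetricAlgebra.induction with
  | algebraMap c => rw [AlgHom.commutes, sub_self]; exact dvd_zero _
  | ι v =>
    change _ ∣ vec v - actSym P (refl P i) (vec v)
    rw [actSym_vec, ← map_sub, corootC_smul_root, map_smul, Algebra.smul_def]
    exact dvd_mul_left _ _
  | mul f g hf hg =>
    rw [map_mul, ← sub_add_sub_cancel _ (actSym P (refl P i) f * g), ← sub_mul, ← mul_sub]
    exact dvd_add (hf.mul_right _) (hg.mul_left _)
  | add f g hf hg => rw [map_add, add_sub_add_comm]; exact dvd_add hf hg

lemma lin_root_dvd_inv (i : ι) (f : PolyAlg X) :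
    lin (P.root i) ∣ f - actSymInv P (refl P i) f := lin_root_dvd P i f

variable [Module.Free ℤ X]

/-- The action of `t_s` on the polynomial representation `S(V)`. -/
def grOp (k : ℂ) (i : ι) : Module.End (invSym P) (PolyAlg X) :=
  heckeOp (actSymInv P (refl P i)) (lin (P.root i)) (lin_root_ne_zero i) (lin_root_dvd_inv P i) 1 k

variable {P} (k : ℂ)

/-- The divided difference of a vector is the constant given by the coroot, so the twisted Leibniz
rule is already the cross relation. -/
lemma grOp_vec_mul (i : ι) (v : VC X) (f : PolyAlg X) :
    grOp P k i (vec v * f) = vec (actVC P (refl P i) v) * grOp P k i f +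
      (k * corootC P i v) • f := by
  have h : demazure (actSymInv P (refl P i)) (lin (P.root i)) (lin_root_ne_zero i)
      (lin_root_dvd_inv P i) (vec v) = algebraMap ℂ _ (corootC P i v) := demazure_eq (by
    rw [actSymInv_apply, actSym_vec, ← map_sub, corootC_smul_root, map_smul, Algebra.smul_def,
      mul_comm])
  rw [grOp, heckeOp_mul, h, ← Algebra.smul_def, smul_smul, actSymInv_apply, actSym_vec]

lemma grOp_one (i : ι) : grOp P k i 1 = 1 := by
  rw [grOp, heckeOp_one, map_one]

/-- The correction term in the commutation of a word in the `t_s` with a vector. -/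
def grSum (P : RootDatum ι X Y) (v : VC X) : List ι → (P.weylGroup → PolyAlg X) → PolyAlg X
  | [], _ => 0
  | i :: M, G => corootC P i (actVC P (wordProd P M) v) • G (wordProd P M) +
      grSum P v M (fun w => G (refl P i * w))

omit [Module.Free ℤ X] in
-- The correction term is a sum over the roots whose sign is changed by w. The right side sees the
-- word only through its Weyl group element, which is all that `grWord_eq` needs. A positive
-- inverted root and its negative contribute equally, each with a sign difference of absolute value
-- 2, whence the factor 4.
lemma grSum_eq [Fintype ι] [P.IsReduced] {b : P.Base} (v : VC X) (L : List ι)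
    (hL : ∀ i ∈ L, i ∈ b.support) (G : P.weylGroup → PolyAlg X) :
    (4 : ℂ) • grSum P v L G = ∑ l, (((rootSign b l -
      rootSign b (P.weylGroupToPerm (wordProd P L) l) : ℤ) : ℂ) * corootC P l v) •
        G (wordProd P L * refl P l) := by
  classical
  induction L generalizing G with
  | nil =>
    rw [grSum, smul_zero, eq_comm]
    refine Finset.sum_eq_zero fun l _ => ?_
    rw [wordProd_nil, map_one, Equiv.Perm.one_apply, sub_self, Int.cast_zero, zero_mul, zero_smul]
  | cons i M ih =>
    have hi : i ∈ b.support := hL i (by simp)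
    rw [grSum, smul_add, ih (fun j hj => hL j (by simp [hj])), ← eq_sub_iff_add_eq,
      ← Finset.sum_sub_distrib]
    rw [wordProd_cons]
    generalize wordProd P M = w
    -- In terms of the root w(l), the difference of the two sums records only the change of sign
    -- caused by the last reflection s_i.
    have hterm : ∀ l, (((rootSign b l - rootSign b (P.weylGroupToPerm (refl P i * w) l) : ℤ)
          : ℂ) * corootC P l v) • G (refl P i * w * refl P l) -
        (((rootSign b l - rootSign b (P.weylGroupToPerm w l) : ℤ) : ℂ) * corootC P l v) •
          G (refl P i * (w * refl P l)) =
        (((rootSign b (P.weylGroupToPerm w l) -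
            rootSign b (P.weylGroupToPerm (refl P i) (P.weylGroupToPerm w l)) : ℤ) : ℂ) *
          corootC P (P.weylGroupToPerm w l) (actVC P w v)) •
            G (refl P i * refl P (P.weylGroupToPerm w l) * w) := by
      intro l
      rw [perm_mul, corootC_perm, refl_perm, mul_assoc _ _ w,
        inv_mul_cancel_right, mul_assoc, ← sub_smul, ← sub_mul, ← Int.cast_sub]
      congr 3
      ring
    rw [Finset.sum_congr rfl fun l _ => hterm l,
      Equiv.sum_comp (P.weylGroupToPerm w) fun l => (((rootSign b l -
            rootSign b (P.weylGroupToPerm (refl P i) l) : ℤ) : ℂ) *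
          corootC P l (actVC P w v)) • G (refl P i * refl P l * w)]
    have hne : i ≠ negIdx P i := fun h => by
      have := rootSign_negIdx (b := b) i
      rw [← h, rootSign_of_pos (b.isPos_of_mem_support hi)] at this
      omega
    -- Only ±α_i survive, and they add up to the first term of `grSum`.
    rw [Finset.sum_eq_add i (negIdx P i) hne]
    · have h1 : rootSign b i = 1 := rootSign_of_pos (b.isPos_of_mem_support hi)
      have h2 : P.weylGroupToPerm (refl P i) i = negIdx P i := rfl
      rw [perm_negIdx, h2, negIdx_negIdx, rootSign_negIdx, h1, refl_negIdx, refl_mul_self, one_mul,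
        corootC_negIdx, smul_smul, ← add_smul]
      congr 1
      push_cast
      ring
    · rintro l - ⟨h1, h2⟩
      rw [rootSign_perm_refl hi h1 h2, sub_self, Int.cast_zero, zero_mul, zero_smul]
    · simp
    · simp

/-- The operator of a word in the `t_s` on the polynomial representation. -/
def grWord (P : RootDatum ι X Y) (k : ℂ) (L : List ι) : Module.End (invSym P) (PolyAlg X) :=
  (L.map (grOp P k)).prod

lemma grWord_cons (i : ι) (L : List ι) (f : PolyAlg X) :
    grWord P k (i :: L) f = grOp P k i (grWord P k L f) := by
  rw [grWord, List.map_cons, List.prod_cons]; rfl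

/-- When all words of one Weyl group element agree on f, the correction left by moving a vector past
a word can be written in terms of the common values G. -/
lemma grWord_vec_mul [Finite ι] [P.IsReduced] {b : P.Base} (v : VC X) (f : PolyAlg X)
    (G : P.weylGroup → PolyAlg X)
    (hG : ∀ L : List ι, (∀ i ∈ L, i ∈ b.support) → grWord P k L f = G (wordProd P L))
    (L : List ι) (hL : ∀ i ∈ L, i ∈ b.support) :
    grWord P k L (vec v * f) =
      vec (actVC P (wordProd P L) v) * G (wordProd P L) + k • grSum P v L G := by
  have hop : ∀ i ∈ b.support, ∀ w, grOp P k i (G w) = G (refl P i * w) := by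
    intro i hi w
    obtain ⟨M, hM, rfl⟩ := exists_word b w
    have h1 := hG M hM
    have h2 := hG (i :: M) (by simpa using ⟨hi, hM⟩)
    rw [grWord_cons, h1, wordProd_cons] at h2
    exact h2
  have hsum : ∀ i ∈ b.support, ∀ M : List ι, ∀ G' : P.weylGroup → PolyAlg X,
      grOp P k i (grSum P v M G') = grSum P v M (fun w => grOp P k i (G' w)) := by
    intro i hi M
    induction M with
    | nil => intro G'; exact map_zero _
    | cons j M ih =>
      intro G'
      rw [grSum, map_add, ih, grSum]
      congr 1
      exact (grOp P k i).map_smul_of_tower _ _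
  induction L with
  | nil =>
    have h := hG [] (by simp)
    rw [grSum, smul_zero, add_zero, ← h, wordProd_nil, actVC_one]
    rfl
  | cons i M ih =>
    have hi : i ∈ b.support := hL i (by simp)
    rw [grWord_cons, ih (fun j hj => hL j (by simp [hj])), map_add, grOp_vec_mul, hop i hi,
      (grOp P k i).map_smul_of_tower, hsum i hi, grSum, wordProd_cons, actVC_mul, smul_add,
      smul_smul, add_assoc]
    simp only [hop i hi]

/-- The operators `t_s` on `S(V)` define an action of the Weyl group. -/
lemma grWord_eq [Finite ι] [P.IsReduced] {b : P.Base} (L L' : List ι)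
    (hL : ∀ i ∈ L, i ∈ b.support) (hL' : ∀ i ∈ L', i ∈ b.support)
    (h : wordProd P L = wordProd P L') : grWord P k L = grWord P k L' := by
  have : Fintype ι := Fintype.ofFinite ι
  -- This set contains 1, which every t_s fixes, and is stable under multiplication by vectors,
  -- hence by all of S(V).
  let S : Set (PolyAlg X) := {f | ∀ L L' : List ι, (∀ i ∈ L, i ∈ b.support) →
    (∀ i ∈ L', i ∈ b.support) → wordProd P L = wordProd P L' → grWord P k L f = grWord P k L' f}
  have hvec : ∀ (v : VC X) (f), f ∈ S → vec v * f ∈ S := by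
    intro v f hf L L' hL hL' h
    let G : P.weylGroup → PolyAlg X := fun w => grWord P k (exists_word b w).choose f
    have hG : ∀ L : List ι, (∀ i ∈ L, i ∈ b.support) → grWord P k L f = G (wordProd P L) :=
      fun L hL => hf _ _ hL (exists_word b _).choose_spec.1
        (exists_word b (wordProd P L)).choose_spec.2.symm
    have h4 : grSum P v L G = grSum P v L' G := by
      have h5 : (4 : ℂ) ≠ 0 := by norm_num
      rw [← smul_right_injective (PolyAlg X) h5 |>.eq_iff]
      rw [grSum_eq v L hL, grSum_eq v L' hL', h]
    rw [grWord_vec_mul k v f G hG L hL, grWord_vec_mul k v f G hG L' hL', h4, h]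
  have hmul : ∀ g f, f ∈ S → g * f ∈ S := by
    intro g
    induction g using SymmetricAlgebra.induction with
    | algebraMap c =>
      intro f hf L L' hL hL' h
      rw [← Algebra.smul_def, LinearMap.map_smul_of_tower, LinearMap.map_smul_of_tower,
        hf L L' hL hL' h]
    | ι v => exact hvec v
    | mul g₁ g₂ h₁ h₂ => intro f hf; rw [mul_assoc]; exact h₁ _ (h₂ _ hf)
    | add g₁ g₂ h₁ h₂ =>
      intro f hf L L' hL hL' h
      rw [add_mul, map_add, map_add, h₁ f hf L L' hL hL' h, h₂ f hf L L' hL hL' h]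
  have hone : ∀ L : List ι, grWord P k L 1 = 1 := by
    intro L
    induction L with
    | nil => rfl
    | cons i L ih => rw [grWord_cons, ih, grOp_one]
  ext1 f
  have := hmul f 1 (fun L L' _ _ _ => by rw [hone, hone])
  rw [mul_one] at this
  exact this L L' hL hL' h

end GradedRep

/-! ### The polynomial representation of the affine algebra: quadratic and commutation relations. -/

section AffineRep

variable {ι X Y : Type*} [AddCommGroup X] [AddCommGroup Y] (P : RootDatum ι X Y)

lemma grpAlg_algHom_ext {B : Type*} [Semiring B] [Algebra ℂ B] {φ ψ : GrpAlg X →ₐ[ℂ] B}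
    (h : ∀ x, φ (θ x) = ψ (θ x)) : φ = ψ := by
  refine AlgHom.ext fun f => ?_
  induction f using AddMonoidAlgebra.induction_linear with
  | zero => rw [map_zero, map_zero]
  | add f g hf hg => rw [map_add, map_add, hf, hg]
  | single x c =>
    have hs : AddMonoidAlgebra.single x c = c • θ x := by simp [θ]
    rw [hs, map_smul, map_smul, h]

lemma actGrp_mul (v w : P.weylGroup) (f : GrpAlg X) :
    actGrp P (v * w) f = actGrp P v (actGrp P w f) := by
  suffices h : actGrp P (v * w) = (actGrp P v).comp (actGrp P w) from AlgHom.congr_fun h f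
  refine grpAlg_algHom_ext fun x => ?_
  change actGrp P _ (θ x) = actGrp P _ (actGrp P _ (θ x))
  rw [actGrp_θ, actGrp_θ, actGrp_θ, mul_smul]

lemma actGrp_one (f : GrpAlg X) : actGrp P 1 f = f := by
  suffices h : actGrp P 1 = AlgHom.id ℂ _ from AlgHom.congr_fun h f
  refine grpAlg_algHom_ext fun x => ?_
  change actGrp P _ (θ x) = θ x
  rw [actGrp_θ, one_smul]

/-- The action of `w` on `ℂ[X]`, linear over the invariants. -/
def actGrpInv (w : P.weylGroup) : GrpAlg X →ₐ[invGrp P] GrpAlg X :=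
  { (actGrp P w).toRingHom with commutes' := fun z => mem_invGrp.mp z.2 w }

lemma actGrpInv_apply (w : P.weylGroup) (f : GrpAlg X) : actGrpInv P w f = actGrp P w f := rfl

lemma one_sub_θ_dvd (i : ι) (f : GrpAlg X) :
    1 - θ (-P.root i) ∣ f - actGrpInv P (refl P i) f := by
  rw [actGrpInv_apply]
  induction f using AddMonoidAlgebra.induction_linear with
  | zero => simp
  | add f g hf hg => rw [map_add, add_sub_add_comm]; exact dvd_add hf hg
  | single x c =>
    obtain ⟨g, hg⟩ := exists_demazure_θ (P := P) i x
    have hs : AddMonoidAlgebra.single x c = c • θ x := by simp [θ]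
    rw [hs, map_smul, actGrp_θ, ← smul_sub, ← hg, ← smul_mul_assoc]
    exact dvd_mul_left _ _

lemma θ_zero : θ (0 : X) = 1 := rfl

lemma θ_injective : Function.Injective (θ : X → GrpAlg X) :=
  AddMonoidAlgebra.of_injective (R := ℂ) (M := X)

variable [Module.Free ℤ X]

/-- The action of `T_s` on the polynomial representation `ℂ[X]`. -/
def afOp (q : ℂ) (i : ι) : Module.End (invGrp P) (GrpAlg X) :=
  heckeOp (actGrpInv P (refl P i)) (1 - θ (-P.root i)) (one_sub_θ_ne_zero i)
    (one_sub_θ_dvd P i) q (q - 1)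

/-- The operator `q T_s⁻¹` on the polynomial representation. -/
def afOpInv (q : ℂ) (i : ι) : Module.End (invGrp P) (GrpAlg X) :=
  afOp P q i - algebraMap ℂ _ (q - 1)

variable {P} {q : ℂ}

lemma afOpInv_apply (i : ι) (f : GrpAlg X) :
    afOpInv P q i f = afOp P q i f - (q - 1) • f := rfl

lemma afOp_afOp (i : ι) (f : GrpAlg X) :
    afOp P q i (afOp P q i f) = (q - 1) • afOp P q i f + q • f := by
  refine heckeOp_quadratic (h0 := one_sub_θ_ne_zero (P := P) i) (h := one_sub_θ_dvd P i)
    (s := actGrpInv P (refl P i)) q (q - 1) (fun f => by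
      rw [actGrpInv_apply, actGrpInv_apply, ← actGrp_mul, refl_mul_self, actGrp_one]) ?_ f
  have h : θ (P.root i) * θ (-P.root i) = 1 := by
    rw [← θ_add, add_neg_cancel, θ_zero]
  rw [actGrpInv_apply, map_sub, map_one, actGrp_θ, smul_neg, refl_smul_root_self, neg_neg,
    ← smul_add]
  congr 1
  linear_combination -h

lemma afOp_afOpInv (i : ι) (f : GrpAlg X) : afOp P q i (afOpInv P q i f) = q • f := by
  rw [afOpInv_apply, map_sub, afOp_afOp, LinearMap.map_smul_of_tower, add_sub_cancel_left]

lemma afOpInv_afOp (i : ι) (f : GrpAlg X) : afOpInv P q i (afOp P q i f) = q • f := by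
  rw [afOpInv_apply, afOp_afOp, add_sub_cancel_left]

lemma afOp_θ_mul_zero {i : ι} {x : X} (hx : P.toLinearMap x (P.coroot i) = 0) (f : GrpAlg X) :
    afOp P q i (θ x * f) = θ x * afOp P q i f := by
  have h : refl P i • x = x := by rw [refl_smul, hx, zero_smul, sub_zero]
  rw [afOp, heckeOp_mul, demazure_eq (g := 0), zero_mul, smul_zero, add_zero, actGrpInv_apply,
    actGrp_θ, h]
  rw [actGrpInv_apply, actGrp_θ, h, sub_self, mul_zero]

/-- For pairing -1 the divided difference of θ_x is the single term -θ_y. It combines with θ_y T_s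
into θ_y (T_s - (q - 1)), and the last factor is q T_s⁻¹. -/
lemma afOp_θ_mul_one {i : ι} {x : X} (y : X) (hx : P.toLinearMap x (P.coroot i) = -1)
    (hy : x + P.root i = y) (f : GrpAlg X) :
    afOp P q i (θ x * f) = θ y * afOpInv P q i f := by
  have h : refl P i • x = y := by rw [refl_smul, hx, ← hy]; module
  have h1 : θ (-P.root i) * θ y = θ x := by rw [← θ_add, ← hy]; congr 1; abel
  rw [afOp, heckeOp_mul, demazure_eq (g := - θ y), actGrpInv_apply, actGrp_θ, h, ← afOp,
    afOpInv_apply, mul_sub, mul_smul_comm, neg_mul, smul_neg, ← sub_eq_add_neg]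
  rw [actGrpInv_apply, actGrp_θ, h]
  linear_combination h1

/-- For x = -α the divided difference has two terms, -θ_α and -1; the second produces the extra
summand. -/
lemma afOp_θ_mul_two (i : ι) (f : GrpAlg X) :
    afOp P q i (θ (-P.root i) * f) = θ (P.root i) * afOpInv P q i f - (q - 1) • f := by
  have h : refl P i • (-P.root i) = P.root i := by rw [smul_neg, refl_smul_root_self, neg_neg]
  have h1 : θ (P.root i) * θ (-P.root i) = 1 := by
    rw [← θ_add, add_neg_cancel, θ_zero]
  rw [afOp, heckeOp_mul, demazure_eq (g := - (1 + θ (P.root i))), actGrpInv_apply, actGrp_θ, h,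
    ← afOp, afOpInv_apply, mul_sub, mul_smul_comm]
  · simp only [Algebra.smul_def]; ring
  · rw [actGrpInv_apply, actGrp_θ, h]
    linear_combination h1

/-- Elements of the polynomial representation on which two operators agree. -/
def agree (u v : Module.End (invGrp P) (GrpAlg X)) : Set (GrpAlg X) := {f | u f = v f}

omit [Module.Free ℤ X] in
lemma mem_agree {u v : Module.End (invGrp P) (GrpAlg X)} {f : GrpAlg X} :
    f ∈ agree u v ↔ u f = v f := Iff.rfl

omit [Module.Free ℤ X] in
lemma agree_sub {u v : Module.End (invGrp P) (GrpAlg X)} {f g : GrpAlg X} (c : ℂ)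
    (hf : f ∈ agree u v) (hg : g ∈ agree u v) : f - c • g ∈ agree u v := by
  rw [mem_agree] at *
  rw [map_sub, map_sub, LinearMap.map_smul_of_tower, LinearMap.map_smul_of_tower, hf, hg]

omit [Module.Free ℤ X] in
lemma agree_of_smul {u v : Module.End (invGrp P) (GrpAlg X)} {f : GrpAlg X} {c : ℂ} (hc : c ≠ 0)
    (hf : c • f ∈ agree u v) : f ∈ agree u v := by
  rw [mem_agree] at *
  rw [LinearMap.map_smul_of_tower, LinearMap.map_smul_of_tower] at hf
  exact smul_right_injective _ hc hf

/-- If T_s v = v T_r holds at f, it holds at T_r f, because T_r and T_s satisfy the same quadratic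
relation. -/
lemma agree_stable (r s : ι) (v : Module.End (invGrp P) (GrpAlg X)) {f : GrpAlg X}
    (hf : f ∈ agree (afOp P q s * v) (v * afOp P q r)) :
    afOp P q r f ∈ agree (afOp P q s * v) (v * afOp P q r) := by
  rw [mem_agree, Module.End.mul_apply, Module.End.mul_apply] at *
  rw [← hf, afOp_afOp, afOp_afOp, map_add, LinearMap.map_smul_of_tower,
    LinearMap.map_smul_of_tower, ← hf]

/-- The sides of the braid relation agree on `1`, and the set where they agree is stable under the
translations in a sublattice. -/
structure BraidStable (P : RootDatum ι X Y) (q : ℂ) (i j : ι) (N : Set (GrpAlg X)) : Prop where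
  one_mem : 1 ∈ N
  sub_mem : ∀ f g, ∀ c : ℂ, f ∈ N → g ∈ N → f - c • g ∈ N
  smul_mem : ∀ f, ∀ c : ℂ, c ≠ 0 → c • f ∈ N → f ∈ N
  left_mem : ∀ f ∈ N, afOp P q i f ∈ N
  right_mem : ∀ f ∈ N, afOp P q j f ∈ N

namespace BraidStable

variable {i j : ι} {N : Set (GrpAlg X)} (hN : BraidStable P q i j N)
include hN

lemma symm : BraidStable P q j i N :=
  ⟨hN.one_mem, hN.sub_mem, hN.smul_mem, hN.right_mem, hN.left_mem⟩

lemma inv_mem {f : GrpAlg X} (hf : f ∈ N) : afOpInv P q i f ∈ N :=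
  hN.sub_mem _ _ _ (hN.left_mem f hf) hf

/-- For pairing -1 one has T_i θ_x T_i = q θ_y with y = x + α_i, so stability under one translation
passes to the next. -/
lemma step (hq : q ≠ 0) {x : X} (y : X) (hx : P.toLinearMap x (P.coroot i) = -1)
    (hy : x + P.root i = y) (h : ∀ f ∈ N, θ x * f ∈ N) (f : GrpAlg X) (hf : f ∈ N) :
    θ y * f ∈ N := by
  have h1 := hN.left_mem _ (h _ (hN.left_mem f hf))
  rw [afOp_θ_mul_one y hx hy, afOpInv_afOp, mul_smul_comm] at h1
  exact hN.smul_mem _ _ hq h1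

/-- The analogous identity is T_i θ_{-α} T_i + (q - 1) T_i = q θ_α. -/
lemma step_neg (hq : q ≠ 0) (h : ∀ f ∈ N, θ (-P.root i) * f ∈ N) (f : GrpAlg X) (hf : f ∈ N) :
    θ (P.root i) * f ∈ N := by
  have h0 := hN.left_mem f hf
  have h1 := hN.sub_mem _ _ (-(q - 1)) (hN.left_mem _ (h _ h0)) h0
  rw [afOp_θ_mul_two, afOpInv_afOp, mul_smul_comm, neg_smul, sub_neg_eq_add, sub_add_cancel] at h1
  exact hN.smul_mem _ _ hq h1

end BraidStable

end AffineRep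

/-! ### Operators that are combinations of group elements, and independence of characters. -/

section Independence

/-- An operator of the form `f ↦ Σ_w d_w w(f)`, with coefficients in the fraction field. -/
def IsComb {Z A W : Type*} [CommRing Z] [CommRing A] [Algebra Z A] [Fintype W]
    (act : W → A →ₐ[Z] A) (D : Module.End Z A) : Prop :=
  ∃ e : A, e ≠ 0 ∧ ∃ d : W → A, ∀ f, e * D f = ∑ w, d w * act w f

variable {Z A W : Type*} [CommRing Z] [CommRing A] [IsDomain A] [Algebra Z A] [Fintype W] [Group W]
  {act : W → A →ₐ[Z] A}

lemma IsComb.one (h1 : ∀ f, act 1 f = f) : IsComb act 1 := by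
  classical
  refine ⟨1, one_ne_zero, fun w => if w = 1 then 1 else 0, fun f => ?_⟩
  simp [h1]

omit [Group W] in
lemma IsComb.sub {D E : Module.End Z A} (hD : IsComb act D) (hE : IsComb act E) :
    IsComb act (D - E) := by
  obtain ⟨e, he, d, hd⟩ := hD
  obtain ⟨e', he', d', hd'⟩ := hE
  refine ⟨e * e', mul_ne_zero he he', fun w => e' * d w - e * d' w, fun f => ?_⟩
  simp only [sub_mul, Finset.sum_sub_distrib, mul_assoc, ← Finset.mul_sum, ← hd, ← hd']
  rw [LinearMap.sub_apply]
  ring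

lemma IsComb.heckeOp_mul [Algebra ℂ Z] [Algebra ℂ A] [IsScalarTower ℂ Z A]
    (hm : ∀ v w f, act (v * w) f = act v (act w f)) (h1 : ∀ f, act 1 f = f)
    (s : W) {δ : A} {h0 : δ ≠ 0} {h : ∀ f, δ ∣ f - act s f} {q c : ℂ}
    {D : Module.End Z A} (hD : IsComb act D) : IsComb act (heckeOp (act s) δ h0 h q c * D) := by
  obtain ⟨e, he, d, hd⟩ := hD
  have hinj : act s e ≠ 0 := fun h' => he (by
    rw [← h1 e, ← inv_mul_cancel s, hm, h', map_zero])
  -- Multiplied by δ, the operator is c + (qδ - c)s. The factor e clears the denominator of D, and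
  -- s(e) that of s ∘ D.
  refine ⟨e * act s e * δ, mul_ne_zero (mul_ne_zero he hinj) h0,
    fun w => c • (act s e * d w) + (q • δ - algebraMap ℂ A c) * (e * act s (d (s⁻¹ * w))),
    fun f => ?_⟩
  have e1 : ∑ w, act s (d (s⁻¹ * w)) * act w f = act s (e * D f) := by
    rw [hd, map_sum, ← Equiv.sum_comp (Equiv.mulLeft s)]
    refine Finset.sum_congr rfl fun w _ => ?_
    rw [Equiv.coe_mulLeft, inv_mul_cancel_left, hm, map_mul]
  have e2 : ∑ w, (c • (act s e * d w) + (q • δ - algebraMap ℂ A c) *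
      (e * act s (d (s⁻¹ * w)))) * act w f =
      c • (act s e * ∑ w, d w * act w f) + (q • δ - algebraMap ℂ A c) *
        (e * ∑ w, act s (d (s⁻¹ * w)) * act w f) := by
    simp only [Finset.mul_sum, Finset.smul_sum, ← Finset.sum_add_distrib]
    refine Finset.sum_congr rfl fun w _ => ?_
    simp only [Algebra.smul_def]
    ring
  rw [e2, e1, ← hd, Module.End.mul_apply, heckeOp_apply, map_mul]
  have e3 := mul_demazure (s := act s) (δ := δ) (h0 := h0) (h := h) (D f)
  simp only [Algebra.smul_def]
  linear_combination algebraMap ℂ A c * e * act s e * e3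

omit [Group W] in
-- Dedekind: the characters w ∘ χ of M are distinct, hence linearly independent, so vanishing on the
-- image of χ already kills all coefficients of D.
lemma IsComb.eq_zero {D : Module.End Z A} (hD : IsComb act D) {M : Type*} [Monoid M]
    (χ : M →* A) (hinj : ∀ v w, (∀ x, act v (χ x) = act w (χ x)) → v = w)
    (h : ∀ x, D (χ x) = 0) : D = 0 := by
  obtain ⟨e, he, d, hd⟩ := hD
  have hli := (linearIndependent_monoidHom M A).comp
    (fun w : W => ((act w : A →* A).comp χ)) fun v w hvw =>
      hinj v w fun x => DFunLike.congr_fun hvw x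
  rw [Fintype.linearIndependent_iff] at hli
  have hd0 := hli d (by
    ext x
    have := hd (χ x)
    rw [h, mul_zero] at this
    simpa using this.symm)
  ext1 f
  have := hd f
  simp only [hd0, zero_mul, Finset.sum_const_zero] at this
  exact (mul_eq_zero.mp this).resolve_left he

end Independence

/-! ### Translations preserving the braid relation in types A₂, B₂ and G₂. -/

section RankTwo

variable {ι X Y : Type*} [AddCommGroup X] [AddCommGroup Y] {P : RootDatum ι X Y}
  [Module.Free ℤ X] {q : ℂ} {i j : ι} {N : Set (GrpAlg X)}

/-- Moving θ to the left through each side turns every T into q T⁻¹, up to the correction (q - 1)q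
f, which is the same on both sides. What remains is the braid relation for the inverse operators at
f. -/
lemma BraidStable.mem_a2 (hN : BraidStable P q i j N) (hq : q ≠ 0) (hij : pair P i j = -1)
    (hji : pair P j i = -1)
    (hmem : ∀ f, f ∈ N ↔ afOp P q i (afOp P q j (afOp P q i f)) =
      afOp P q j (afOp P q i (afOp P q j f))) (f : GrpAlg X) (hf : f ∈ N) :
    θ (-P.root i - P.root j) * f ∈ N := by
  have hii : P.toLinearMap (P.root i) (P.coroot i) = 2 := pair_self i
  have hjj : P.toLinearMap (P.root j) (P.coroot j) = 2 := pair_self j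
  have hij' : P.toLinearMap (P.root i) (P.coroot j) = _ := hij
  have hji' : P.toLinearMap (P.root j) (P.coroot i) = _ := hji
  rw [hmem]
  rw [afOp_θ_mul_one (i := i) (-P.root j) (by simp [hii, hji']) (by abel), afOp_θ_mul_two, map_sub,
    LinearMap.map_smul_of_tower, afOp_afOpInv,
    afOp_θ_mul_one (i := i) (P.root i + P.root j) hji' (by abel)]
  rw [afOp_θ_mul_one (i := j) (-P.root i) (by simp [hjj, hij']) (by abel), afOp_θ_mul_two, map_sub,
    LinearMap.map_smul_of_tower, afOp_afOpInv,
    afOp_θ_mul_one (i := j) (P.root i + P.root j) hij' (by abel)]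
  -- The braid relation at this element has one side equal to a power of q times f; cancelling the
  -- operators on the other side gives the inverse relation at f.
  have h1 : afOpInv P q j (afOpInv P q i (afOpInv P q j f)) ∈ N :=
    hN.symm.inv_mem (hN.inv_mem (hN.symm.inv_mem hf))
  rw [hmem] at h1
  simp only [afOp_afOpInv, LinearMap.map_smul_of_tower] at h1
  have h2 := congrArg (fun g => afOpInv P q i (afOpInv P q j (afOpInv P q i g))) h1
  simp only [afOpInv_afOp, LinearMap.map_smul_of_tower] at h2
  rw [smul_right_injective _ hq (smul_right_injective _ hq (smul_right_injective _ hq h2))]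

/-- As in type A₂, with the simplification that α_i + α_j is orthogonal to the coroot of i. The
translations commute with T_i, and `key` treats the three other operators. -/
lemma BraidStable.mem_b2 (hN : BraidStable P q i j N) (hq : q ≠ 0) (hij : pair P i j = -1)
    (hji : pair P j i = -2)
    (hmem : ∀ f, f ∈ N ↔ afOp P q i (afOp P q j (afOp P q i (afOp P q j f))) =
      afOp P q j (afOp P q i (afOp P q j (afOp P q i f)))) (f : GrpAlg X) (hf : f ∈ N) :
    θ (-P.root i - P.root j) * f ∈ N := by
  have hii : P.toLinearMap (P.root i) (P.coroot i) = 2 := pair_self i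
  have hjj : P.toLinearMap (P.root j) (P.coroot j) = 2 := pair_self j
  have hij' : P.toLinearMap (P.root i) (P.coroot j) = _ := hij
  have hji' : P.toLinearMap (P.root j) (P.coroot i) = _ := hji
  have key : ∀ f, afOp P q j (afOp P q i (afOp P q j (θ (-P.root i - P.root j) * f))) =
      θ (P.root i + P.root j) * afOpInv P q j (afOpInv P q i (afOpInv P q j f)) -
        (q - 1) • q • f := by
    intro f
    rw [afOp_θ_mul_one (i := j) (-P.root i) (by simp [hjj, hij']) (by abel), afOp_θ_mul_two,
      map_sub, LinearMap.map_smul_of_tower, afOp_afOpInv,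
      afOp_θ_mul_one (i := j) (P.root i + P.root j) hij' (by abel)]
  rw [hmem, afOp_θ_mul_zero (i := i) (by simp [hii, hji']), key, key, map_sub,
    afOp_θ_mul_zero (i := i) (by simp [hii, hji']), LinearMap.map_smul_of_tower,
    LinearMap.map_smul_of_tower]
  have h1 : afOpInv P q j (afOpInv P q i (afOpInv P q j f)) ∈ N :=
    hN.symm.inv_mem (hN.inv_mem (hN.symm.inv_mem hf))
  rw [hmem] at h1
  simp only [afOp_afOpInv, LinearMap.map_smul_of_tower] at h1
  have h2 := congrArg (fun g => afOpInv P q j (afOpInv P q i (afOpInv P q j g))) h1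
  simp only [afOpInv_afOp, LinearMap.map_smul_of_tower] at h2
  rw [smul_right_injective _ hq (smul_right_injective _ hq (smul_right_injective _ hq h2))]

/-- Here 2α_i + α_j is orthogonal to the coroot of j, so its translations commute with T_j and only
five operators have to be moved. -/
lemma BraidStable.mem_g2 (hN : BraidStable P q i j N) (hq : q ≠ 0) (hij : pair P i j = -1)
    (hji : pair P j i = -3)
    (hmem : ∀ f, f ∈ N ↔
      afOp P q i (afOp P q j (afOp P q i (afOp P q j (afOp P q i (afOp P q j f))))) =
      afOp P q j (afOp P q i (afOp P q j (afOp P q i (afOp P q j (afOp P q i f))))))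
    (f : GrpAlg X) (hf : f ∈ N) :
    θ (-P.root i - P.root i - P.root j) * f ∈ N := by
  have hii : P.toLinearMap (P.root i) (P.coroot i) = 2 := pair_self i
  have hjj : P.toLinearMap (P.root j) (P.coroot j) = 2 := pair_self j
  have hij' : P.toLinearMap (P.root i) (P.coroot j) = _ := hij
  have hji' : P.toLinearMap (P.root j) (P.coroot i) = _ := hji
  have key : ∀ f, afOp P q i (afOp P q j (afOp P q i (afOp P q j (afOp P q i
      (θ (-P.root i - P.root i - P.root j) * f))))) =
      θ (P.root i + P.root i + P.root j) * afOpInv P q i (afOpInv P q j (afOpInv P q i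
        (afOpInv P q j (afOpInv P q i f)))) - (q - 1) • q • q • f := by
    intro f
    rw [afOp_θ_mul_one (i := i) (-P.root i - P.root j) (by simp [hii, hji']) (by abel),
      afOp_θ_mul_one (i := j) (-P.root i) (by simp [hjj, hij']) (by abel), afOp_θ_mul_two,
      map_sub, LinearMap.map_smul_of_tower, afOp_afOpInv,
      afOp_θ_mul_one (i := j) (P.root i + P.root j) hij' (by abel), map_sub,
      afOp_θ_mul_one (i := i) (P.root i + P.root i + P.root j) (by simp [hii, hji']) (by abel),
      LinearMap.map_smul_of_tower, LinearMap.map_smul_of_tower, afOp_afOpInv]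
  rw [hmem, afOp_θ_mul_zero (i := j) (by simp [hjj, hij']), key, key, map_sub,
    afOp_θ_mul_zero (i := j) (by simp [hjj, hij']), LinearMap.map_smul_of_tower,
    LinearMap.map_smul_of_tower, LinearMap.map_smul_of_tower]
  have h1 : afOpInv P q i (afOpInv P q j (afOpInv P q i (afOpInv P q j (afOpInv P q i f)))) ∈ N :=
    hN.inv_mem (hN.symm.inv_mem (hN.inv_mem (hN.symm.inv_mem (hN.inv_mem hf))))
  rw [hmem] at h1
  simp only [afOp_afOpInv, LinearMap.map_smul_of_tower] at h1
  have h2 := congrArg (fun g => afOpInv P q i (afOpInv P q j (afOpInv P q i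
    (afOpInv P q j (afOpInv P q i g))))) h1
  simp only [afOpInv_afOp, LinearMap.map_smul_of_tower] at h2
  rw [smul_right_injective _ hq (smul_right_injective _ hq (smul_right_injective _ hq
    (smul_right_injective _ hq (smul_right_injective _ hq h2))))]

end RankTwo

/-! ### The braid relations on ℂ[X]. -/

section RankTwoClosure

variable {ι X Y : Type*} [AddCommGroup X] [AddCommGroup Y] {P : RootDatum ι X Y}
  [Module.Free ℤ X] {q : ℂ} {i j : ι} {N : Set (GrpAlg X)}

omit [Module.Free ℤ X] in
lemma BraidStable.mem_of_gens (h1 : ∀ f ∈ N, θ (P.root i) * f ∈ N)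
    (h2 : ∀ f ∈ N, θ (-P.root i) * f ∈ N) (h3 : ∀ f ∈ N, θ (P.root j) * f ∈ N)
    (h4 : ∀ f ∈ N, θ (-P.root j) * f ∈ N) {x : X}
    (hx : x ∈ AddSubgroup.closure {P.root i, P.root j}) (f : GrpAlg X) (hf : f ∈ N) :
    θ x * f ∈ N := by
  suffices h : ∀ f ∈ N, θ x * f ∈ N ∧ θ (-x) * f ∈ N from (h f hf).1
  induction hx using AddSubgroup.closure_induction with
  | mem y hy =>
    rcases hy with rfl | rfl
    exacts [fun f hf => ⟨h1 f hf, h2 f hf⟩, fun f hf => ⟨h3 f hf, h4 f hf⟩]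
  | zero => intro f hf; rw [neg_zero, θ_zero, one_mul]; exact ⟨hf, hf⟩
  | add y z _ _ hy hz =>
    intro f hf
    rw [neg_add, θ_add, θ_add, mul_assoc, mul_assoc]
    exact ⟨(hy _ (hz f hf).1).1, (hy _ (hz f hf).2).2⟩
  | neg y _ hy => intro f hf; rw [neg_neg]; exact (hy f hf).symm

/-- From -α_i - α_j, stepping with j, i and j again gives -α_i, α_i and α_i + α_j; sums of these
give ±α_j. -/
lemma BraidStable.mem_of_neg (hN : BraidStable P q i j N) (hq : q ≠ 0) (hij : pair P i j = -1)
    (h : ∀ f ∈ N, θ (-P.root i - P.root j) * f ∈ N) {x : X}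
    (hx : x ∈ AddSubgroup.closure {P.root i, P.root j}) (f : GrpAlg X) (hf : f ∈ N) :
    θ x * f ∈ N := by
  have hjj : P.toLinearMap (P.root j) (P.coroot j) = 2 := pair_self j
  have hij' : P.toLinearMap (P.root i) (P.coroot j) = _ := hij
  have h1 := hN.symm.step hq (x := -P.root i - P.root j) (-P.root i) (by simp [hjj, hij'])
    (by abel) h
  have h2 := hN.step_neg hq h1
  have h3 := hN.symm.step hq (P.root i + P.root j) hij' (by abel) h2
  refine mem_of_gens h2 h1 (fun f hf => ?_) (fun f hf => ?_) hx f hf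
  · rw [show P.root j = -P.root i + (P.root i + P.root j) by abel, θ_add, mul_assoc]
    exact h1 _ (h3 f hf)
  · rw [show -P.root j = P.root i + (-P.root i - P.root j) by abel, θ_add, mul_assoc]
    exact h2 _ (h f hf)

lemma BraidStable.neg_mem_of_commute (hij : pair P i j = 0)
    (hmem : ∀ f, f ∈ N ↔ afOp P q i (afOp P q j f) = afOp P q j (afOp P q i f))
    (f : GrpAlg X) (hf : f ∈ N) : θ (-P.root i) * f ∈ N := by
  have hij' : P.toLinearMap (P.root i) (P.coroot j) = _ := hij
  rw [hmem, afOp_θ_mul_zero (i := j) (by simp [hij']), afOp_θ_mul_two, afOp_θ_mul_two, map_sub,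
    afOp_θ_mul_zero hij', LinearMap.map_smul_of_tower, afOpInv_apply, afOpInv_apply, map_sub,
    LinearMap.map_smul_of_tower, (hmem f).mp hf]

/-- The product of the operators `T_s` in a word. -/
def afWord (P : RootDatum ι X Y) (q : ℂ) (L : List ι) : Module.End (invGrp P) (GrpAlg X) :=
  (L.map (afOp P q)).prod

lemma afWord_cons (i : ι) (L : List ι) : afWord P q (i :: L) = afOp P q i * afWord P q L := by
  simp [afWord]

/-- Each T_s multiplies 1 by q. So the two sides of a braid relation, having equal length, agree on
1. -/
lemma afWord_one (L : List ι) : afWord P q L 1 = algebraMap ℂ _ (q ^ L.length) := by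
  induction L with
  | nil => rw [List.length_nil, pow_zero, map_one (algebraMap ℂ (GrpAlg X))]; rfl
  | cons i L ih =>
    rw [afWord_cons, Module.End.mul_apply, ih, Algebra.algebraMap_eq_smul_one,
      LinearMap.map_smul_of_tower, afOp, heckeOp_one, Algebra.smul_def, ← map_mul,
      List.length_cons, pow_succ]

omit [AddCommGroup X] [AddCommGroup Y] [Module.Free ℤ X] in
lemma alt_succ_last (i j : ι) (n : ℕ) :
    alt i j (n + 1) = alt i j n ++ [if Even n then i else j] := by
  induction n generalizing i j with
  | zero => simp [alt]
  | succ n ih =>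
    rw [alt, ih, alt, List.cons_append]
    simp only [Nat.even_add_one]
    split_ifs <;> rfl

/-- The two alternating words share a middle v: they are T_i v and v T_r, where r is the last
letter. The parity of n decides which letter r is. -/
lemma agree_alt_stable (i j : ι) (n : ℕ) {f : GrpAlg X}
    (hf : f ∈ agree (afWord P q (alt i j (n + 1))) (afWord P q (alt j i (n + 1)))) :
    afOp P q (if Even n then j else i) f ∈
      agree (afWord P q (alt i j (n + 1))) (afWord P q (alt j i (n + 1))) := by
  have h1 : afWord P q (alt i j (n + 1)) = afOp P q i * afWord P q (alt j i n) := afWord_cons _ _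
  have h2 : afWord P q (alt j i (n + 1)) =
      afWord P q (alt j i n) * afOp P q (if Even n then j else i) := by
    rw [alt_succ_last]; simp [afWord]
  rw [h1, h2] at hf ⊢
  exact agree_stable _ _ _ hf

lemma braidStable_agree (i j : ι) (n : ℕ) :
    BraidStable P q i j
      (agree (afWord P q (alt i j (n + 1))) (afWord P q (alt j i (n + 1)))) := by
  have hstab : ∀ f ∈ agree (afWord P q (alt i j (n + 1))) (afWord P q (alt j i (n + 1))),
      afOp P q i f ∈ agree (afWord P q (alt i j (n + 1))) (afWord P q (alt j i (n + 1))) ∧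
      afOp P q j f ∈ agree (afWord P q (alt i j (n + 1))) (afWord P q (alt j i (n + 1))) := by
    intro f hf
    have h1 := agree_alt_stable i j n hf
    have h2 := (agree_alt_stable j i n (f := f) hf.symm).symm
    by_cases hn : Even n
    · simp only [hn, if_true] at h1 h2; exact ⟨h2, h1⟩
    · simp only [hn, if_false] at h1 h2; exact ⟨h1, h2⟩
  exact ⟨by rw [mem_agree, afWord_one, afWord_one, alt_length, alt_length],
    fun f g c => agree_sub c, fun f c => agree_of_smul, fun f hf => (hstab f hf).1,
    fun f hf => (hstab f hf).2⟩

lemma agree_alt_translate_of_short (hq : q ≠ 0) (hij : pair P i j = -1)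
    (hji : pair P j i = -1 ∨ pair P j i = -2 ∨ pair P j i = -3) {x : X}
    (hx : x ∈ AddSubgroup.closure {P.root i, P.root j}) :
    θ x ∈ agree (afWord P q (alt i j (braidLength P i j)))
      (afWord P q (alt j i (braidLength P i j))) := by
  rw [← mul_one (θ x)]
  have hji' : P.toLinearMap (P.root j) (P.coroot i) = pair P j i := rfl
  have hii : P.toLinearMap (P.root i) (P.coroot i) = 2 := pair_self i
  rcases hji with h | h | h
  · have hm : braidLength P i j = 2 + 1 := by simp [braidLength, hij, h]
    rw [hm]
    have hN := braidStable_agree (P := P) (q := q) i j 2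
    exact hN.mem_of_neg hq hij (hN.mem_a2 hq hij h fun f => Iff.rfl) hx 1 hN.one_mem
  · have hm : braidLength P i j = 3 + 1 := by simp [braidLength, hij, h]
    rw [hm]
    have hN := braidStable_agree (P := P) (q := q) i j 3
    exact hN.mem_of_neg hq hij (hN.mem_b2 hq hij h fun f => Iff.rfl) hx 1 hN.one_mem
  · have hm : braidLength P i j = 5 + 1 := by simp [braidLength, hij, h]
    rw [hm]
    have hN := braidStable_agree (P := P) (q := q) i j 5
    refine hN.mem_of_neg hq hij ?_ hx 1 hN.one_mem
    -- In type G₂ the rank two computation gives -2α_i - α_j, whose pairing with the coroot of i is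
    -- -1; one step leads to -α_i - α_j.
    exact hN.step hq _ (by simp [hii, hji', h]) (by abel)
      (hN.mem_g2 hq hij h fun f => Iff.rfl)

variable [Finite ι] [P.IsReduced] {b : P.Base}

lemma agree_alt_translate (hq : q ≠ 0) (hi : i ∈ b.support) (hj : j ∈ b.support) (hij : i ≠ j)
    {x : X} (hx : x ∈ AddSubgroup.closure {P.root i, P.root j}) :
    afWord P q (alt i j (braidLength P i j)) (θ x) =
      afWord P q (alt j i (braidLength P i j)) (θ x) := by
  rcases pair_cases b hi hj hij with h | h | h | h | h | h
  · have hm : braidLength P i j = 1 + 1 := by simp [braidLength, h.1]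
    rw [hm, ← mul_one (θ x)]
    have hN := braidStable_agree (P := P) (q := q) i j 1
    have hmem : ∀ f, f ∈ agree (afWord P q (alt i j (1 + 1))) (afWord P q (alt j i (1 + 1))) ↔
        afOp P q i (afOp P q j f) = afOp P q j (afOp P q i f) := fun f => Iff.rfl
    have h1 := BraidStable.neg_mem_of_commute h.1 hmem
    have h2 := BraidStable.neg_mem_of_commute h.2 fun f => (hmem f).trans eq_comm
    exact BraidStable.mem_of_gens (hN.step_neg hq h1) h1 (hN.symm.step_neg hq h2) h2 hx 1
      hN.one_mem
  · exact agree_alt_translate_of_short hq h.1 (Or.inl h.2) hx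
  · exact agree_alt_translate_of_short hq h.1 (Or.inr (Or.inl h.2)) hx
  · rw [Set.pair_comm] at hx
    rw [braidLength_comm]
    exact (agree_alt_translate_of_short hq h.2 (Or.inr (Or.inl h.1)) hx).symm
  · exact agree_alt_translate_of_short hq h.1 (Or.inr (Or.inr h.2)) hx
  · rw [Set.pair_comm] at hx
    rw [braidLength_comm]
    exact (agree_alt_translate_of_short hq h.2 (Or.inr (Or.inr h.1)) hx).symm

instance fintype_subgroup_weylGroup (H : Subgroup P.weylGroup) : Fintype H := Fintype.ofFinite H

omit [P.IsReduced] in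
lemma isComb_afWord (i j : ι) (n : ℕ) :
    IsComb (fun w : Subgroup.closure {refl P i, refl P j} => actGrpInv P w)
      (afWord P q (alt i j n)) := by
  have hm : ∀ (v w : Subgroup.closure {refl P i, refl P j}) (f : GrpAlg X),
      actGrpInv P (v * w : Subgroup.closure {refl P i, refl P j}) f =
        actGrpInv P v (actGrpInv P w f) := fun v w f => actGrp_mul P v w f
  have h1 : ∀ f : GrpAlg X,
      actGrpInv P (1 : Subgroup.closure {refl P i, refl P j}) f = f := fun f => actGrp_one P f
  suffices h : ∀ L : List ι, (∀ k ∈ L, k = i ∨ k = j) →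
      IsComb (fun w : Subgroup.closure {refl P i, refl P j} => actGrpInv P w) (afWord P q L) from
    h _ fun k => mem_alt
  intro L hL
  induction L with
  | nil => exact IsComb.one h1
  | cons k L ih =>
    rw [afWord_cons]
    have hk : refl P k ∈ Subgroup.closure {refl P i, refl P j} := by
      rcases hL k (by simp) with rfl | rfl <;> exact Subgroup.subset_closure (by simp)
    exact IsComb.heckeOp_mul (act := fun w : Subgroup.closure {refl P i, refl P j} =>
      actGrpInv P w) hm h1 ⟨refl P k, hk⟩ (ih fun l hl => hL l (by simp [hl]))

omit [P.IsReduced] in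
-- An element u of the dihedral group moves every x by an element of Q. If u fixes Q, then uⁿx = x +
-- n(ux - x); as u has finite order and X is torsion-free, ux = x.
lemma eq_of_smul_eq {v w : Subgroup.closure {refl P i, refl P j}}
    (h : ∀ x ∈ AddSubgroup.closure {P.root i, P.root j},
      (v : P.weylGroup) • x = (w : P.weylGroup) • x) : v = w := by
  set Q := AddSubgroup.closure {P.root i, P.root j} with hQ
  have hsub : ∀ u ∈ Subgroup.closure {refl P i, refl P j}, ∀ x : X, u • x - x ∈ Q := by
    intro u hu
    induction hu using Subgroup.closure_induction with
    | mem u hu =>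
      intro x
      rcases hu with rfl | rfl <;>
      · rw [refl_smul, sub_sub_cancel_left]
        exact neg_mem (zsmul_mem (AddSubgroup.subset_closure (by simp)) _)
    | one => intro x; rw [one_smul, sub_self]; exact zero_mem _
    | mul u u' _ _ hu hu' =>
      intro x
      have := add_mem (hu (u' • x)) (hu' x)
      rwa [sub_add_sub_cancel, smul_smul] at this
    | inv u _ hu =>
      intro x
      have := neg_mem (hu (u⁻¹ • x))
      rwa [smul_inv_smul, neg_sub] at this
  have hfix : ∀ x ∈ Q, ((v⁻¹ * w : Subgroup.closure {refl P i, refl P j}) : P.weylGroup) • x = x := by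
    intro x hx
    rw [Subgroup.coe_mul, mul_smul, ← h x hx, Subgroup.coe_inv, inv_smul_smul]
  obtain ⟨u, hu⟩ : ∃ u : Subgroup.closure {refl P i, refl P j}, u = v⁻¹ * w := ⟨_, rfl⟩
  rw [← hu] at hfix
  suffices h1 : u = 1 by rw [h1, eq_comm, inv_mul_eq_one] at hu; exact hu
  apply Subtype.ext
  refine smul_ext fun x => ?_
  rw [Subgroup.coe_one, one_smul]
  have hpow : ∀ n : ℕ, (u : P.weylGroup) ^ n • x = x + n • ((u : P.weylGroup) • x - x) := by
    intro n
    induction n with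
    | zero => simp
    | succ n ih =>
      rw [pow_succ', mul_smul, ih, smul_add, smul_comm, hfix _ (hsub u u.2 x), succ_nsmul]
      abel
  have h2 := hpow (orderOf (u : P.weylGroup))
  rw [pow_orderOf_eq_one, one_smul, left_eq_add, ← natCast_zsmul, smul_eq_zero, sub_eq_zero] at h2
  exact h2.resolve_left (by exact_mod_cast (orderOf_pos (u : P.weylGroup)).ne')

/-- The braid relations for the operators `T_s` on the polynomial representation. -/
lemma afWord_braid (hq : q ≠ 0) (hi : i ∈ b.support) (hj : j ∈ b.support) (hij : i ≠ j) :
    afWord P q (alt i j (braidLength P i j)) = afWord P q (alt j i (braidLength P i j)) := by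
  rw [← sub_eq_zero]
  have h2 := isComb_afWord (P := P) (q := q) j i (braidLength P i j)
  rw [Set.pair_comm] at h2
  -- The difference of the two sides is a combination of dihedral group elements. These stay
  -- distinct on the lattice spanned by the two roots, where the difference is known to vanish.
  refine ((isComb_afWord i j (braidLength P i j)).sub h2).eq_zero
    (M := Multiplicative (AddSubgroup.closure {P.root i, P.root j}))
    { toFun := fun x => θ (x.toAdd : X)
      map_one' := rfl
      map_mul' := fun x y => by rw [toAdd_mul, AddSubgroup.coe_add, θ_add] } ?_ ?_
  · intro v w h
    refine eq_of_smul_eq fun x hx => θ_injective ?_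
    have : actGrp P v (θ x) = actGrp P w (θ x) := h (Multiplicative.ofAdd ⟨x, hx⟩)
    rwa [actGrp_θ, actGrp_θ] at this
  · intro x
    rw [LinearMap.sub_apply, sub_eq_zero]
    exact agree_alt_translate hq hi hj hij x.toAdd.2

end RankTwoClosure

/-! ### The representations of the two Hecke algebras. -/

section Reps

variable {ι X Y : Type*} [AddCommGroup X] [AddCommGroup Y] {P : RootDatum ι X Y}
  [Finite ι] [P.IsReduced] [Module.Free ℤ X] (b : P.Base)

/-- The operator of `T_w` on the polynomial representation `ℂ[X]`. -/
def afT (q : ℂ) (w : P.weylGroup) : Module.End (invGrp P) (GrpAlg X) :=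
  afWord P q (exists_reduced b w).choose

/-- By Matsumoto's theorem the choice of a reduced word in the definition is immaterial. -/
lemma afT_wordProd {q : ℂ} (hq : q ≠ 0) (L : List ι) (hL : ∀ i ∈ L, i ∈ b.support)
    (hlen : L.length = len b (wordProd P L)) : afT b q (wordProd P L) = afWord P q L := by
  obtain ⟨h1, h2, h3⟩ := (exists_reduced b (wordProd P L)).choose_spec
  exact matsumoto (afOp P q) (fun i hi j hj hij => afWord_braid hq hi hj hij) _ L h1 hL h3
    (by rw [h3, h2]) hlen

lemma afT_mul {q : ℂ} (hq : q ≠ 0) (v w : P.weylGroup) (h : len b (v * w) = len b v + len b w) :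
    afT b q v * afT b q w = afT b q (v * w) := by
  obtain ⟨L, hL, hLlen, rfl⟩ := exists_reduced b v
  obtain ⟨M, hM, hMlen, rfl⟩ := exists_reduced b w
  rw [afT_wordProd b hq L hL hLlen, afT_wordProd b hq M hM hMlen, ← wordProd_append,
    afT_wordProd b hq (L ++ M)]
  · simp [afWord]
  · intro i hi
    rcases List.mem_append.mp hi with hi | hi
    exacts [hL i hi, hM i hi]
  · rw [wordProd_append, h, List.length_append, hLlen, hMlen]

lemma afT_one {q : ℂ} (hq : q ≠ 0) : afT b q 1 = 1 := by
  have := afT_wordProd b hq [] (by simp) (by rw [wordProd_nil, len_one]; rfl)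
  exact this

lemma afT_refl {q : ℂ} (hq : q ≠ 0) {i : ι} (hi : i ∈ b.support) :
    afT b q (refl P i) = afOp P q i := by
  have := afT_wordProd b hq [i] (by simpa using hi) (by
    rw [wordProd_cons, wordProd_nil, mul_one, len_refl hi]; rfl)
  rw [wordProd_cons, wordProd_nil, mul_one] at this
  rw [this]
  simp [afWord]

/-- The polynomial representation of the affine Hecke algebra. -/
def affRep {q : ℂ} (hq : q ≠ 0) : AffineHecke b q →ₐ[ℂ] Module.End (invGrp P) (GrpAlg X) :=
  RingQuot.liftAlgHom ℂ ⟨FreeAlgebra.lift ℂ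
    (Sum.elim (afT b q) (Algebra.lmul (invGrp P) (GrpAlg X))), by
    intro x y h
    induction h with
    | add f g => simp only [map_add, FreeAlgebra.lift_ι_apply, Sum.elim_inr]
    | mul f g => simp only [map_mul, FreeAlgebra.lift_ι_apply, Sum.elim_inr]
    | scalar c =>
      simp only [FreeAlgebra.lift_ι_apply, Sum.elim_inr, AlgHom.commutes]
      ext1 f
      exact (Algebra.smul_def c f).symm
    | T_one => simp only [FreeAlgebra.lift_ι_apply, Sum.elim_inl, map_one, afT_one b hq]
    | T_mul v w h =>
      simp only [map_mul, FreeAlgebra.lift_ι_apply, Sum.elim_inl, afT_mul b hq v w h]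
    | quadratic i hi =>
      simp only [map_mul, map_add, map_sub, map_one, map_zero, FreeAlgebra.lift_ι_apply,
        Sum.elim_inl, afT_refl b hq hi, AlgHom.commutes]
      ext1 f
      change afOp P q i (afOp P q i f - q • f) + (afOp P q i f - q • f) = 0
      rw [map_sub, LinearMap.map_smul_of_tower, afOp_afOp, sub_smul, one_smul]
      abel
    | bernstein i hi x g hg =>
      rw [map_sub, map_mul, map_mul, map_mul, AlgHom.commutes]
      simp only [FreeAlgebra.lift_ι_apply, Sum.elim_inl, Sum.elim_inr, afT_refl b hq hi]
      ext1 f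
      change afOp P q i (θ x * f) - θ (refl P i • x) * afOp P q i f = (q - 1) • (g * f)
      rw [afOp, heckeOp_mul, demazure_eq (g := g), actGrpInv_apply, actGrp_θ, add_sub_cancel_left]
      · rw [actGrpInv_apply, actGrp_θ, mul_comm, hg]⟩

lemma affRep_T {q : ℂ} (hq : q ≠ 0) (w : P.weylGroup) :
    affRep b hq (T b q w) = afT b q w := by
  refine (RingQuot.liftAlgHom_mkAlgHom_apply ..).trans ?_
  rw [FreeAlgebra.lift_ι_apply, Sum.elim_inl]

lemma affRep_grpToHecke {q : ℂ} (hq : q ≠ 0) (f g : GrpAlg X) :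
    affRep b hq (grpToHecke b q f) g = f * g := by
  have : affRep b hq (grpToHecke b q f) = Algebra.lmul (invGrp P) (GrpAlg X) f := by
    refine (RingQuot.liftAlgHom_mkAlgHom_apply ..).trans ?_
    rw [FreeAlgebra.lift_ι_apply, Sum.elim_inr]
  rw [this]
  rfl

/-- The operator of `t_w` on the polynomial representation `S(V)`. -/
def grT (k : ℂ) (w : P.weylGroup) : Module.End (invSym P) (PolyAlg X) :=
  grWord P k (exists_word b w).choose

lemma grT_wordProd (k : ℂ) (L : List ι) (hL : ∀ i ∈ L, i ∈ b.support) :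
    grT b k (wordProd P L) = grWord P k L :=
  grWord_eq k _ L (exists_word b _).choose_spec.1 hL (exists_word b _).choose_spec.2

lemma grT_mul (k : ℂ) (v w : P.weylGroup) : grT b k v * grT b k w = grT b k (v * w) := by
  obtain ⟨L, hL, rfl⟩ := exists_word b v
  obtain ⟨M, hM, rfl⟩ := exists_word b w
  change grT b k (wordProd P L) * grT b k (wordProd P M) =
    grT b k (wordProd P L * wordProd P M)
  rw [grT_wordProd b k L hL, grT_wordProd b k M hM, ← wordProd_append, grT_wordProd b k (L ++ M)]
  · simp [grWord]
  · intro i hi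
    rcases List.mem_append.mp hi with hi | hi
    exacts [hL i hi, hM i hi]

lemma grT_one (k : ℂ) : grT b k 1 = 1 := grT_wordProd b k [] (by simp)

lemma grT_refl (k : ℂ) {i : ι} (hi : i ∈ b.support) : grT b k (refl P i) = grOp P k i := by
  have := grT_wordProd b k [i] (by simpa using hi)
  rw [wordProd_cons, wordProd_nil, mul_one] at this
  rw [this]
  simp [grWord]

/-- The polynomial representation of the graded affine Hecke algebra. -/
def grRep (k : ℂ) : GradedHecke b k →ₐ[ℂ] Module.End (invSym P) (PolyAlg X) :=
  RingQuot.liftAlgHom ℂ ⟨FreeAlgebra.lift ℂ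
    (Sum.elim (grT b k) (Algebra.lmul (invSym P) (PolyAlg X))), by
    intro x y h
    induction h with
    | add f g => simp only [map_add, FreeAlgebra.lift_ι_apply, Sum.elim_inr]
    | mul f g => simp only [map_mul, FreeAlgebra.lift_ι_apply, Sum.elim_inr]
    | scalar c =>
      simp only [FreeAlgebra.lift_ι_apply, Sum.elim_inr, AlgHom.commutes]
      ext1 f
      exact (Algebra.smul_def c f).symm
    | t_one => simp only [FreeAlgebra.lift_ι_apply, Sum.elim_inl, map_one, grT_one]
    | t_mul v w => simp only [map_mul, FreeAlgebra.lift_ι_apply, Sum.elim_inl, grT_mul]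
    | cross i hi v =>
      rw [map_sub, map_mul, map_mul, AlgHom.commutes]
      simp only [FreeAlgebra.lift_ι_apply, Sum.elim_inl, Sum.elim_inr, grT_refl b k hi]
      ext1 f
      change vec v * grOp P k i f - grOp P k i (vec (actVC P (refl P i) v) * f) = (k * corootC P i v) • f
      have h1 := corootC_perm (refl P i) v i
      have h2 := corootC_negIdx (P := P) i (actVC P (refl P i) v)
      rw [negIdx, h1] at h2
      rw [grOp_vec_mul, ← actVC_mul, refl_mul_self, actVC_one, sub_add_cancel_left, ← neg_smul,
        ← mul_neg, ← h2]⟩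

lemma grRep_t (k : ℂ) (w : P.weylGroup) : grRep b k (t b k w) = grT b k w := by
  refine (RingQuot.liftAlgHom_mkAlgHom_apply ..).trans ?_
  rw [FreeAlgebra.lift_ι_apply, Sum.elim_inl]

lemma grRep_symToHecke (k : ℂ) (f g : PolyAlg X) :
    grRep b k (symToHecke b k f) g = f * g := by
  have : grRep b k (symToHecke b k f) = Algebra.lmul (invSym P) (PolyAlg X) f := by
    refine (RingQuot.liftAlgHom_mkAlgHom_apply ..).trans ?_
    rw [FreeAlgebra.lift_ι_apply, Sum.elim_inr]
  rw [this]
  rfl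

end Reps

/-! ### Both Hecke algebras are spanned over the commutative subalgebra by the elements of W. -/

section Span

variable {ι X Y : Type*} [AddCommGroup X] [AddCommGroup Y] {P : RootDatum ι X Y}
  [Finite ι] [P.IsReduced] (b : P.Base)

omit [Finite ι] [P.IsReduced] in
lemma T_sq (q : ℂ) {i : ι} (hi : i ∈ b.support) :
    T b q (refl P i) * T b q (refl P i) = (q - 1) • T b q (refl P i) + q • (1 : AffineHecke b q) := by
  have h := RingQuot.mkAlgHom_rel ℂ (AffRel.quadratic (b := b) (q := q) i hi)
  rw [map_mul, map_add, map_sub, map_one, map_zero, AlgHom.commutes] at h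
  change (T b q (refl P i) + 1) * (T b q (refl P i) - algebraMap ℂ (AffineHecke b q) q) = 0 at h
  rw [Algebra.algebraMap_eq_smul_one, add_mul, mul_sub, mul_smul_comm, mul_one, one_mul] at h
  rw [sub_smul, one_smul, ← sub_eq_zero, ← h]
  abel

lemma T_refl_mul (q : ℂ) {i : ι} (hi : i ∈ b.support) (w : P.weylGroup)
    (h : len b (refl P i * w) = len b w + 1) :
    T b q (refl P i) * T b q w = T b q (refl P i * w) :=
  T_mul b q _ _ (by rw [h, len_refl hi, add_comm])

lemma T_refl_mul' (q : ℂ) {i : ι} (hi : i ∈ b.support) (w : P.weylGroup)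
    (h : len b (refl P i * w) + 1 = len b w) :
    T b q (refl P i) * T b q w = (q - 1) • T b q w + q • T b q (refl P i * w) := by
  have h1 := T_refl_mul b q hi (refl P i * w) (by
    rw [← mul_assoc, refl_mul_self, one_mul, h])
  rw [← mul_assoc, refl_mul_self, one_mul] at h1
  conv_lhs => rw [← h1]
  rw [← mul_assoc, T_sq b q hi, add_mul, smul_mul_assoc, smul_mul_assoc, h1, one_mul]

/-- The elements of the form `Σ_w f_w T_w`. -/
lemma affineHecke_span [Module.Free ℤ X] (q : ℂ) (h : AffineHecke b q) :
    ∃ f : P.weylGroup → GrpAlg X, h = ∑ w, grpToHecke b q (f w) * T b q w := by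
  classical
  -- It suffices that this span contains 1 and is stable under left multiplication by the
  -- generators. The Bernstein relation moves T_s past the commutative factor.
  let S : Submodule ℂ (AffineHecke b q) :=
    Submodule.span ℂ {h | ∃ (f : GrpAlg X) (w : P.weylGroup), h = grpToHecke b q f * T b q w}
  have hmem : ∀ f w, grpToHecke b q f * T b q w ∈ S := fun f w => Submodule.subset_span ⟨f, w, rfl⟩
  have hA : ∀ (f : GrpAlg X), ∀ h ∈ S, grpToHecke b q f * h ∈ S := by
    intro f h hh
    induction hh using Submodule.span_induction with
    | mem h hh =>
      obtain ⟨g, w, rfl⟩ := hh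
      rw [← mul_assoc, ← map_mul]
      exact hmem _ _
    | zero => rw [mul_zero]; exact zero_mem _
    | add x y _ _ hx hy => rw [mul_add]; exact add_mem hx hy
    | smul c x _ hx => rw [mul_smul_comm]; exact S.smul_mem c hx
  have hT : ∀ i ∈ b.support, ∀ h ∈ S, T b q (refl P i) * h ∈ S := by
    intro i hi h hh
    induction hh using Submodule.span_induction with
    | mem h hh =>
      obtain ⟨f, w, rfl⟩ := hh
      obtain ⟨g, -, hg⟩ := bernstein_general b q i hi f
      rw [sub_eq_iff_eq_add] at hg
      rw [← mul_assoc, hg, add_mul, ← Algebra.smul_def, smul_mul_assoc, mul_assoc]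
      refine add_mem (S.smul_mem _ (hmem _ _)) (hA _ _ ?_)
      have hTw : ∀ v, T b q v ∈ S := fun v => by simpa using hmem 1 v
      rcases len_refl_mul_cases hi w with hw | hw
      · rw [T_refl_mul b q hi w hw]; exact hTw _
      · rw [T_refl_mul' b q hi w hw]
        exact add_mem (S.smul_mem _ (hTw _)) (S.smul_mem _ (hTw _))
    | zero => rw [mul_zero]; exact zero_mem _
    | add x y _ _ hx hy => rw [mul_add]; exact add_mem hx hy
    | smul c x _ hx => rw [mul_smul_comm]; exact S.smul_mem c hx
  have hTw : ∀ n (w : P.weylGroup), len b w = n → ∀ h ∈ S, T b q w * h ∈ S := by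
    intro n
    induction n using Nat.strong_induction_on with
    | _ n ih =>
      rintro w rfl h hh
      by_cases hw : w = 1
      · rwa [hw, T_one, one_mul]
      obtain ⟨i, hi, v, rfl, hlen, hlt⟩ := exists_len_succ b w hw
      rw [← T_mul b q _ _ hlen, mul_assoc]
      exact hT i hi _ (ih _ hlt v rfl h hh)
  have hall : ∀ h g, g ∈ S → h * g ∈ S := by
    intro h
    obtain ⟨h, rfl⟩ := RingQuot.mkAlgHom_surjective ℂ (AffRel b q) h
    change ∀ g ∈ S, AffineHecke.mk b q h * g ∈ S
    induction h using FreeAlgebra.induction with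
    | grade0 c =>
      intro g hg
      rw [AlgHom.commutes, ← Algebra.smul_def]
      exact S.smul_mem c hg
    | grade1 x =>
      rcases x with w | f
      exacts [hTw _ w rfl, hA f]
    | mul x y hx hy => intro g hg; rw [map_mul, mul_assoc]; exact hx _ (hy _ hg)
    | add x y hx hy => intro g hg; rw [map_add, add_mul]; exact add_mem (hx _ hg) (hy _ hg)
  have h1 : h ∈ S := by
    have := hall h 1 (by simpa [T_one] using hmem 1 1)
    rwa [mul_one] at this
  induction h1 using Submodule.span_induction with
  | mem h hh =>
    obtain ⟨f, w, rfl⟩ := hh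
    refine ⟨fun v => if v = w then f else 0, ?_⟩
    rw [Finset.sum_eq_single w (fun v _ hv => by simp [hv]) (by simp)]
    simp
  | zero => exact ⟨0, by simp⟩
  | add x y _ _ hx hy =>
    obtain ⟨f, rfl⟩ := hx
    obtain ⟨g, rfl⟩ := hy
    exact ⟨f + g, by simp [add_mul, Finset.sum_add_distrib]⟩
  | smul c x _ hx =>
    obtain ⟨f, rfl⟩ := hx
    exact ⟨c • f, by simp [Finset.smul_sum]⟩

lemma gradedHecke_span [Module.Free ℤ X] (k : ℂ) (h : GradedHecke b k) :
    ∃ f : P.weylGroup → PolyAlg X, h = ∑ w, symToHecke b k (f w) * t b k w := by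
  classical
  let S : Submodule ℂ (GradedHecke b k) :=
    Submodule.span ℂ {h | ∃ (f : PolyAlg X) (w : P.weylGroup), h = symToHecke b k f * t b k w}
  have hmem : ∀ f w, symToHecke b k f * t b k w ∈ S := fun f w => Submodule.subset_span ⟨f, w, rfl⟩
  have hA : ∀ (f : PolyAlg X), ∀ h ∈ S, symToHecke b k f * h ∈ S := by
    intro f h hh
    induction hh using Submodule.span_induction with
    | mem h hh =>
      obtain ⟨g, w, rfl⟩ := hh
      rw [← mul_assoc, ← map_mul]
      exact hmem _ _
    | zero => rw [mul_zero]; exact zero_mem _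
    | add x y _ _ hx hy => rw [mul_add]; exact add_mem hx hy
    | smul c x _ hx => rw [mul_smul_comm]; exact S.smul_mem c hx
  have hT : ∀ i ∈ b.support, ∀ h ∈ S, t b k (refl P i) * h ∈ S := by
    intro i hi h hh
    induction hh using Submodule.span_induction with
    | mem h hh =>
      obtain ⟨f, w, rfl⟩ := hh
      -- The cross relation carries the reflected element to the right of t_s, so it is applied to
      -- s(f) in order to rewrite t_s f.
      obtain ⟨g, -, hg⟩ := cross_general b k i hi (actSym P (refl P i) f)
      rw [← actSym_mul, refl_mul_self, actSym_one, sub_eq_iff_eq_add, ← sub_eq_iff_eq_add'] at hg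
      rw [← mul_assoc, ← hg, sub_mul, mul_assoc, t_mul, ← Algebra.smul_def, smul_mul_assoc]
      exact sub_mem (hmem _ _) (S.smul_mem _ (hmem _ _))
    | zero => rw [mul_zero]; exact zero_mem _
    | add x y _ _ hx hy => rw [mul_add]; exact add_mem hx hy
    | smul c x _ hx => rw [mul_smul_comm]; exact S.smul_mem c hx
  have hTw : ∀ n (w : P.weylGroup), len b w = n → ∀ h ∈ S, t b k w * h ∈ S := by
    intro n
    induction n using Nat.strong_induction_on with
    | _ n ih =>
      rintro w rfl h hh
      by_cases hw : w = 1
      · rwa [hw, t_one, one_mul]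
      obtain ⟨i, hi, v, rfl, hlen, hlt⟩ := exists_len_succ b w hw
      rw [← t_mul b k, mul_assoc]
      exact hT i hi _ (ih _ hlt v rfl h hh)
  have hall : ∀ h g, g ∈ S → h * g ∈ S := by
    intro h
    obtain ⟨h, rfl⟩ := RingQuot.mkAlgHom_surjective ℂ (GrRel b k) h
    change ∀ g ∈ S, GradedHecke.mk b k h * g ∈ S
    induction h using FreeAlgebra.induction with
    | grade0 c =>
      intro g hg
      rw [AlgHom.commutes, ← Algebra.smul_def]
      exact S.smul_mem c hg
    | grade1 x =>
      rcases x with w | f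
      exacts [hTw _ w rfl, hA f]
    | mul x y hx hy => intro g hg; rw [map_mul, mul_assoc]; exact hx _ (hy _ hg)
    | add x y hx hy => intro g hg; rw [map_add, add_mul]; exact add_mem (hx _ hg) (hy _ hg)
  have h1 : h ∈ S := by
    have := hall h 1 (by simpa [t_one] using hmem 1 1)
    rwa [mul_one] at this
  induction h1 using Submodule.span_induction with
  | mem h hh =>
    obtain ⟨f, w, rfl⟩ := hh
    refine ⟨fun v => if v = w then f else 0, ?_⟩
    rw [Finset.sum_eq_single w (fun v _ hv => by simp [hv]) (by simp)]
    simp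
  | zero => exact ⟨0, by simp⟩
  | add x y _ _ hx hy =>
    obtain ⟨f, rfl⟩ := hx
    obtain ⟨g, rfl⟩ := hy
    exact ⟨f + g, by simp [add_mul, Finset.sum_add_distrib]⟩
  | smul c x _ hx =>
    obtain ⟨f, rfl⟩ := hx
    exact ⟨c • f, by simp [Finset.smul_sum]⟩

end Span

/-! ### A finite group acting on a domain: norms, traces, separators, finiteness. -/

section Invariants

/-- A faithful action of a group `W` on a `Z`-algebra `A` whose invariants are `Z`. -/
structure InvAction (W Z A : Type*) [Group W] [CommRing Z] [CommRing A] [Algebra Z A] where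
  /-- The action. -/
  act : W →* (A →ₐ[Z] A)
  act_injective : Function.Injective act
  algebraMap_injective : Function.Injective (algebraMap Z A)
  exists_eq : ∀ a, (∀ w, act w a = a) → ∃ z, algebraMap Z A z = a

namespace InvAction

variable {W Z A : Type*} [Group W] [CommRing Z] [CommRing A] [Algebra Z A] (D : InvAction W Z A)

lemma act_mul_apply (v w : W) (a : A) : D.act (v * w) a = D.act v (D.act w a) := by
  rw [map_mul]; rfl

lemma act_one_apply (a : A) : D.act 1 a = a := by
  rw [map_one]; rfl

lemma act_inv_act (w : W) (a : A) : D.act w⁻¹ (D.act w a) = a := by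
  rw [← D.act_mul_apply, inv_mul_cancel, D.act_one_apply]

section Fintype

variable [Fintype W]

lemma act_sum (v : W) (a : A) : D.act v (∑ w, D.act w a) = ∑ w, D.act w a := by
  rw [map_sum]
  exact Fintype.sum_equiv (Equiv.mulLeft v) _ _ fun w => (D.act_mul_apply v w a).symm

/-- The sum over the group, with values in the invariants. -/
def trace : A →ₗ[Z] Z where
  toFun a := (D.exists_eq _ fun v => D.act_sum v a).choose
  map_add' a b := D.algebraMap_injective (by
    rw [map_add, (D.exists_eq _ fun v => D.act_sum v a).choose_spec,
      (D.exists_eq _ fun v => D.act_sum v b).choose_spec,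
      (D.exists_eq _ fun v => D.act_sum v (a + b)).choose_spec, ← Finset.sum_add_distrib]
    simp only [map_add])
  map_smul' c a := D.algebraMap_injective (by
    rw [RingHom.id_apply, smul_eq_mul, map_mul,
      (D.exists_eq _ fun v => D.act_sum v a).choose_spec,
      (D.exists_eq _ fun v => D.act_sum v (c • a)).choose_spec, Finset.mul_sum]
    simp only [Algebra.smul_def, map_mul, AlgHom.commutes])

lemma algebraMap_trace (a : A) : algebraMap Z A (D.trace a) = ∑ w, D.act w a :=
  (D.exists_eq _ fun v => D.act_sum v a).choose_spec

lemma exists_norm (a : A) : ∃ z : Z, algebraMap Z A z = ∏ w, D.act w a :=  by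
  obtain ⟨z, hz⟩ := D.exists_eq (∏ w, D.act w a) fun v => by
    rw [map_prod]
    exact Fintype.prod_equiv (Equiv.mulLeft v) _ _ fun w => (D.act_mul_apply v w a).symm
  exact ⟨z, hz⟩

omit [Fintype W] in
lemma act_ne_zero {a : A} (ha : a ≠ 0) (w : W) : D.act w a ≠ 0 := fun h =>
  ha (by rw [← D.act_inv_act w a, h, map_zero])

include D in
-- Every element divides its norm, which is invariant. Hence inverting the nonzero invariants
-- inverts all nonzero elements of A.
lemma exists_dvd [IsDomain A] {a : A} (ha : a ≠ 0) : ∃ z : Z, z ≠ 0 ∧ a ∣ algebraMap Z A z := by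
  obtain ⟨z, hz⟩ := D.exists_norm a
  refine ⟨z, ?_, ?_⟩
  · rintro rfl
    rw [map_zero, eq_comm, Finset.prod_eq_zero_iff] at hz
    obtain ⟨w, -, hw⟩ := hz
    exact D.act_ne_zero ha w hw
  · rw [hz]
    have := Finset.dvd_prod_of_mem (fun w => D.act w a) (Finset.mem_univ (1 : W))
    rwa [D.act_one_apply] at this

/-- The homomorphism `g ⊗ f ↦ g w(f)`. -/
def twistMul (w : W) : A ⊗[Z] A →ₐ[Z] A := Algebra.TensorProduct.productMap (AlgHom.id Z A) (D.act w)

omit [Fintype W] in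
lemma twistMul_tmul (w : W) (f g : A) : D.twistMul w (g ⊗ₜ f) = g * D.act w f := by
  simp [twistMul]

/-- For each w ≠ 1 choose a_w moved by w. The product of the tensors 1 ⊗ a_w - w(a_w) ⊗ 1 is killed
by g ⊗ f ↦ g w(f) for every w ≠ 1, but not for w = 1. Its expansion replaces a dual basis for the
trace form. -/
lemma exists_separator [IsDomain A] :
    ∃ (d : A) (n : ℕ) (g f : Fin n → A), d ≠ 0 ∧ ∑ j, g j * f j = d ∧
      ∀ w, w ≠ 1 → ∑ j, g j * D.act w (f j) = 0 := by
  classical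
  have hne : ∀ w : W, ∃ a : A, w ≠ 1 → D.act w a ≠ a := by
    intro w
    by_contra! h
    obtain ⟨hw, -⟩ := h 0
    refine hw (D.act_injective ?_)
    rw [map_one]
    ext a
    exact (h a).2
  choose a ha using hne
  set e : A ⊗[Z] A := ∏ w ∈ Finset.univ.erase (1 : W), (1 ⊗ₜ a w - D.act w (a w) ⊗ₜ 1) with he
  have h1 : D.twistMul 1 e ≠ 0 := by
    rw [he, map_prod, Finset.prod_ne_zero_iff]
    intro w hw
    rw [map_sub, D.twistMul_tmul, D.twistMul_tmul, D.act_one_apply, map_one, mul_one, one_mul,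
      sub_ne_zero]
    exact (ha w (Finset.ne_of_mem_erase hw)).symm
  have h2 : ∀ w, w ≠ 1 → D.twistMul w e = 0 := by
    intro w hw
    rw [he, map_prod]
    refine Finset.prod_eq_zero (Finset.mem_erase.mpr ⟨hw, Finset.mem_univ w⟩) ?_
    rw [map_sub, D.twistMul_tmul, D.twistMul_tmul, map_one, mul_one, one_mul, sub_self]
  clear_value e
  obtain ⟨n, g, f, rfl⟩ : ∃ (n : ℕ) (g f : Fin n → A), e = ∑ j, g j ⊗ₜ[Z] f j := by
    obtain ⟨s, rfl⟩ := TensorProduct.exists_finset e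
    refine ⟨s.card, fun j => (s.equivFin.symm j).1.1, fun j => (s.equivFin.symm j).1.2, ?_⟩
    rw [← Finset.sum_coe_sort s]
    exact Fintype.sum_equiv s.equivFin _ _ fun x => by simp
  refine ⟨_, n, g, f, h1, ?_, fun w hw => ?_⟩
  · simp [D.twistMul_tmul]
  · simpa [D.twistMul_tmul] using h2 w hw

include D in
/-- The algebra embeds in a free module of finite rank over the invariants. -/
lemma exists_embedding [IsDomain A] :
    ∃ (n : ℕ) (φ : A →ₗ[Z] (Fin n → Z)), Function.Injective φ := by
  obtain ⟨d, n, g, f, hd, h1, h2⟩ := D.exists_separator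
  refine ⟨n, LinearMap.pi fun j => D.trace ∘ₗ LinearMap.mulRight Z (f j), ?_⟩
  rw [injective_iff_map_eq_zero]
  intro a ha
  -- The separator kills every term of the trace except the one at w = 1, so the traces determine a.
  have h3 : ∑ j, g j * algebraMap Z A (D.trace (a * f j)) = d * a := by
    simp only [D.algebraMap_trace, Finset.mul_sum, map_mul]
    rw [Finset.sum_comm, Finset.sum_eq_single 1]
    · simp only [D.act_one_apply, ← h1, Finset.sum_mul]
      exact Finset.sum_congr rfl fun j _ => by ring
    · intro w _ hw
      have := congrArg (fun x => D.act w a * x) (h2 w hw)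
      simp only [Finset.mul_sum, mul_zero] at this
      rw [← this]
      exact Finset.sum_congr rfl fun j _ => by ring
    · simp
  have h4 : ∀ j, D.trace (a * f j) = 0 := fun j => congrFun ha j
  simp only [h4, map_zero, mul_zero, Finset.sum_const_zero] at h3
  exact (mul_eq_zero.mp h3.symm).resolve_left hd

include D in
-- Each a is a root of the product of the X - w(a), whose coefficients are invariant.
lemma isIntegral [Nontrivial A] : Algebra.IsIntegral Z A := by
  refine ⟨fun a => ?_⟩
  let p : Polynomial A := ∏ w : W, (Polynomial.X - Polynomial.C (D.act w a))
  have hp : ∀ v, p.map (D.act v).toRingHom = p := by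
    intro v
    simp only [p, Polynomial.map_prod, Polynomial.map_sub, Polynomial.map_X, Polynomial.map_C]
    exact Fintype.prod_equiv (Equiv.mulLeft v) _ _ fun w => by
      rw [Equiv.coe_mulLeft, D.act_mul_apply]; rfl
  have hlift : p ∈ Polynomial.lifts (algebraMap Z A) := by
    rw [Polynomial.lifts_iff_coeff_lifts]
    intro n
    exact D.exists_eq _ fun v => by
      conv_rhs => rw [← hp v, Polynomial.coeff_map]
      rfl
  have hmon : p.Monic := Polynomial.monic_prod_of_monic _ _ fun w _ => Polynomial.monic_X_sub_C _
  obtain ⟨r, hr, -, hr'⟩ := Polynomial.lifts_and_degree_eq_and_monic hlift hmon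
  refine ⟨r, hr', ?_⟩
  rw [← Polynomial.eval_map, hr]
  simp only [p, Polynomial.eval_prod]
  exact Finset.prod_eq_zero (Finset.mem_univ 1) (by simp)

include D in
lemma moduleFinite (k : Type*) [CommRing k] [Algebra k Z] [Algebra k A] [IsScalarTower k Z A]
    [Algebra.FiniteType k A] [Nontrivial A] : Module.Finite Z A := by
  have := D.isIntegral
  have : Algebra.FiniteType Z A := Algebra.FiniteType.of_restrictScalars_finiteType k Z A
  exact Algebra.IsIntegral.finite

include D in
-- By the Artin–Tate lemma Z is of finite type over k, because A is of finite type over k and finite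
-- over Z.
lemma isNoetherianRing (k : Type*) [Field k] [Algebra k Z] [Algebra k A] [IsScalarTower k Z A]
    [Algebra.FiniteType k A] [Nontrivial A] : IsNoetherianRing Z := by
  have := D.moduleFinite k
  have : Algebra.FiniteType k Z :=
    ⟨fg_of_fg_of_fg k Z A Algebra.FiniteType.out Module.Finite.fg_top D.algebraMap_injective⟩
  exact Algebra.FiniteType.isNoetherianRing k Z

end Fintype

end InvAction

end Invariants

/-! ### Pure tensors and denominators in the completions. -/

section HatLemmas

variable {Z : Type*} [CommRing Z] (J : Ideal Z)
  {B C : Type*} [Ring B] [Algebra Z B] [Ring C] [Algebra Z C]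

/-- The element `r ⊗ b` of the completion. -/
def hatTmul (r : ZHat J) (b : B) : Hat J B := r ⊗ₜ[Z] b

/-- The element `r ⊗ b` of the localized completion. -/
def fTmul (r : ZFrac J) (b : B) : HatF J B := r ⊗ₜ[Z] b

variable {J}

lemma hat_induction {p : Hat J B → Prop} (x : Hat J B) (h : ∀ r b, p (hatTmul J r b))
    (hadd : ∀ x y, p x → p y → p (x + y)) : p x :=
  TensorProduct.induction_on x (by simpa [hatTmul, TensorProduct.zero_tmul] using h 0 0) h hadd

lemma f_induction {p : HatF J B → Prop} (x : HatF J B) (h : ∀ r b, p (fTmul J r b))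
    (hadd : ∀ x y, p x → p y → p (x + y)) : p x :=
  TensorProduct.induction_on x (by simpa [fTmul, TensorProduct.zero_tmul] using h 0 0) h hadd

lemma hatTmul_mul (r r' : ZHat J) (b b' : B) :
    hatTmul J r b * hatTmul J r' b' = hatTmul J (r * r') (b * b') :=
  Algebra.TensorProduct.tmul_mul_tmul ..

lemma fTmul_mul (r r' : ZFrac J) (b b' : B) :
    fTmul J r b * fTmul J r' b' = fTmul J (r * r') (b * b') :=
  Algebra.TensorProduct.tmul_mul_tmul ..

lemma fTmul_add (r : ZFrac J) (b b' : B) : fTmul J r (b + b') = fTmul J r b + fTmul J r b' :=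
  TensorProduct.tmul_add ..

lemma toF_eq (b : B) : toF J b = fTmul J 1 b := rfl

lemma toHat_eq (b : B) : toHat J b = hatTmul J 1 b := rfl

lemma fMap_fTmul (f : B →ₐ[Z] C) (r : ZFrac J) (b : B) : fMap J f (fTmul J r b) = fTmul J r (f b) :=
  rfl

lemma hatMap_hatTmul (f : B →ₐ[Z] C) (r : ZHat J) (b : B) :
    hatMap J f (hatTmul J r b) = hatTmul J r (f b) := rfl

lemma hatToF_hatTmul (r : ZHat J) (b : B) :
    hatToF J B (hatTmul J r b) = fTmul J (algebraMap _ _ r) b := rfl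

lemma hatToF_toHat (b : B) : hatToF J B (toHat J b) = toF J b := by
  rw [toHat_eq, hatToF_hatTmul, map_one, toF_eq]

lemma fMap_toF (f : B →ₐ[Z] C) (b : B) : fMap J f (toF J b) = toF J (f b) := rfl

lemma hatToF_hatMap (f : B →ₐ[Z] C) (x : Hat J B) :
    hatToF J C (hatMap J f x) = fMap J f (hatToF J B x) := by
  induction x using hat_induction with
  | h r b => rfl
  | hadd x y hx hy => rw [map_add, map_add, map_add, map_add, hx, hy]

lemma exists_mul_eq_hatToF (y : HatF J B) :
    ∃ r ∈ nonZeroDivisors (ZHat J), ∃ x : Hat J B,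
    fTmul J (algebraMap _ _ r) 1 * y = hatToF J B x := by
  induction y using f_induction with
  | h s a =>
    obtain ⟨⟨x, m⟩, hxm⟩ := IsLocalization.surj (nonZeroDivisors (ZHat J)) s
    refine ⟨m, m.2, hatTmul J x a, ?_⟩
    rw [fTmul_mul, hatToF_hatTmul, ← hxm, one_mul, mul_comm]
  | hadd y y' hy hy' =>
    obtain ⟨r, hr, x, hx⟩ := hy
    obtain ⟨r', hr', x', hx'⟩ := hy'
    refine ⟨r * r', mul_mem hr hr', hatTmul J r' 1 * x + hatTmul J r 1 * x', ?_⟩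
    rw [map_add, map_mul _ (hatTmul J r' 1), map_mul _ (hatTmul J r 1), ← hx, ← hx', hatToF_hatTmul,
      hatToF_hatTmul, ← mul_assoc, ← mul_assoc, fTmul_mul, fTmul_mul, map_mul, mul_add, one_mul,
      mul_comm (algebraMap _ (ZFrac J) r')]

end HatLemmas

/-! ### Flatness of the completion and its consequences. -/

namespace InvAction

variable {W Z A : Type*} [Group W] [Fintype W] [CommRing Z] [CommRing A] [Algebra Z A]
  (D : InvAction W Z A) [IsDomain A] [IsNoetherianRing Z] (J : Ideal Z)

omit [Fintype W] [IsDomain A] in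
include D in
lemma zToHat_injective : Function.Injective (fun r : ZHat J => (hatTmul J r 1 : Hat J A)) := by
  have h := Module.Flat.lTensor_preserves_injective_linearMap (M := ZHat J)
    (Algebra.linearMap Z A) D.algebraMap_injective
  intro r r' hr
  have h1 : (TensorProduct.rid Z (ZHat J)).symm r = (TensorProduct.rid Z (ZHat J)).symm r' := by
    apply h
    change r ⊗ₜ[Z] (1 : A) = r' ⊗ₜ[Z] 1 at hr
    simpa [LinearMap.lTensor_tmul] using hr
  exact (TensorProduct.rid Z (ZHat J)).symm.injective h1

omit [Fintype W] in
include D in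
-- The completion of a noetherian ring is flat, so multiplication by z stays injective on it, and z
-- becomes a non-zero-divisor there. The completed center itself need not be known to be a domain.
lemma isUnit_zFrac {z : Z} (hz : z ≠ 0) : IsUnit (algebraMap Z (ZFrac J) z) := by
  have : IsDomain Z := D.algebraMap_injective.isDomain (algebraMap Z A)
  rw [IsScalarTower.algebraMap_apply Z (ZHat J) (ZFrac J)]
  refine IsLocalization.map_units (M := nonZeroDivisors (ZHat J)) (ZFrac J)
    ⟨algebraMap Z (ZHat J) z, ?_⟩
  have h1 : IsSMulRegular (ZHat J) z := by
    have h := Module.Flat.lTensor_preserves_injective_linearMap (M := ZHat J)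
      (LinearMap.mulLeft Z z) (mul_right_injective₀ hz)
    intro r r' hr
    have h1 : (TensorProduct.rid Z (ZHat J)).symm r = (TensorProduct.rid Z (ZHat J)).symm r' := by
      apply h
      have : ∀ r : ZHat J, (LinearMap.mulLeft Z z).lTensor (ZHat J) (r ⊗ₜ 1) = (z • r) ⊗ₜ 1 := by
        intro r
        rw [LinearMap.lTensor_tmul, LinearMap.mulLeft_apply, ← smul_eq_mul, TensorProduct.tmul_smul,
          TensorProduct.smul_tmul']
      simp only [TensorProduct.rid_symm_apply]
      rw [this, this]
      exact congrArg (fun x => x ⊗ₜ[Z] (1 : Z)) hr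
    exact (TensorProduct.rid Z (ZHat J)).symm.injective h1
  rw [mem_nonZeroDivisors_iff_right]
  intro x hx
  apply h1
  simp only [smul_zero]
  rw [Algebra.smul_def, mul_comm, hx]

include D in
/-- Nonzero elements of `A` become invertible in the localized completion. -/
lemma isUnit_toF {a : A} (ha : a ≠ 0) : IsUnit (toF J a) := by
  obtain ⟨z, hz, b, hb⟩ := D.exists_dvd ha
  have h1 : toF J (algebraMap Z A z) = fTmul J (algebraMap Z (ZFrac J) z) 1 := by
    rw [AlgHom.commutes]
    exact (Algebra.TensorProduct.algebraMap_apply ..)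
  have h2 : IsUnit (toF J (algebraMap Z A z)) := by
    rw [h1]
    obtain ⟨u, hu⟩ := D.isUnit_zFrac J hz
    refine IsUnit.of_mul_eq_one (fTmul J (↑u⁻¹) 1) ?_
    rw [fTmul_mul, ← hu, Units.mul_inv, mul_one]
    rfl
  rw [hb, map_mul] at h2
  exact isUnit_of_mul_isUnit_left h2

include D in
-- By flatness an embedding of A in Zⁿ gives one of the completion in Ẑⁿ, and Ẑ embeds in its ring
-- of fractions coordinate by coordinate.
lemma hatToF_injective : Function.Injective (hatToF J A) := by
  obtain ⟨n, φ, hφ⟩ := D.exists_embedding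
  have h1 := Module.Flat.lTensor_preserves_injective_linearMap (M := ZHat J) φ hφ
  let e := TensorProduct.piScalarRight Z Z (ZHat J) (Fin n)
  let e' := TensorProduct.piScalarRight Z Z (ZFrac J) (Fin n)
  have h2 : ∀ x : Hat J A, e' (φ.lTensor (ZFrac J) (hatToF J A x)) =
      fun j => algebraMap (ZHat J) (ZFrac J) (e (φ.lTensor (ZHat J) x) j) := by
    intro x
    induction x using hat_induction with
    | h r a =>
      change e' (φ.lTensor (ZFrac J) (algebraMap _ _ r ⊗ₜ a)) =
        fun j => algebraMap (ZHat J) (ZFrac J) (e (φ.lTensor (ZHat J) (r ⊗ₜ a)) j)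
      ext j
      simp [e, e', TensorProduct.piScalarRight_apply, TensorProduct.piScalarRightHom_tmul,
        Algebra.smul_def, ← IsScalarTower.algebraMap_apply]
    | hadd x y hx hy =>
      have : ∀ x y : Hat J A, e (φ.lTensor (ZHat J) (x + y)) =
        e (φ.lTensor (ZHat J) x) + e (φ.lTensor (ZHat J) y) := fun x y =>
          (congrArg e (map_add (φ.lTensor (ZHat J)) _ _)).trans (map_add e _ _)
      have h3 : ∀ x y : HatF J A, e' (φ.lTensor (ZFrac J) (x + y)) =
        e' (φ.lTensor (ZFrac J) x) + e' (φ.lTensor (ZFrac J) y) := fun x y =>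
          (congrArg e' (map_add (φ.lTensor (ZFrac J)) _ _)).trans (map_add e' _ _)
      rw [map_add, h3, hx, hy, this]
      ext j
      simp
  intro x y hxy
  have h3 := h2 x
  rw [hxy, h2 y] at h3
  apply h1
  apply e.injective
  ext1 j
  exact (IsFractionRing.injective (ZHat J) (ZFrac J) (congrFun h3 j)).symm

omit [IsDomain A] [IsNoetherianRing Z] in
-- The trace extends to the completion with values in Ẑ, and on an invariant element it is
-- multiplication by the order of W, which is invertible in ℂ.
lemma exists_of_hat_invariant [Algebra ℂ Z] {x : Hat J A} (hx : ∀ w, hatMap J (D.act w) x = x) :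
    ∃ r : ZHat J, hatTmul J r 1 = x := by
  let τ : Hat J A → ZHat J := fun x => TensorProduct.rid Z _ (D.trace.lTensor (ZHat J) x)
  have h : ∀ x : Hat J A, hatTmul J (τ x) 1 = ∑ w, hatMap J (D.act w) x := by
    intro x
    induction x using hat_induction with
    | h r a =>
      have : τ (hatTmul J r a) = D.trace a • r := by
        simp only [τ, hatTmul]
        exact (congrArg _ (LinearMap.lTensor_tmul ..)).trans (TensorProduct.rid_tmul ..)
      rw [this]
      simp only [hatMap_hatTmul]
      have h2 : ∑ w, hatTmul J r (D.act w a) = hatTmul J r (∑ w, D.act w a) :=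
        (TensorProduct.tmul_sum ..).symm
      rw [h2, ← D.algebraMap_trace, Algebra.algebraMap_eq_smul_one]
      exact TensorProduct.smul_tmul ..
    | hadd x y hx hy =>
      have h1 : τ (x + y) = τ x + τ y :=
        (congrArg (TensorProduct.rid Z (ZHat J)) (map_add (D.trace.lTensor (ZHat J)) _ _)).trans
          (map_add (TensorProduct.rid Z (ZHat J)) _ _)
      have h2 : ∀ r r' : ZHat J, (hatTmul J (r + r') 1 : Hat J A) = hatTmul J r 1 + hatTmul J r' 1 :=
        fun r r' => TensorProduct.add_tmul ..
      rw [h1, h2, hx, hy, ← Finset.sum_add_distrib]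
      simp only [map_add]
  have hc : (Fintype.card W : ℂ) ≠ 0 := Nat.cast_ne_zero.mpr Fintype.card_ne_zero
  refine ⟨((Fintype.card W : ℂ)⁻¹) • τ x, ?_⟩
  have h3 : (hatTmul J ((Fintype.card W : ℂ)⁻¹ • τ x) 1 : Hat J A) =
    (Fintype.card W : ℂ)⁻¹ • hatTmul J (τ x) 1 := (TensorProduct.smul_tmul' ..).symm
  rw [h3, h]
  simp only [hx, Finset.sum_const, Finset.card_univ]
  rw [← Nat.cast_smul_eq_nsmul ℂ, smul_smul, inv_mul_cancel₀ hc, one_smul]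

end InvAction

/-! ### The common framework for both Hecke algebras. -/

/-- A `Z`-algebra `H` spanned over `A` by elements `T_w`, with a representation on `A` in which
`T_s + 1` acts as `(1 + s) ∘ (num / den)` for the simple reflections `s`. -/
structure HeckeRep {W Z A : Type*} [Group W] [Fintype W] [CommRing Z] [CommRing A] [Algebra Z A]
    (D : InvAction W Z A) (H : Type*) [Ring H] [Algebra Z H] (ι : Type*) where
  /-- The simple reflections. -/
  s : ι → W
  exists_word : ∀ w, ∃ L : List ι, (L.map s).prod = w
  /-- The homomorphism from `A`. -/
  inc : A →ₐ[Z] H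
  /-- The elements `T_w`. -/
  T : W → H
  T_word : ∀ w, ∃ L : List ι, (L.map fun i => T (s i)).prod = T w
  span : ∀ h, ∃ f : W → A, h = ∑ w, inc (f w) * T w
  /-- The representation on `A`. -/
  rep : H →ₐ[Z] Module.End Z A
  rep_inc : ∀ a b, rep (inc a) b = a * b
  /-- The numerator. -/
  num : ι → A
  /-- The denominator. -/
  den : ι → A
  num_ne_zero : ∀ i, num i ≠ 0
  den_ne_zero : ∀ i, den i ≠ 0
  -- The formula (T_s + 1)f = (1 + s)((num/den) f), multiplied by den · s(den).
  rep_T : ∀ i f, den i * D.act (s i) (den i) * (rep (T (s i)) f + f) =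
    D.act (s i) (den i) * num i * f + den i * D.act (s i) (num i) * D.act (s i) f

namespace HeckeRep

variable {W Z A H ι : Type*} [Group W] [Fintype W] [CommRing Z] [CommRing A] [Algebra Z A]
  {D : InvAction W Z A} [Ring H] [Algebra Z H] (R : HeckeRep D H ι) (J : Ideal Z)

lemma hat_span (x : Hat J H) :
    ∃ f : W → Hat J A, x = ∑ w, hatMap J R.inc (f w) * toHat J (R.T w) := by
  induction x using hat_induction with
  | h r h =>
    obtain ⟨f, rfl⟩ := R.span h
    refine ⟨fun w => hatTmul J r (f w), ?_⟩
    simp only [hatMap_hatTmul, toHat_eq, hatTmul_mul, mul_one]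
    exact TensorProduct.tmul_sum ..
  | hadd x y hx hy =>
    obtain ⟨f, rfl⟩ := hx
    obtain ⟨g, rfl⟩ := hy
    exact ⟨f + g, by simp [add_mul, Finset.sum_add_distrib]⟩

lemma f_span (x : HatF J H) :
    ∃ f : W → HatF J A, x = ∑ w, fMap J R.inc (f w) * toF J (R.T w) := by
  induction x using f_induction with
  | h r h =>
    obtain ⟨f, rfl⟩ := R.span h
    refine ⟨fun w => fTmul J r (f w), ?_⟩
    simp only [fMap_fTmul, toF_eq, fTmul_mul, mul_one]
    exact TensorProduct.tmul_sum ..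
  | hadd x y hx hy =>
    obtain ⟨f, rfl⟩ := hx
    obtain ⟨g, rfl⟩ := hy
    exact ⟨f + g, by simp [add_mul, Finset.sum_add_distrib]⟩

/-- The representation extended to the localized completion, over the field of fractions. -/
def repFrac : ZFrac J ⊗[Z] H →ₐ[ZFrac J] Module.End (ZFrac J) (ZFrac J ⊗[Z] A) :=
  Algebra.TensorProduct.lift (Algebra.ofId (ZFrac J) _)
    ((Module.End.baseChangeHom Z (ZFrac J) A).comp R.rep)
    (fun x _ => Algebra.commutes x _)

lemma repFrac_tmul (r r' : ZFrac J) (h : H) (a : A) :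
    R.repFrac J (r ⊗ₜ h) (r' ⊗ₜ a) = (r * r') ⊗ₜ R.rep h a := by
  refine (congrArg (fun F : Module.End (ZFrac J) (ZFrac J ⊗[Z] A) => F (r' ⊗ₜ[Z] a))
    (Algebra.TensorProduct.lift_tmul ..)).trans ?_
  change r • (r' ⊗ₜ[Z] R.rep h a) = _
  rw [TensorProduct.smul_tmul', smul_eq_mul]

variable [Algebra ℂ Z]

/-- The representation extended to the localized completion. -/
def repF : HatF J H →ₐ[ℂ] Module.End ℂ (HatF J A) where
  toFun x := (R.repFrac J x).restrictScalars ℂ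
  map_one' := congrArg (LinearMap.restrictScalars ℂ) (map_one (R.repFrac J))
  map_mul' x y := congrArg (LinearMap.restrictScalars ℂ) (map_mul (R.repFrac J) x y)
  map_zero' := congrArg (LinearMap.restrictScalars ℂ) (map_zero (R.repFrac J))
  map_add' x y := congrArg (LinearMap.restrictScalars ℂ) (map_add (R.repFrac J) x y)
  commutes' c := by
    refine (congrArg (LinearMap.restrictScalars ℂ)
      ((R.repFrac J).commutes (algebraMap ℂ (ZFrac J) c))).trans ?_
    ext x
    exact algebraMap_smul (ZFrac J) c (x : ZFrac J ⊗[Z] A)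

lemma repF_fTmul (r r' : ZFrac J) (h : H) (a : A) :
    R.repF J (fTmul J r h) (fTmul J r' a) = fTmul J (r * r') (R.rep h a) :=
  R.repFrac_tmul J r r' h a

lemma repF_inc (k x : HatF J A) : R.repF J (fMap J R.inc k) x = k * x := by
  induction k using f_induction with
  | h r a =>
    induction x using f_induction with
    | h r' a' => rw [fMap_fTmul, repF_fTmul, R.rep_inc, fTmul_mul]
    | hadd x y hx hy => rw [map_add, mul_add, hx, hy]
  | hadd k l hk hl => rw [map_add, map_add, add_mul, LinearMap.add_apply, hk, hl]

variable [IsDomain A] [IsNoetherianRing Z]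

/-- The factor `num / den` in the localized completion. -/
def fac (i : ι) : HatF J A := toF J (R.num i) * Ring.inverse (toF J (R.den i))

omit [Algebra ℂ Z] in
lemma isUnit_fac (i : ι) : IsUnit (R.fac J i) :=
  (D.isUnit_toF J (R.num_ne_zero i)).mul (D.isUnit_toF J (R.den_ne_zero i)).ringInverse

lemma repF_T (i : ι) (x : HatF J A) : R.repF J (toF J (R.T (R.s i)) + 1) x =
    R.fac J i * x + fMap J (D.act (R.s i)) (R.fac J i * x) := by
  have hu := D.isUnit_toF J (R.den_ne_zero i)
  have hu' := D.isUnit_toF J (D.act_ne_zero (R.den_ne_zero i) (R.s i))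
  have h1 : toF J (R.den i) * R.fac J i = toF J (R.num i) := by
    rw [fac, mul_left_comm, Ring.mul_inverse_cancel _ hu, mul_one]
  have h2 : toF J (D.act (R.s i) (R.den i)) * fMap J (D.act (R.s i)) (R.fac J i) =
      toF J (D.act (R.s i) (R.num i)) := by
    rw [← fMap_toF, ← map_mul, h1, fMap_toF]
  have h3 : toF J (R.den i) * toF J (D.act (R.s i) (R.den i)) *
      (R.repF J (toF J (R.T (R.s i)) + 1) x) =
      toF J (D.act (R.s i) (R.den i)) * toF J (R.num i) * x +
      toF J (R.den i) * toF J (D.act (R.s i) (R.num i)) * fMap J (D.act (R.s i)) x := by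
    induction x using f_induction with
    | h r a =>
      have : R.repF J (toF J (R.T (R.s i)) + 1) (fTmul J r a) =
          fTmul J r (R.rep (R.T (R.s i)) a + a) := by
        rw [map_add, map_one, LinearMap.add_apply, toF_eq, repF_fTmul, one_mul, fTmul_add]
        rfl
      rw [this, fMap_fTmul]
      simp only [toF_eq, fTmul_mul, mul_one, one_mul]
      rw [R.rep_T, fTmul_add]
    | hadd x y hx hy =>
      rw [map_add (R.repF J _), map_add (fMap J _), mul_add, hx, hy]; ring
  refine (hu.mul hu').mul_left_cancel (h3.trans ?_)
  rw [map_mul, ← h1, ← h2]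
  ring

/-- The element `τ_s`, with `τ_s + 1 = (T_s + 1) (num / den)⁻¹`. -/
def tau (i : ι) : HatF J H :=
  (toF J (R.T (R.s i)) + 1) * fMap J R.inc (Ring.inverse (R.fac J i)) - 1

/-- T_s + 1 acts as (1 + s) ∘ (num/den); the normalization cancels the factor and leaves the bare
reflection, in which nothing depends on the parameters. -/
lemma repF_tau (i : ι) (x : HatF J A) : R.repF J (R.tau J i) x = fMap J (D.act (R.s i)) x := by
  rw [tau, map_sub, map_mul, map_one, LinearMap.sub_apply, Module.End.mul_apply, repF_inc, repF_T,
    ← mul_assoc, Ring.mul_inverse_cancel _ (R.isUnit_fac J i), one_mul]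
  exact add_sub_cancel_left _ _

omit [Algebra ℂ Z] in
lemma T_add_one (i : ι) :
    toF J (R.T (R.s i)) + 1 = (R.tau J i + 1) * fMap J R.inc (R.fac J i) := by
  rw [tau, sub_add_cancel, mul_assoc, ← map_mul, Ring.inverse_mul_cancel _ (R.isUnit_fac J i),
    map_one, mul_one]

end HeckeRep

instance {Z : Type*} [CommRing Z] [Algebra ℂ Z] (J : Ideal Z) (B : Type*) [Ring B] [Algebra Z B] :
    IsScalarTower ℂ Z (Hat J B) :=
  IsScalarTower.of_algebraMap_eq fun c =>
    congrArg (fun x => x ⊗ₜ[Z] (1 : B)) (IsScalarTower.algebraMap_apply ℂ Z (ZHat J) c)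

instance {Z : Type*} [CommRing Z] [Algebra ℂ Z] (J : Ideal Z) (B : Type*) [Ring B] [Algebra Z B] :
    IsScalarTower ℂ Z (HatF J B) :=
  IsScalarTower.of_algebraMap_eq fun c =>
    congrArg (fun x => x ⊗ₜ[Z] (1 : B)) (IsScalarTower.algebraMap_apply ℂ Z (ZFrac J) c)

/-! ### The twisted group algebra. -/

namespace InvAction

variable {W Z A : Type*} [Group W] [Fintype W] [CommRing Z] [CommRing A] [Algebra Z A]
  (D : InvAction W Z A) [Algebra ℂ Z] (J : Ideal Z)

/-- The element `Σ k_w w` of the twisted group algebra, as an operator on the localized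
completion. -/
def twist : (W → HatF J A) →ₗ[HatF J A] Module.End ℂ (HatF J A) where
  toFun k := ∑ w, k w • ((fMap J (D.act w)).toLinearMap.restrictScalars ℂ)
  map_add' k l := by simp [add_smul, Finset.sum_add_distrib]
  map_smul' c k := by simp [Finset.smul_sum, mul_smul]

lemma twist_apply (k : W → HatF J A) (x : HatF J A) :
    D.twist J k x = ∑ w, k w * fMap J (D.act w) x := by
  simp [twist]

omit [Fintype W] [Algebra ℂ Z] in
lemma fMap_act_mul (v w : W) (x : HatF J A) :
    fMap J (D.act (v * w)) x = fMap J (D.act v) (fMap J (D.act w) x) := by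
  induction x using f_induction with
  | h r a => rw [fMap_fTmul, fMap_fTmul, fMap_fTmul, D.act_mul_apply]
  | hadd x y hx hy => rw [map_add, map_add, map_add, hx, hy]

omit [Fintype W] [Algebra ℂ Z] in
lemma fMap_act_one (x : HatF J A) : fMap J (D.act 1) x = x := by
  induction x using f_induction with
  | h r a => rw [fMap_fTmul, D.act_one_apply]
  | hadd x y hx hy => rw [map_add, hx, hy]

/-- Evaluating at the f_j of a separator and summing against v(g_j) isolates the coefficient at v,
up to the unit v(d). -/
lemma twist_injective [IsDomain A] [IsNoetherianRing Z] : Function.Injective (D.twist J) := by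
  obtain ⟨d, n, g, f, hd, h1, h2⟩ := D.exists_separator
  rw [injective_iff_map_eq_zero]
  intro k hk
  ext v
  have h3 : ∑ j, D.twist J k (toF J (f j)) * toF J (D.act v (g j)) = k v * toF J (D.act v d) := by
    simp only [twist_apply, Finset.sum_mul]
    rw [Finset.sum_comm, Finset.sum_eq_single v]
    · simp only [fMap_toF, mul_assoc, ← map_mul, ← Finset.mul_sum, ← map_sum]
      rw [← h1]
      simp only [mul_comm]
    · intro w _ hw
      simp only [fMap_toF, mul_assoc, ← map_mul, ← Finset.mul_sum, ← map_sum]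
      have : ∑ j, D.act w (f j) * D.act v (g j) = D.act v (∑ j, g j * D.act (v⁻¹ * w) (f j)) := by
        rw [map_sum]
        refine Finset.sum_congr rfl fun j _ => ?_
        rw [map_mul, ← D.act_mul_apply, mul_inv_cancel_left, mul_comm]
      rw [this, h2 (v⁻¹ * w) (fun h => hw (inv_mul_eq_one.mp h).symm), map_zero, map_zero, mul_zero]
    · simp
  simp only [hk, LinearMap.zero_apply, zero_mul, Finset.sum_const_zero] at h3
  exact (D.isUnit_toF J (D.act_ne_zero hd v)).mul_left_eq_zero.mp h3.symm

lemma twist_single [DecidableEq W] (w : W) (c x : HatF J A) :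
    D.twist J (Pi.single w c) x = c * fMap J (D.act w) x := by
  rw [twist_apply, Finset.sum_eq_single w (fun v _ hv => by simp [hv]) (by simp), Pi.single_eq_same]

lemma one_mem_range_twist : 1 ∈ LinearMap.range (D.twist J) := by
  classical
  refine ⟨Pi.single 1 1, ?_⟩
  ext x
  rw [twist_single, D.fMap_act_one, one_mul]
  rfl

lemma mul_mem_range_twist {a b : Module.End ℂ (HatF J A)} (ha : a ∈ LinearMap.range (D.twist J))
    (hb : b ∈ LinearMap.range (D.twist J)) : a * b ∈ LinearMap.range (D.twist J) := by
  obtain ⟨k, rfl⟩ := ha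
  obtain ⟨l, rfl⟩ := hb
  -- Multiplication in the twisted group algebra is twisted convolution.
  refine ⟨fun u => ∑ v, k v * fMap J (D.act v) (l (v⁻¹ * u)), ?_⟩
  ext x
  rw [Module.End.mul_apply, twist_apply, twist_apply]
  simp only [twist_apply, map_sum, map_mul, Finset.sum_mul, Finset.mul_sum]
  rw [Finset.sum_comm]
  refine Finset.sum_congr rfl fun v _ => ?_
  refine (Fintype.sum_equiv (Equiv.mulLeft v) _ _ fun w => ?_).symm
  rw [Equiv.coe_mulLeft, inv_mul_cancel_left, D.fMap_act_mul, mul_assoc]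

end InvAction

/-! ### The localized Hecke algebra is the twisted group algebra. -/

namespace HeckeRep

variable {W Z A H ι : Type*} [Group W] [Fintype W] [CommRing Z] [CommRing A] [Algebra Z A]
  {D : InvAction W Z A} [Ring H] [Algebra Z H] (R : HeckeRep D H ι) (J : Ideal Z)
  [Algebra ℂ Z] [IsDomain A] [IsNoetherianRing Z]

omit [IsDomain A] [IsNoetherianRing Z] in
lemma mul_mem_range (k : HatF J A) {a : Module.End ℂ (HatF J A)}
    (ha : a ∈ LinearMap.range (D.twist J)) :
    R.repF J (fMap J R.inc k) * a ∈ LinearMap.range (D.twist J) := by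
  have : R.repF J (fMap J R.inc k) * a = k • a := by
    ext x
    exact R.repF_inc J k _
  rw [this]
  exact Submodule.smul_mem _ _ ha

lemma T_mem_range (w : W) : R.repF J (toF J (R.T w)) ∈ LinearMap.range (D.twist J) := by
  classical
  obtain ⟨L, hL⟩ := R.T_word w
  rw [← hL]
  clear hL
  induction L with
  | nil => simpa using D.one_mem_range_twist J
  | cons i L ih =>
    rw [List.map_cons, List.prod_cons, map_mul, map_mul]
    refine D.mul_mem_range_twist J ?_ ih
    have h1 : R.repF J (toF J (R.T (R.s i)) + 1) ∈ LinearMap.range (D.twist J) := by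
      refine ⟨Pi.single 1 (R.fac J i) + Pi.single (R.s i) (fMap J (D.act (R.s i)) (R.fac J i)), ?_⟩
      ext x
      rw [map_add, LinearMap.add_apply, D.twist_single, D.twist_single, repF_T, map_mul,
        D.fMap_act_one]
    rw [map_add, map_one] at h1
    simpa using sub_mem h1 (D.one_mem_range_twist J)

/-- The linear map `k ↦ Σ k_w T_w`, composed with the representation. -/
def repBasis : (W → HatF J A) →ₗ[HatF J A] Module.End ℂ (HatF J A) where
  toFun k := R.repF J (∑ w, fMap J R.inc (k w) * toF J (R.T w))
  map_add' k l := by simp [add_mul, Finset.sum_add_distrib]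
  map_smul' c k := by
    ext x
    simp only [Pi.smul_apply, smul_eq_mul, map_mul, map_sum, LinearMap.sum_apply,
      Module.End.mul_apply, RingHom.id_apply, LinearMap.smul_apply, repF_inc, Finset.mul_sum,
      mul_assoc]

/-- T_s acts as a combination of 1 and s, which gives one inclusion. Products of the τ_s act as the
elements of W, and rewriting them in the spanning set T_w gives the other. -/
lemma range_repBasis : LinearMap.range (R.repBasis J) = LinearMap.range (D.twist J) := by
  classical
  apply le_antisymm
  · rintro _ ⟨k, rfl⟩
    change R.repF J _ ∈ _
    rw [map_sum]
    refine Submodule.sum_mem _ fun w _ => ?_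
    rw [map_mul]
    exact R.mul_mem_range J _ (R.T_mem_range J w)
  · rintro _ ⟨k, rfl⟩
    have hW : ∀ w, ∃ h, ∀ x, R.repF J h x = fMap J (D.act w) x := by
      intro w
      obtain ⟨L, rfl⟩ := R.exists_word w
      induction L with
      | nil => exact ⟨1, fun x => by rw [map_one, List.map_nil, List.prod_nil, D.fMap_act_one]; rfl⟩
      | cons i L ih =>
        obtain ⟨h, hh⟩ := ih
        refine ⟨R.tau J i * h, fun x => ?_⟩
        rw [map_mul, Module.End.mul_apply, hh, R.repF_tau, List.map_cons, List.prod_cons,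
          D.fMap_act_mul]
    choose h hh using hW
    obtain ⟨l, hl⟩ := R.f_span J (∑ w, fMap J R.inc (k w) * h w)
    refine ⟨l, ?_⟩
    change R.repF J _ = _
    rw [← hl]
    ext x
    simp only [map_sum, map_mul, LinearMap.sum_apply, Module.End.mul_apply, repF_inc, hh,
      D.twist_apply]

/-- Identifying the twisted group algebra with the free module on W turns k ↦ Σ k_w T_w into a
surjective endomorphism of a finite free module over a commutative ring, which is injective. Linear
independence of the T_w follows without any triangularity argument. -/
lemma repBasis_injective : Function.Injective (R.repBasis J) := by
  let e := LinearEquiv.ofInjective (D.twist J) (D.twist_injective J)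
  let θ : (W → HatF J A) →ₗ[HatF J A] (W → HatF J A) :=
    e.symm.toLinearMap ∘ₗ (R.repBasis J).codRestrict (LinearMap.range (D.twist J)) fun k => by
      rw [← R.range_repBasis J]
      exact ⟨k, rfl⟩
  have hθ : Function.Surjective θ := by
    intro k
    have : D.twist J k ∈ LinearMap.range (R.repBasis J) := by
      rw [R.range_repBasis J]
      exact ⟨k, rfl⟩
    obtain ⟨l, hl⟩ := this
    refine ⟨l, e.injective ?_⟩
    apply Subtype.ext
    simpa [θ, e] using hl
  have hinj := OrzechProperty.injective_of_surjective_endomorphism θ hθ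
  intro k l hkl
  apply hinj
  simp only [θ, LinearMap.comp_apply]
  congr 1
  exact Subtype.ext hkl

lemma repF_injective : Function.Injective (R.repF J) := by
  rw [injective_iff_map_eq_zero]
  intro x hx
  obtain ⟨k, rfl⟩ := R.f_span J x
  have : k = 0 := R.repBasis_injective J (by rw [map_zero]; exact hx)
  subst this
  simp

lemma eq_zero_of_sum_eq_zero {k : W → HatF J A}
    (h : ∑ w, fMap J R.inc (k w) * toF J (R.T w) = 0) : k = 0 :=
  R.repBasis_injective J (by rw [map_zero]; change R.repF J _ = 0; rw [h, map_zero])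

lemma mem_range_repF {a : Module.End ℂ (HatF J A)} :
    (∃ x, R.repF J x = a) ↔ ∃ k, D.twist J k = a := by
  constructor
  · rintro ⟨x, rfl⟩
    obtain ⟨k, rfl⟩ := R.f_span J x
    have : R.repBasis J k ∈ LinearMap.range (D.twist J) := by
      rw [← R.range_repBasis J]
      exact ⟨k, rfl⟩
    exact this
  · rintro ⟨k, rfl⟩
    have : D.twist J k ∈ LinearMap.range (R.repBasis J) := by
      rw [R.range_repBasis J]
      exact ⟨k, rfl⟩
    obtain ⟨l, hl⟩ := this
    exact ⟨_, hl⟩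

end HeckeRep

/-! ### The localized completion as a localization. -/

section Localize

variable {Z A : Type*} [CommRing Z] [CommRing A] [Algebra Z A] (J : Ideal Z)

/-- The non-zero-divisors of the completed center, in the completed algebra. -/
def zMonoid (A : Type*) [CommRing A] [Algebra Z A] : Submonoid (Hat J A) :=
  (nonZeroDivisors (ZHat J)).map
    (Algebra.TensorProduct.includeLeft : ZHat J →ₐ[Z] ZHat J ⊗[Z] A).toRingHom.toMonoidHom

lemma mem_zMonoid {x : Hat J A} :
    x ∈ zMonoid J A ↔ ∃ r ∈ nonZeroDivisors (ZHat J), hatTmul J r 1 = x := Iff.rfl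

/-- The completion embeds in the localized completion. -/
abbrev hatAlgebra (A : Type*) [CommRing A] [Algebra Z A] : Algebra (Hat J A) (HatF J A) :=
  (hatToF J A).toRingHom.toAlgebra

variable {J} in
lemma isUnit_fTmul {r : ZHat J} (hr : r ∈ nonZeroDivisors (ZHat J)) :
    IsUnit (fTmul J (algebraMap _ _ r) (1 : A)) := by
  obtain ⟨u, hu⟩ := IsLocalization.map_units (M := nonZeroDivisors (ZHat J)) (ZFrac J) ⟨r, hr⟩
  refine IsUnit.of_mul_eq_one (fTmul J (↑u⁻¹) 1) ?_
  rw [fTmul_mul, ← hu, Units.mul_inv, mul_one]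
  rfl

lemma isLocalization_hatF (h : Function.Injective (hatToF J A)) :
    letI := hatAlgebra J A
    IsLocalization (zMonoid J A) (HatF J A) := by
  let := hatAlgebra J A
  refine ⟨?_, ?_, ?_⟩
  · rintro ⟨_, r, hr, rfl⟩
    exact isUnit_fTmul hr
  · intro y
    obtain ⟨r, hr, x, hx⟩ := exists_mul_eq_hatToF y
    exact ⟨(x, ⟨_, r, hr, rfl⟩), by rw [mul_comm]; exact hx⟩
  · intro x y hxy
    exact ⟨1, by rw [h hxy]⟩

end Localize

/-! ### Extending an equivariant isomorphism to the localized completions. -/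

section Transport

variable {W Z₁ A₁ Z₂ A₂ : Type*} [Group W] [Fintype W] [CommRing Z₁] [CommRing A₁]
  [Algebra Z₁ A₁] [CommRing Z₂] [CommRing A₂] [Algebra Z₂ A₂] [Algebra ℂ Z₁] [Algebra ℂ Z₂]
  [IsDomain A₁] [IsDomain A₂] [IsNoetherianRing Z₁] [IsNoetherianRing Z₂]
  {D₁ : InvAction W Z₁ A₁} {D₂ : InvAction W Z₂ A₂} {I : Ideal Z₁} {J : Ideal Z₂}

/-- Compatibility of an isomorphism of completions with the group actions. -/
def Equivariant (D₁ : InvAction W Z₁ A₁) (D₂ : InvAction W Z₂ A₂)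
    (κ : Hat I A₁ ≃ₐ[ℂ] Hat J A₂) : Prop :=
  ∀ w x, κ (hatMap I (D₁.act w) x) = hatMap J (D₂.act w) (κ x)

omit [Fintype W] [IsDomain A₁] [IsDomain A₂] [IsNoetherianRing Z₁] [IsNoetherianRing Z₂] in
lemma Equivariant.symm {κ : Hat I A₁ ≃ₐ[ℂ] Hat J A₂} (h : Equivariant D₁ D₂ κ) :
    Equivariant D₂ D₁ κ.symm := fun w x => by
  rw [AlgEquiv.symm_apply_eq, h, AlgEquiv.apply_symm_apply]

omit [IsDomain A₁] [IsDomain A₂] [IsNoetherianRing Z₁] [IsNoetherianRing Z₂] in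
lemma Equivariant.map_center {κ : Hat I A₁ ≃ₐ[ℂ] Hat J A₂} (h : Equivariant D₁ D₂ κ) (r : ZHat I) :
    ∃ r' : ZHat J, hatTmul J r' 1 = κ (hatTmul I r 1) :=
  D₂.exists_of_hat_invariant J fun w => by
    rw [← h, hatMap_hatTmul, map_one]

omit [IsDomain A₁] [IsDomain A₂] in
-- Equivariance matches the invariants, that is, the completed centers. A relation showing a zero
-- divisor on one side can therefore be carried back to the other center.
lemma Equivariant.map_zMonoid {κ : Hat I A₁ ≃ₐ[ℂ] Hat J A₂} (h : Equivariant D₁ D₂ κ)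
    {x : Hat I A₁} (hx : x ∈ zMonoid I A₁) : κ x ∈ zMonoid J A₂ := by
  obtain ⟨r, hr, rfl⟩ := (mem_zMonoid I).mp hx
  obtain ⟨r', hr'⟩ := h.map_center r
  refine (mem_zMonoid J).mpr ⟨r', ?_, hr'⟩
  rw [mem_nonZeroDivisors_iff_right]
  intro y hy
  obtain ⟨y', hy'⟩ := h.symm.map_center y
  have h1 : κ (hatTmul I (y' * r) 1) = 0 := by
    have h2 : (hatTmul I (y' * r) 1 : Hat I A₁) = hatTmul I y' 1 * hatTmul I r 1 := by
      rw [hatTmul_mul, one_mul]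
    rw [h2, map_mul, hy', ← hr', AlgEquiv.apply_symm_apply, hatTmul_mul, hy]
    exact TensorProduct.zero_tmul ..
  have h3 : (hatTmul I (y' * r) 1 : Hat I A₁) = hatTmul I 0 1 := by
    rw [(map_eq_zero_iff κ κ.injective).mp h1]
    exact (TensorProduct.zero_tmul ..).symm
  have h4 : y' = 0 := (mem_nonZeroDivisors_iff_right.mp hr) y' (D₁.zToHat_injective I h3)
  rw [h4] at hy'
  have h5 : (hatTmul J y 1 : Hat J A₂) = hatTmul J 0 1 := by
    apply κ.symm.injective
    rw [← hy']
    refine (TensorProduct.zero_tmul ..).trans ?_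
    refine (map_zero κ.symm).symm.trans (congrArg κ.symm ?_)
    exact (TensorProduct.zero_tmul ..).symm
  exact D₂.zToHat_injective J h5

lemma Equivariant.exists_extension {κ : Hat I A₁ ≃ₐ[ℂ] Hat J A₂} (h : Equivariant D₁ D₂ κ) :
    ∃ K : HatF I A₁ ≃ₐ[ℂ] HatF J A₂, (∀ x, K (hatToF I A₁ x) = hatToF J A₂ (κ x)) ∧
      ∀ w x, K (fMap I (D₁.act w) x) = fMap J (D₂.act w) (K x) := by
  let := hatAlgebra I A₁
  let := hatAlgebra J A₂
  have := isLocalization_hatF I (D₁.hatToF_injective I)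
  have := isLocalization_hatF J (D₂.hatToF_injective J)
  have hM : (zMonoid I A₁).map κ.toRingEquiv.toMonoidHom = zMonoid J A₂ := by
    apply le_antisymm
    · rintro _ ⟨x, hx, rfl⟩
      exact h.map_zMonoid hx
    · intro y hy
      exact ⟨κ.symm y, h.symm.map_zMonoid hy, κ.apply_symm_apply y⟩
  let K := IsLocalization.ringEquivOfRingEquiv (HatF I A₁) (HatF J A₂) κ.toRingEquiv hM
  have hK : ∀ x, K (hatToF I A₁ x) = hatToF J A₂ (κ x) := fun x =>
    IsLocalization.ringEquivOfRingEquiv_eq (S := HatF I A₁) (Q := HatF J A₂) hM x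
  have hc₁ : ∀ c : ℂ, hatToF I A₁ (algebraMap ℂ _ c) = algebraMap ℂ _ c := fun c =>
    (AlgHom.restrictScalars ℂ (hatToF I A₁)).commutes c
  have hc₂ : ∀ c : ℂ, hatToF J A₂ (algebraMap ℂ _ c) = algebraMap ℂ _ c := fun c =>
    (AlgHom.restrictScalars ℂ (hatToF J A₂)).commutes c
  refine ⟨AlgEquiv.ofRingEquiv (f := K) fun c => ?_, hK, fun w x => ?_⟩
  · rw [← hc₁, hK, κ.commutes, hc₂]
  · change K _ = fMap J (D₂.act w) (K x)
    obtain ⟨r, hr, y, hy⟩ := exists_mul_eq_hatToF x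
    refine (IsUnit.map K (isUnit_fTmul (A := A₁) hr)).mul_left_cancel ?_
    have h1 : fMap I (D₁.act w) (fTmul I (algebraMap _ _ r) 1 * x) =
        fTmul I (algebraMap _ _ r) 1 * fMap I (D₁.act w) x := by
      rw [map_mul, fMap_fTmul, map_one]
    have h2 : fMap J (D₂.act w) (K (fTmul I (algebraMap _ _ r) 1 * x)) =
        K (fTmul I (algebraMap _ _ r) 1) * fMap J (D₂.act w) (K x) := by
      rw [map_mul, map_mul]
      congr 1
      have h3 : (fTmul I (algebraMap _ _ r) (1 : A₁)) = hatToF I A₁ (hatTmul I r 1) := rfl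
      rw [h3, hK, ← hatToF_hatMap, ← h, hatMap_hatTmul, map_one]
    rw [← h2, ← map_mul, ← h1, hy, ← hatToF_hatMap, hK, hK, h, hatToF_hatMap]

end Transport

/-! ### From an isomorphism of commutative algebras to one of Hecke algebras. -/

section Iso

variable {W Z₁ A₁ H₁ Z₂ A₂ H₂ ι : Type*} [Group W] [Fintype W] [CommRing Z₁] [CommRing A₁]
  [Algebra Z₁ A₁] [CommRing Z₂] [CommRing A₂] [Algebra Z₂ A₂] [Algebra ℂ Z₁] [Algebra ℂ Z₂]
  {D₁ : InvAction W Z₁ A₁} {D₂ : InvAction W Z₂ A₂} {I : Ideal Z₁} {J : Ideal Z₂}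
  [Ring H₁] [Algebra Z₁ H₁] [Ring H₂] [Algebra Z₂ H₂]
  (R₁ : HeckeRep D₁ H₁ ι) (R₂ : HeckeRep D₂ H₂ ι)

/-- The completed Hecke algebra is generated by the completed commutative algebra and the T_s, and
the images of both have no denominators. It is used for j and for its inverse. -/
lemma exists_hatToF_eq {j : HatF I H₁ ≃ₐ[ℂ] HatF J H₂} {κ : Hat I A₁ ≃ₐ[ℂ] Hat J A₂}
    (hκ : ∀ x, j (hatToF I H₁ (hatMap I R₁.inc x)) = hatToF J H₂ (hatMap J R₂.inc (κ x)))
    {v : ι → Hat J A₂} (hT : ∀ i, j (toF I (R₁.T (R₁.s i)) + 1) =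
      (toF J (R₂.T (R₂.s i)) + 1) * hatToF J H₂ (hatMap J R₂.inc (v i)))
    (x : Hat I H₁) : j (hatToF I H₁ x) ∈ (hatToF J H₂).range := by
  obtain ⟨f, rfl⟩ := R₁.hat_span I x
  rw [map_sum, map_sum]
  refine Subalgebra.sum_mem _ fun w _ => ?_
  rw [map_mul, map_mul, hκ, hatToF_toHat]
  refine mul_mem ⟨_, rfl⟩ ?_
  obtain ⟨L, hL⟩ := R₁.T_word w
  rw [← hL]
  clear hL
  induction L with
  | nil =>
    rw [List.map_nil, List.prod_nil, map_one, map_one]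
    exact one_mem _
  | cons i L ih =>
    rw [List.map_cons, List.prod_cons, map_mul, map_mul]
    refine mul_mem ?_ ih
    have h1 : j (toF I (R₁.T (R₁.s i))) =
        (toF J (R₂.T (R₂.s i)) + 1) * hatToF J H₂ (hatMap J R₂.inc (v i)) - 1 := by
      rw [← hT, map_add, map_one, add_sub_cancel_right]
    rw [h1]
    refine sub_mem (mul_mem (add_mem ⟨toHat J (R₂.T (R₂.s i)), ?_⟩ (one_mem _)) ⟨_, rfl⟩)
      (one_mem _)
    exact hatToF_toHat _

variable [IsDomain A₁] [IsDomain A₂] [IsNoetherianRing Z₁] [IsNoetherianRing Z₂]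

/-- Both representations are faithful with image the twisted group algebra, and conjugation by the
equivariant K carries one image onto the other. -/
lemma exists_conj (K : HatF I A₁ ≃ₐ[ℂ] HatF J A₂)
    (hK : ∀ w x, K (fMap I (D₁.act w) x) = fMap J (D₂.act w) (K x)) :
    ∃ j : HatF I H₁ ≃ₐ[ℂ] HatF J H₂,
      ∀ x y, R₂.repF J (j x) (K y) = K (R₁.repF I x y) := by
  let c : Module.End ℂ (HatF I A₁) ≃ₐ[ℂ] Module.End ℂ (HatF J A₂) :=
    K.toLinearEquiv.conjAlgEquiv ℂ
  have hc : ∀ a y, c a y = K (a (K.symm y)) := fun a y => rfl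
  let f : HatF I H₁ →ₐ[ℂ] Module.End ℂ (HatF J A₂) := c.toAlgHom.comp (R₁.repF I)
  have hf : Function.Injective f := c.injective.comp (R₁.repF_injective I)
  have hct : ∀ k, c (D₁.twist I k) = D₂.twist J (fun w => K (k w)) := by
    intro k
    ext y
    rw [hc, D₁.twist_apply, D₂.twist_apply, map_sum]
    refine Finset.sum_congr rfl fun w _ => ?_
    rw [map_mul, hK, AlgEquiv.apply_symm_apply]
  have hr : f.range = (R₂.repF J).range := by
    ext a
    rw [AlgHom.mem_range, AlgHom.mem_range, R₂.mem_range_repF J]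
    constructor
    · rintro ⟨x, rfl⟩
      obtain ⟨k, hk⟩ := (R₁.mem_range_repF I).mp ⟨x, rfl⟩
      exact ⟨fun w => K (k w), by rw [← hct, hk]; rfl⟩
    · rintro ⟨k, rfl⟩
      obtain ⟨x, hx⟩ := (R₁.mem_range_repF I).mpr ⟨fun w => K.symm (k w), rfl⟩
      refine ⟨x, ?_⟩
      change c (R₁.repF I x) = _
      rw [hx, hct]
      simp
  let j := ((AlgEquiv.ofInjective f hf).trans (Subalgebra.equivOfEq _ _ hr)).trans
    (AlgEquiv.ofInjective (R₂.repF J) (R₂.repF_injective J)).symm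
  refine ⟨j, fun x y => ?_⟩
  have : R₂.repF J (j x) = f x := by
    have h1 : AlgEquiv.ofInjective (R₂.repF J) (R₂.repF_injective J) (j x) =
        Subalgebra.equivOfEq _ _ hr (AlgEquiv.ofInjective f hf x) :=
      AlgEquiv.apply_symm_apply ..
    exact congrArg Subtype.val h1
  rw [this]
  change c _ _ = _
  rw [hc, AlgEquiv.symm_apply_apply]
  rfl

/-- An equivariant isomorphism of the completed commutative algebras which matches the factors
`num / den` up to units extends to the completed Hecke algebras. -/
theorem exists_hecke_iso (hs : R₁.s = R₂.s) {κ : Hat I A₁ ≃ₐ[ℂ] Hat J A₂}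
    (h : Equivariant D₁ D₂ κ) (u : ι → (Hat J A₂)ˣ)
    (hu : ∀ i, κ (toHat I (R₁.num i)) * toHat J (R₂.den i) =
      toHat J (R₂.num i) * κ (toHat I (R₁.den i)) * u i) :
    ∃ j : HatF I H₁ ≃ₐ[ℂ] HatF J H₂, (∀ i, j (R₁.tau I i) = R₂.tau J i) ∧
      (∀ x, j (hatToF I H₁ (hatMap I R₁.inc x)) = hatToF J H₂ (hatMap J R₂.inc (κ x))) ∧
      j '' Set.range (hatToF I H₁) = Set.range (hatToF J H₂) := by
  obtain ⟨K, hK, hK'⟩ := h.exists_extension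
  obtain ⟨j, hj⟩ := exists_conj R₁ R₂ K hK'
  have hinc : ∀ x, j (fMap I R₁.inc x) = fMap J R₂.inc (K x) := by
    intro x
    apply R₂.repF_injective J
    ext y
    obtain ⟨y, rfl⟩ := K.surjective y
    rw [hj, R₁.repF_inc, R₂.repF_inc, map_mul]
  have htau : ∀ i, j (R₁.tau I i) = R₂.tau J i := by
    intro i
    apply R₂.repF_injective J
    ext y
    obtain ⟨y, rfl⟩ := K.surjective y
    rw [hj, R₁.repF_tau, R₂.repF_tau, hK', hs]
  have hκ : ∀ x, j (hatToF I H₁ (hatMap I R₁.inc x)) = hatToF J H₂ (hatMap J R₂.inc (κ x)) := by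
    intro x
    rw [hatToF_hatMap, hinc, hK, ← hatToF_hatMap]
  have hfac : ∀ i, K (R₁.fac I i) = R₂.fac J i * hatToF J A₂ (u i) := by
    intro i
    have hd₁ := (D₁.isUnit_toF I (R₁.den_ne_zero i))
    have hd₂ := (D₂.isUnit_toF J (R₂.den_ne_zero i))
    have h1 : K (R₁.fac I i) * K (toF I (R₁.den i)) = K (toF I (R₁.num i)) := by
      rw [← map_mul, HeckeRep.fac, mul_assoc, Ring.inverse_mul_cancel _ hd₁, mul_one]
    have h2 : R₂.fac J i * toF J (R₂.den i) = toF J (R₂.num i) := by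
      rw [HeckeRep.fac, mul_assoc, Ring.inverse_mul_cancel _ hd₂, mul_one]
    have h3 := congrArg (hatToF J A₂) (hu i)
    simp only [map_mul, ← hK, hatToF_toHat] at h3
    refine ((hd₁.map K).mul hd₂).mul_right_cancel ?_
    rw [← mul_assoc, h1, h3, ← h2]
    ring
  have hT : ∀ i, j (toF I (R₁.T (R₁.s i)) + 1) =
      (toF J (R₂.T (R₂.s i)) + 1) * hatToF J H₂ (hatMap J R₂.inc (u i)) := by
    intro i
    rw [R₁.T_add_one, R₂.T_add_one, map_mul, map_add, map_one, htau, hinc, hfac, map_mul,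
      hatToF_hatMap, mul_assoc]
  refine ⟨j, htau, hκ, ?_⟩
  have hκ' : ∀ x, j.symm (hatToF J H₂ (hatMap J R₂.inc x)) =
      hatToF I H₁ (hatMap I R₁.inc (κ.symm x)) := by
    intro x
    rw [AlgEquiv.symm_apply_eq, hκ, AlgEquiv.apply_symm_apply]
  -- The inverse satisfies the same kind of formula with the inverse units; this is where
  -- invertibility of the factors is needed.
  have hT' : ∀ i, j.symm (toF J (R₂.T (R₂.s i)) + 1) =
      (toF I (R₁.T (R₁.s i)) + 1) * hatToF I H₁ (hatMap I R₁.inc (κ.symm ↑(u i)⁻¹)) := by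
    intro i
    rw [AlgEquiv.symm_apply_eq, map_mul, hT, hκ, AlgEquiv.apply_symm_apply, mul_assoc, ← map_mul,
      ← map_mul, Units.mul_inv, map_one, map_one, mul_one]
  apply Set.eq_of_subset_of_subset
  · rintro _ ⟨_, ⟨x, rfl⟩, rfl⟩
    exact exists_hatToF_eq R₁ R₂ hκ hT x
  · rintro _ ⟨x, rfl⟩
    exact ⟨_, exists_hatToF_eq R₂ R₁ hκ' hT' x, AlgEquiv.apply_symm_apply ..⟩

omit [IsDomain A₁] [IsDomain A₂] [IsNoetherianRing Z₁] [IsNoetherianRing Z₂] in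
lemma image_center {j : HatF I H₁ ≃ₐ[ℂ] HatF J H₂} {κ : Hat I A₁ ≃ₐ[ℂ] Hat J A₂}
    (h : Equivariant D₁ D₂ κ)
    (hκ : ∀ x, j (hatToF I H₁ (hatMap I R₁.inc x)) = hatToF J H₂ (hatMap J R₂.inc (κ x))) :
    j '' Set.range (zHatToF I H₁) = Set.range (zHatToF J H₂) := by
  have h₁ : ∀ r, zHatToF I H₁ r = hatToF I H₁ (hatMap I R₁.inc (hatTmul I r 1)) := fun r => by
    rw [hatMap_hatTmul, map_one]; rfl
  have h₂ : ∀ r, zHatToF J H₂ r = hatToF J H₂ (hatMap J R₂.inc (hatTmul J r 1)) := fun r => by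
    rw [hatMap_hatTmul, map_one]; rfl
  apply Set.eq_of_subset_of_subset
  · rintro _ ⟨_, ⟨r, rfl⟩, rfl⟩
    obtain ⟨r', hr'⟩ := h.map_center r
    exact ⟨r', by rw [h₁, hκ, h₂, hr']⟩
  · rintro _ ⟨r, rfl⟩
    obtain ⟨r', hr'⟩ := h.symm.map_center r
    exact ⟨_, ⟨r', rfl⟩, by rw [h₁, hκ, h₂, hr', AlgEquiv.apply_symm_apply]⟩

end Iso

/-! ### Sign projectors and what they absorb. -/

/-- A sign projector: a combination of the elements `(-1) ^ l(w) T_w`, with coefficients of sum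
one, which is annihilated by the elements `T_s + 1`. -/
structure IsSignProjector {W Z A H ι : Type*} [Group W] [Fintype W] [CommRing Z] [CommRing A]
    [Algebra Z A] {D : InvAction W Z A} [Ring H] [Algebra Z H] [Algebra ℂ H]
    (R : HeckeRep D H ι) (S : H) : Prop where
  exists_eq : ∃ (l : W → ℕ) (c : W → ℂ), S = ∑ w, (c w * (-1) ^ l w) • R.T w ∧ ∑ w, c w = 1 ∧
    (∀ w, c w ≠ 0) ∧ ∀ w, ∃ L : List ι, L.length = l w ∧ (L.map fun i => R.T (R.s i)).prod = R.T w
  mul_right : ∀ i, S * (R.T (R.s i) + 1) = 0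
  mul_left : ∀ i, (R.T (R.s i) + 1) * S = 0

namespace IsSignProjector

variable {W Z A H ι : Type*} [Group W] [Fintype W] [CommRing Z] [CommRing A]
  [Algebra Z A] {D : InvAction W Z A} [Ring H] [Algebra Z H] [Algebra ℂ H] [Algebra ℂ Z]
  [IsScalarTower ℂ Z H] {R : HeckeRep D H ι} {S : H} (hS : IsSignProjector R S) (J : Ideal Z)

include hS

omit [Algebra ℂ Z] [IsScalarTower ℂ Z H] in
lemma T_mul (w : W) : ∃ n : ℕ, R.T w * S = (-1) ^ n * S := by
  obtain ⟨L, hL⟩ := R.T_word w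
  refine ⟨L.length, ?_⟩
  rw [← hL]
  clear hL
  induction L with
  | nil => simp
  | cons i L ih =>
    rw [List.map_cons, List.prod_cons, mul_assoc, ih, List.length_cons, pow_succ]
    have h1 : R.T (R.s i) * S = -S := by
      have := hS.mul_left i
      rwa [add_mul, one_mul, add_eq_zero_iff_eq_neg] at this
    have h2 : Commute (R.T (R.s i)) ((-1) ^ L.length) :=
      ((Commute.one_right _).neg_right).pow_right _
    rw [← mul_assoc, h2.eq, mul_assoc, h1]
    simp

variable {J}

/-- Such a y satisfies y T_w = (-1)^l(w) y. The signs cancel those in the projector, and the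
remaining coefficients sum to one. -/
lemma mul_eq_self {y : HatF J H} (hy : ∀ i, y * (toF J (R.T (R.s i)) + 1) = 0) :
    y * toF J S = y := by
  obtain ⟨l, c, hSc, hc, -, hl⟩ := hS.exists_eq
  have h1 : ∀ w, y * toF J (R.T w) = (-1 : ℂ) ^ l w • y := by
    intro w
    obtain ⟨L, hLl, hL⟩ := hl w
    rw [← hL, ← hLl]
    clear hL hLl
    induction L using List.reverseRecOn with
    | nil => simp
    | append_singleton L i ih =>
      have h2 : y * toF J (R.T (R.s i)) = -y := by
        have := hy i
        rwa [mul_add, mul_one, add_eq_zero_iff_eq_neg] at this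
      rw [List.map_append, List.prod_append, map_mul, ← mul_assoc, ih, List.length_append,
        List.map_singleton, List.prod_singleton, smul_mul_assoc, h2, List.length_singleton,
        pow_succ, mul_smul, neg_one_smul]
  have h2 : ∀ (c : ℂ) (h : H), toF J (c • h) = c • toF J h := fun c h =>
    map_smul (AlgHom.restrictScalars ℂ (toF J)) c h
  rw [hSc, map_sum, Finset.mul_sum]
  simp only [h2, mul_smul_comm, h1, smul_smul]
  rw [← Finset.sum_smul]
  simp only [mul_assoc, ← mul_pow, neg_mul_neg, one_pow, mul_one, hc, one_smul]

/-- Expand y in the T_w and use y = yS: every T_w turns into a sign in front of S. -/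
lemma exists_mul {y : HatF J H} (hy : ∀ i, y * (toF J (R.T (R.s i)) + 1) = 0)
    (hy' : y ∈ Set.range (hatToF J H)) :
    ∃ a : Hat J A, y = hatToF J H (hatMap J R.inc a) * toF J S := by
  obtain ⟨x, rfl⟩ := hy'
  rw [← hS.mul_eq_self hy]
  obtain ⟨f, rfl⟩ := R.hat_span J x
  choose n hn using hS.T_mul
  refine ⟨∑ w, f w * (-1) ^ n w, ?_⟩
  simp only [map_sum, Finset.sum_mul, map_mul, mul_assoc, hatToF_toHat]
  refine Finset.sum_congr rfl fun w _ => ?_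
  rw [← map_mul (toF J), hn]
  simp

/-- The T_w are independent over the localized commutative algebra, and the coefficient of S at the
identity is a nonzero scalar. -/
lemma eq_one_of_mul_eq [IsDomain A] [IsNoetherianRing Z] {a : Hat J A}
    (h : hatToF J H (hatMap J R.inc a) * toF J S = toF J S) : a = 1 := by
  obtain ⟨l, c, hSc, -, hc, -⟩ := hS.exists_eq
  have h2 : ∀ (c : ℂ) (h : H), toF J (c • h) = c • toF J h := fun c h =>
    map_smul (AlgHom.restrictScalars ℂ (toF J)) c h
  have h3 : ∀ (c : ℂ) (h : HatF J A), fMap J R.inc (c • h) = c • fMap J R.inc h := fun c h =>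
    map_smul (AlgHom.restrictScalars ℂ (fMap J R.inc)) c h
  have h4 : ∑ w, fMap J R.inc ((c w * (-1) ^ l w) • hatToF J A (a - 1)) * toF J (R.T w) = 0 := by
    rw [← sub_eq_zero, ← sub_one_mul, hSc, map_sum, Finset.mul_sum] at h
    rw [← h]
    refine Finset.sum_congr rfl fun w _ => ?_
    rw [h3, h2, mul_smul_comm, smul_mul_assoc, hatToF_hatMap, map_sub, map_sub, map_one, map_one]
  have h5 := congrFun (R.eq_zero_of_sum_eq_zero J h4) 1
  have h6 : hatToF J A (a - 1) = 0 :=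
    (smul_eq_zero_iff_right (mul_ne_zero (hc 1) (pow_ne_zero _ (by norm_num)))).mp h5
  exact sub_eq_zero.mp (D.hatToF_injective J (by rw [h6, map_zero]))

end IsSignProjector

/-! ### Comparison of the two sign projectors. -/

section Main

variable {W Z₁ A₁ H₁ Z₂ A₂ H₂ ι : Type*} [Group W] [Fintype W] [CommRing Z₁] [CommRing A₁]
  [Algebra Z₁ A₁] [CommRing Z₂] [CommRing A₂] [Algebra Z₂ A₂] [Algebra ℂ Z₁] [Algebra ℂ Z₂]
  {D₁ : InvAction W Z₁ A₁} {D₂ : InvAction W Z₂ A₂} {I : Ideal Z₁} {J : Ideal Z₂}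
  [Ring H₁] [Algebra Z₁ H₁] [Ring H₂] [Algebra Z₂ H₂] [Algebra ℂ H₁] [Algebra ℂ H₂]
  [IsScalarTower ℂ Z₁ H₁] [IsScalarTower ℂ Z₂ H₂]
  {R₁ : HeckeRep D₁ H₁ ι} {R₂ : HeckeRep D₂ H₂ ι}
  [IsDomain A₁] [IsDomain A₂] [IsNoetherianRing Z₁] [IsNoetherianRing Z₂]

omit [IsScalarTower ℂ Z₁ H₁] [IsScalarTower ℂ Z₂ H₂] [Algebra ℂ H₂] in
-- T_s + 1 and τ_s + 1 differ by a unit on the right, so being killed by one means being killed by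
-- the other; and j matches the τ_s.
lemma IsSignProjector.image_mul {S₁ : H₁} (hS₁ : IsSignProjector R₁ S₁)
    {j : HatF I H₁ ≃ₐ[ℂ] HatF J H₂} (htau : ∀ i, j (R₁.tau I i) = R₂.tau J i) (i : ι) :
    j (toF I S₁) * (toF J (R₂.T (R₂.s i)) + 1) = 0 := by
  have hu : IsUnit (fMap I R₁.inc (R₁.fac I i)) := (R₁.isUnit_fac I i).map _
  have h1 : toF I S₁ * (R₁.tau I i + 1) = 0 := by
    have := congrArg (toF I) (hS₁.mul_right i)
    rw [map_mul, map_add, map_one, R₁.T_add_one, map_zero, ← mul_assoc] at this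
    exact hu.mul_left_eq_zero.mp this
  rw [R₂.T_add_one, ← mul_assoc, ← htau, ← map_one j, ← map_add, ← map_mul, h1, map_zero, zero_mul]

/-- The situation is symmetric: j(S₁) is a multiple of S₂ and j⁻¹(S₂) a multiple of S₁. The product
of the two multipliers fixes S₂, hence is 1. -/
theorem exists_sign_unit {S₁ : H₁} {S₂ : H₂} (hS₁ : IsSignProjector R₁ S₁)
    (hS₂ : IsSignProjector R₂ S₂) {j : HatF I H₁ ≃ₐ[ℂ] HatF J H₂}
    (htau : ∀ i, j (R₁.tau I i) = R₂.tau J i)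
    (hA : ∀ x, j (hatToF I H₁ (hatMap I R₁.inc x)) ∈
      Set.range fun y => hatToF J H₂ (hatMap J R₂.inc y))
    (hH : j '' Set.range (hatToF I H₁) = Set.range (hatToF J H₂)) :
    ∃ a : (Hat J A₂)ˣ, j (hatToF I H₁ (toHat I S₁)) =
      hatToF J H₂ (hatMap J R₂.inc a) * hatToF J H₂ (toHat J S₂) := by
  simp only [hatToF_toHat]
  have htau' : ∀ i, j.symm (R₂.tau J i) = R₁.tau I i := fun i => by
    rw [AlgEquiv.symm_apply_eq, htau]
  obtain ⟨a, ha⟩ := hS₂.exists_mul (hS₁.image_mul htau)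
    (by rw [← hH]; exact ⟨_, ⟨toHat I S₁, rfl⟩, congrArg j (hatToF_toHat S₁)⟩)
  obtain ⟨b, hb⟩ := hS₁.exists_mul (hS₂.image_mul htau') (by
    have : toF J S₂ ∈ j '' Set.range (hatToF I H₁) := by
      rw [hH]
      exact ⟨_, hatToF_toHat S₂⟩
    obtain ⟨x, hx, hx'⟩ := this
    rwa [← hx', AlgEquiv.symm_apply_apply])
  obtain ⟨b', hb'⟩ := hA b
  have h1 : hatToF J H₂ (hatMap J R₂.inc (b' * a)) * toF J S₂ = toF J S₂ := by
    rw [map_mul, map_mul, mul_assoc, ← ha]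
    refine (congrArg (· * _) hb').trans ?_
    rw [← map_mul, ← hb, AlgEquiv.apply_symm_apply]
  have h2 := hS₂.eq_one_of_mul_eq h1
  exact ⟨⟨a, b', by rw [mul_comm, h2], h2⟩, ha⟩

end Main

/-! ### Inverses, right multiplication and reduced words for T and t. -/

section Lengths

variable {ι X Y : Type*} [AddCommGroup X] [AddCommGroup Y] {P : RootDatum ι X Y}
  [Finite ι] [P.IsReduced] {b : P.Base}

lemma len_inv_le (w : P.weylGroup) : len b w⁻¹ ≤ len b w := by
  obtain ⟨L, hL, hlen, rfl⟩ := exists_reduced b w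
  have h : (wordProd P L)⁻¹ = wordProd P L.reverse := by
    clear hL hlen
    induction L with
    | nil => simp [wordProd_nil]
    | cons i L ih =>
      rw [wordProd_cons, mul_inv_rev, ih, List.reverse_cons, wordProd_append, wordProd_cons,
        wordProd_nil, mul_one, refl_inv]
  rw [h, ← hlen, ← List.length_reverse]
  exact len_wordProd_le fun i hi => hL i (List.mem_reverse.mp hi)

lemma len_inv (w : P.weylGroup) : len b w⁻¹ = len b w :=
  le_antisymm (len_inv_le w) (by simpa using len_inv_le (b := b) w⁻¹)

lemma len_mul_refl_cases {i : ι} (hi : i ∈ b.support) (w : P.weylGroup) :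
    len b (w * refl P i) = len b w + 1 ∨ len b (w * refl P i) + 1 = len b w := by
  have := len_refl_mul_cases hi w⁻¹
  rwa [len_inv, ← len_inv (refl P i * w⁻¹), mul_inv_rev, inv_inv, refl_inv] at this

/-- One induction on the length serves the group itself (f = id), the T_w and the t_w. -/
lemma exists_reduced_map {M : Type*} [Monoid M] (f : P.weylGroup → M) (h1 : f 1 = 1)
    (hf : ∀ v w, len b (v * w) = len b v + len b w → f v * f w = f (v * w)) (w : P.weylGroup) :
    ∃ L : List b.support, L.length = len b w ∧ (L.map fun i : b.support => f (refl P i)).prod = f w := by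
  induction hn : len b w using Nat.strong_induction_on generalizing w with
  | _ n ih =>
    subst hn
    by_cases hw : w = 1
    · exact ⟨[], by rw [hw, len_one]; rfl, by rw [hw, h1]; rfl⟩
    obtain ⟨i, hi, v, rfl, hlen, hlt⟩ := exists_len_succ b w hw
    obtain ⟨L, hL, hL'⟩ := ih _ hlt v rfl
    refine ⟨⟨i, hi⟩ :: L, ?_, ?_⟩
    · rw [hlen, len_refl hi, List.length_cons, hL, add_comm]
    · rw [List.map_cons, List.prod_cons, hL', hf _ _ hlen]

end Lengths

/-! ### The Weyl group acting on ℂ[X] and on S(V). -/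

section Actions

variable {ι X Y : Type*} [Finite ι] [AddCommGroup X] [AddCommGroup Y] [Module.Free ℤ X]
  (P : RootDatum ι X Y)

lemma lin_injective : Function.Injective (lin : X → PolyAlg X) := by
  let b := Module.Free.chooseBasis ℤ X
  let c := b.baseChange ℂ
  intro x y hxy
  have h1 : ∀ i, b.repr x i = b.repr y i := by
    intro i
    have h2 := congrArg (SymmetricAlgebra.lift (c.coord i)) hxy
    simp only [lin, vec, SymmetricAlgebra.lift_ι_apply, Module.Basis.coord_apply, c,
      Module.Basis.baseChange_repr_tmul] at h2
    simpa using h2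
  exact b.repr.injective (Finsupp.ext h1)

/-- The action of the Weyl group on `ℂ[X]`. -/
def grpAction : InvAction P.weylGroup (invGrp P) (GrpAlg X) where
  act :=
    { toFun := actGrpInv P
      map_one' := AlgHom.ext (actGrp_one P)
      map_mul' := fun v w => AlgHom.ext (actGrp_mul P v w) }
  act_injective v w h := smul_ext fun x => θ_injective (by
    rw [← actGrp_θ, ← actGrp_θ]
    exact congrArg (fun f => f (θ x)) h)
  algebraMap_injective := Subtype.val_injective
  exists_eq a ha := ⟨⟨a, mem_invGrp.mpr ha⟩, rfl⟩

/-- The action of the Weyl group on `S(V)`. -/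
def symAction : InvAction P.weylGroup (invSym P) (PolyAlg X) where
  act :=
    { toFun := actSymInv P
      map_one' := AlgHom.ext (actSym_one P)
      map_mul' := fun v w => AlgHom.ext (actSym_mul P v w) }
  act_injective v w h := smul_ext fun x => lin_injective (by
    have h1 := congrArg (fun f => f (lin x)) h
    change actSym P v (lin x) = actSym P w (lin x) at h1
    rwa [actSym_vec, actSym_vec, actVC_tmul, actVC_tmul] at h1)
  algebraMap_injective := Subtype.val_injective
  exists_eq a ha := ⟨⟨a, mem_invSym.mpr ha⟩, rfl⟩

omit [Finite ι] [Module.Free ℤ X] in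
lemma grpAction_act_θ (w : P.weylGroup) (x : X) : (grpAction P).act w (θ x) = θ (w • x) :=
  actGrp_θ w x

omit [Finite ι] in
lemma symAction_act_lin (w : P.weylGroup) (x : X) : (symAction P).act w (lin x) = lin (w • x) := by
  change actSym P w (lin x) = _
  rw [actSym_vec, actVC_tmul]

variable [Module.Finite ℤ X]

instance finiteType_grpAlg : Algebra.FiniteType ℂ (GrpAlg X) := by
  have : AddMonoid.FG X := (AddGroup.fg_iff_addMonoid_fg).mp (Module.Finite.iff_addGroup_fg.mp ‹_›)
  infer_instance

omit [Module.Free ℤ X] in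
instance finiteType_polyAlg : Algebra.FiniteType ℂ (PolyAlg X) :=
  Algebra.FiniteType.equiv inferInstance
    (SymmetricAlgebra.equivMvPolynomial (Module.Free.chooseBasis ℂ (VC X))).symm

instance noetherian_invGrp : IsNoetherianRing (invGrp P) := (grpAction P).isNoetherianRing ℂ

instance noetherian_invSym : IsNoetherianRing (invSym P) := (symAction P).isNoetherianRing ℂ

end Actions

/-! ### The two Hecke algebras as instances of the framework. -/

section Data

variable {ι X Y : Type*} [Finite ι] [AddCommGroup X] [AddCommGroup Y] [Module.Free ℤ X]
  {P : RootDatum ι X Y} [P.IsReduced] (b : P.Base)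

/-- The affine Hecke algebra with its polynomial representation. -/
def affData {q : ℂ} (hq : q ≠ 0) : HeckeRep (grpAction P) (AffineHecke b q) b.support where
  s i := refl P i
  exists_word w := by
    obtain ⟨L, -, hL⟩ := exists_reduced_map (b := b) id rfl (fun _ _ _ => rfl) w
    exact ⟨L, hL⟩
  inc := grpToHeckeInv b q
  T := T b q
  T_word w := by
    obtain ⟨L, -, hL⟩ := exists_reduced_map (b := b) (T b q) (T_one b q) (T_mul b q) w
    exact ⟨L, hL⟩
  span := affineHecke_span b q
  rep := { (affRep b hq).toRingHom with
    commutes' := fun z => LinearMap.ext fun f => affRep_grpToHecke b hq z f }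
  rep_inc := affRep_grpToHecke b hq
  num i := q • θ (P.root i) - 1
  den i := θ (P.root i) - 1
  num_ne_zero i h := by
    have := congrArg (fun f => AddMonoidAlgebra.coeff f 0) h
    have h0 : (1 : GrpAlg X) = AddMonoidAlgebra.single 0 1 := rfl
    simp [h0, θ, P.ne_zero] at this
  den_ne_zero i h := by
    have := congrArg (fun f => AddMonoidAlgebra.coeff f 0) h
    have h0 : (1 : GrpAlg X) = AddMonoidAlgebra.single 0 1 := rfl
    simp [h0, θ, P.ne_zero] at this
  rep_T i f := by
    have h1 : (grpAction P).act (refl P i) (θ (P.root i)) = θ (-P.root i) := by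
      rw [grpAction_act_θ, refl_smul_root_self]
    have h2 : θ (P.root i) * θ (-P.root i) = 1 := by
      rw [← θ_add, add_neg_cancel, θ_zero]
    have h3 := mul_demazure (s := actGrpInv P (refl P i)) (h0 := one_sub_θ_ne_zero i.1)
      (h := one_sub_θ_dvd P i) f
    change (θ (P.root i) - 1) * actGrpInv P (refl P i) (θ (P.root i) - 1) *
      (affRep b hq (T b q (refl P i)) f + f) =
      actGrpInv P (refl P i) (θ (P.root i) - 1) * (q • θ (P.root i) - 1) * f +
      (θ (P.root i) - 1) * actGrpInv P (refl P i) (q • θ (P.root i) - 1) *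
        actGrpInv P (refl P i) f
    rw [affRep_T, afT_refl b hq i.2, afOp, heckeOp_apply, map_sub, map_sub, map_one]
    have h4 : actGrpInv P (refl P i) (q • θ (P.root i)) = q • θ (-P.root i) := by
      rw [← h1]
      exact map_smul (AlgHom.restrictScalars ℂ (actGrpInv P (refl P i))) q _
    rw [h4, show actGrpInv P (refl P i) (θ (P.root i)) = θ (-P.root i) from h1]
    simp only [Algebra.smul_def, map_sub, map_one]
    linear_combination -(θ (P.root i) - 1) * (algebraMap ℂ (GrpAlg X) q - 1) * h3 +
      (1 - algebraMap ℂ (GrpAlg X) q) * f * h2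

set_option synthInstance.maxHeartbeats 200000 in
/-- The graded affine Hecke algebra with its polynomial representation. -/
def grData (k : ℂ) : HeckeRep (symAction P) (GradedHecke b k) b.support where
  s i := refl P i
  exists_word w := by
    obtain ⟨L, -, hL⟩ := exists_reduced_map (b := b) id rfl (fun _ _ _ => rfl) w
    exact ⟨L, hL⟩
  inc := symToHeckeInv b k
  T := t b k
  T_word w := by
    obtain ⟨L, -, hL⟩ := exists_reduced_map (b := b) (t b k) (t_one b k)
      (fun v w _ => t_mul b k v w) w
    exact ⟨L, hL⟩
  span := gradedHecke_span b k
  rep := { (grRep b k).toRingHom with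
    commutes' := fun z => LinearMap.ext fun f => grRep_symToHecke b k z f }
  rep_inc := grRep_symToHecke b k
  num i := lin (P.root i) + algebraMap ℂ _ k
  den i := lin (P.root i)
  num_ne_zero i h := by
    -- At plus and minus the coroot, α + k takes the values 2 + k and -2 + k, which cannot both
    -- vanish.
    have h1 := congrArg (SymmetricAlgebra.lift (corootC P i)) h
    have h2 := congrArg (SymmetricAlgebra.lift (-corootC P i)) h
    simp only [map_add, lin, vec, SymmetricAlgebra.lift_ι_apply, AlgHom.commutes, map_zero,
      LinearMap.neg_apply, corootC_tmul] at h1 h2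
    have h3 : P.toLinearMap (P.root i) (P.coroot i) = 2 := P.root_coroot_two i
    rw [h3] at h1 h2
    have h4 : (4 : ℂ) = 0 := by
      push_cast at h1 h2
      linear_combination h1 - h2
    norm_num at h4
  den_ne_zero i := lin_root_ne_zero i.1
  rep_T i f := by
    have h1 : actSymInv P (refl P i) (lin (P.root i)) = - lin (P.root i) := by
      refine (symAction_act_lin P (refl P i) (P.root i)).trans ?_
      rw [refl_smul_root_self]
      exact (congrArg vec (TensorProduct.tmul_neg _ _)).trans (map_neg _ _)
    have h3 := mul_demazure (s := actSymInv P (refl P i)) (h0 := lin_root_ne_zero i.1)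
      (h := lin_root_dvd_inv P i) f
    have h4 : actSymInv P (refl P i) (algebraMap ℂ _ k) = algebraMap ℂ _ k :=
      (actSym P (refl P i)).commutes k
    change lin (P.root i) * actSymInv P (refl P i) (lin (P.root i)) *
      (grRep b k (t b k (refl P i)) f + f) =
      actSymInv P (refl P i) (lin (P.root i)) * (lin (P.root i) + algebraMap ℂ _ k) * f +
      lin (P.root i) * actSymInv P (refl P i) (lin (P.root i) + algebraMap ℂ _ k) *
        actSymInv P (refl P i) f
    rw [grRep_t, grT_refl b k i.2, grOp, heckeOp_apply, map_add, h1, h4]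
    simp only [Algebra.smul_def, map_one]
    linear_combination -lin (P.root i) * algebraMap ℂ (PolyAlg X) k * h3

end Data

/-! ### The two elements are sign projectors. -/

section Sign

variable {ι X Y : Type*} [Finite ι] [AddCommGroup X] [AddCommGroup Y]
  {P : RootDatum ι X Y} [P.IsReduced] (b : P.Base)

/-- Applied with the translation of W by a simple reflection, on the left or on the right. -/
lemma sum_eq_zero_of_neg {G M : Type*} [Fintype G] [AddCommGroup M] [Module ℂ M] (σ : G ≃ G)
    (f : G → M) (h : ∀ g, f (σ g) = - f g) : ∑ g, f g = 0 := by
  have h1 : ∑ g, f g = - ∑ g, f g := by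
    rw [← Finset.sum_neg_distrib]
    simp only [← h]
    exact (Equiv.sum_comp σ f).symm
  have h2 : (2 : ℂ) • ∑ g, f g = 0 := by
    rw [two_smul]
    exact add_eq_zero_iff_eq_neg.mpr h1
  exact (smul_eq_zero_iff_right two_ne_zero).mp h2

lemma T_mul_refl (q : ℂ) {i : ι} (hi : i ∈ b.support) (w : P.weylGroup)
    (h : len b (w * refl P i) = len b w + 1) :
    T b q w * T b q (refl P i) = T b q (w * refl P i) :=
  T_mul b q _ _ (by rw [h, len_refl hi])

lemma T_mul_refl' (q : ℂ) {i : ι} (hi : i ∈ b.support) (w : P.weylGroup)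
    (h : len b (w * refl P i) + 1 = len b w) :
    T b q w * T b q (refl P i) = (q - 1) • T b q w + q • T b q (w * refl P i) := by
  have h1 := T_mul_refl b q hi (w * refl P i) (by
    rw [mul_assoc, refl_mul_self, mul_one, h])
  rw [mul_assoc, refl_mul_self, mul_one] at h1
  conv_lhs => rw [← h1]
  rw [mul_assoc, T_sq b q hi, mul_add, mul_smul_comm, mul_smul_comm, h1, mul_one]

variable [Module.Free ℤ X]

/-- The terms of w and ws cancel: if ws is longer, then T_{ws}(T_s + 1) = q T_w(T_s + 1), and the
extra factor -1/q compensates. The same holds on the left. -/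
lemma isSignProjector_aff {q : ℂ} (hq : q ≠ 0)
    (hsum : ∑ w : P.weylGroup, (1 / q) ^ len b w ≠ 0) :
    IsSignProjector (affData b hq) (signAff b q) where
  exists_eq := by
    refine ⟨len b, fun w => (∑ w : P.weylGroup, (1 / q) ^ len b w)⁻¹ * (1 / q) ^ len b w, ?_, ?_,
      ?_, ?_⟩
    · rw [signAff, Finset.smul_sum]
      refine Finset.sum_congr rfl fun w _ => ?_
      rw [smul_smul, mul_assoc, ← mul_pow, mul_neg_one, neg_div]
      rfl
    · rw [← Finset.mul_sum, inv_mul_cancel₀ hsum]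
    · exact fun w => mul_ne_zero (inv_ne_zero hsum) (pow_ne_zero _ (one_div_ne_zero hq))
    · exact exists_reduced_map (b := b) (T b q) (T_one b q) (T_mul b q)
  mul_right i := by
    change signAff b q * (T b q (refl P i) + 1) = 0
    rw [signAff, smul_mul_assoc, Finset.sum_mul]
    refine (congrArg _ (sum_eq_zero_of_neg (Equiv.mulRight (refl P i.1)) _ ?_)).trans (smul_zero _)
    have key : ∀ w, len b (w * refl P i) = len b w + 1 →
        (-1 / q) ^ len b (w * refl P i) • T b q (w * refl P i) * (T b q (refl P i) + 1) =
          -((-1 / q) ^ len b w • T b q w * (T b q (refl P i) + 1)) := by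
      intro w hw
      have h1 := T_mul_refl b q i.2 w hw
      have h2 := T_mul_refl' b q i.2 (w * refl P i)
        (by rw [mul_assoc, refl_mul_self, mul_one, hw])
      rw [mul_assoc w, refl_mul_self, mul_one] at h2
      rw [smul_mul_assoc, smul_mul_assoc, mul_add, mul_add, h1, h2, mul_one, mul_one, hw, pow_succ,
        sub_smul, one_smul, sub_add_eq_add_sub, sub_add_cancel, ← smul_add, smul_smul, mul_assoc,
        div_mul_cancel₀ _ hq, mul_neg_one, neg_smul, add_comm]
    intro w
    rcases len_mul_refl_cases i.2 w with hw | hw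
    · exact key w hw
    · have := key (w * refl P i) (by rw [mul_assoc, refl_mul_self, mul_one, hw])
      rw [mul_assoc w, refl_mul_self, mul_one] at this
      exact (neg_eq_iff_eq_neg.mpr this).symm
  mul_left i := by
    change (T b q (refl P i) + 1) * signAff b q = 0
    rw [signAff, mul_smul_comm, Finset.mul_sum]
    refine (congrArg _ (sum_eq_zero_of_neg (Equiv.mulLeft (refl P i.1)) _ ?_)).trans (smul_zero _)
    have key : ∀ w, len b (refl P i * w) = len b w + 1 →
        (T b q (refl P i) + 1) * (-1 / q) ^ len b (refl P i * w) • T b q (refl P i * w) =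
          -((T b q (refl P i) + 1) * (-1 / q) ^ len b w • T b q w) := by
      intro w hw
      have h1 := T_refl_mul b q i.2 w hw
      have h2 := T_refl_mul' b q i.2 (refl P i * w)
        (by rw [← mul_assoc, refl_mul_self, one_mul, hw])
      rw [← mul_assoc, refl_mul_self, one_mul] at h2
      rw [mul_smul_comm, mul_smul_comm, add_mul, add_mul, h1, h2, one_mul, one_mul, hw, pow_succ,
        sub_smul, one_smul, sub_add_eq_add_sub, sub_add_cancel, ← smul_add, smul_smul, mul_assoc,
        div_mul_cancel₀ _ hq, mul_neg_one, neg_smul, add_comm]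
    intro w
    rcases len_refl_mul_cases i.2 w with hw | hw
    · exact key w hw
    · have := key (refl P i * w) (by rw [← mul_assoc, refl_mul_self, one_mul, hw])
      rw [← mul_assoc, refl_mul_self, one_mul] at this
      exact (neg_eq_iff_eq_neg.mpr this).symm

lemma isSignProjector_gr (k : ℂ) : IsSignProjector (grData b k) (signGr b k) where
  exists_eq := by
    have hc : (Nat.card P.weylGroup : ℂ) ≠ 0 := Nat.cast_ne_zero.mpr Nat.card_pos.ne'
    refine ⟨len b, fun w => (Nat.card P.weylGroup : ℂ)⁻¹, ?_, ?_, fun w => inv_ne_zero hc, ?_⟩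
    · rw [signGr, Finset.smul_sum]
      exact Finset.sum_congr rfl fun w _ => smul_smul ..
    · rw [Finset.sum_const, Finset.card_univ, nsmul_eq_mul, ← Nat.card_eq_fintype_card,
        mul_inv_cancel₀ hc]
    · exact exists_reduced_map (b := b) (t b k) (t_one b k) (fun v w _ => t_mul b k v w)
  mul_right i := by
    change signGr b k * (t b k (refl P i) + 1) = 0
    rw [signGr, smul_mul_assoc, Finset.sum_mul]
    refine (congrArg _ (sum_eq_zero_of_neg (Equiv.mulRight (refl P i.1)) _ ?_)).trans (smul_zero _)
    intro w
    have h1 : (-1 : ℂ) ^ len b (w * refl P i) = -(-1) ^ len b w := by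
      rcases len_mul_refl_cases i.2 w with hw | hw
      · rw [hw, pow_succ, mul_neg_one]
      · rw [← hw, pow_succ, mul_neg_one, neg_neg]
    rw [Equiv.coe_mulRight, h1, neg_smul, neg_mul, smul_mul_assoc, smul_mul_assoc, mul_add,
      mul_add, t_mul, t_mul, mul_assoc w, refl_mul_self, mul_one, mul_one, mul_one, add_comm]
  mul_left i := by
    change (t b k (refl P i) + 1) * signGr b k = 0
    rw [signGr, mul_smul_comm, Finset.mul_sum]
    refine (congrArg _ (sum_eq_zero_of_neg (Equiv.mulLeft (refl P i.1)) _ ?_)).trans (smul_zero _)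
    intro w
    have h1 : (-1 : ℂ) ^ len b (refl P i * w) = -(-1) ^ len b w := by
      rcases len_refl_mul_cases i.2 w with hw | hw
      · rw [hw, pow_succ, mul_neg_one]
      · rw [← hw, pow_succ, mul_neg_one, neg_neg]
    rw [Equiv.coe_mulLeft, h1, neg_smul, mul_neg, mul_smul_comm, mul_smul_comm, add_mul,
      add_mul, t_mul, t_mul, ← mul_assoc, refl_mul_self, one_mul, one_mul, one_mul, add_comm]

end Sign

/-! ### Exponential and logarithm in finite-dimensional algebras. -/

section Series

variable {B C : Type*} [CommRing B] [Algebra ℂ B] [CommRing C] [Algebra ℂ C]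

/-- The series `Σ c_m x ^ m` converges weakly to `y`. -/
def HasSer (c : ℕ → ℂ) (x y : B) : Prop :=
  ∀ φ : B →ₗ[ℂ] ℂ, HasSum (fun m => c m * φ (x ^ m)) (φ y)

lemma eq_of_forall_functional {x y : B} (h : ∀ φ : B →ₗ[ℂ] ℂ, φ x = φ y) : x = y := by
  rw [← sub_eq_zero]
  refine (Module.forall_dual_apply_eq_zero_iff ℂ (x - y)).mp fun φ => ?_
  rw [map_sub, h, sub_self]

lemma HasSer.unique {c : ℕ → ℂ} {x y y' : B} (h : HasSer c x y) (h' : HasSer c x y') : y = y' :=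
  eq_of_forall_functional fun φ => (h φ).unique (h' φ)

lemma HasSer.map {c : ℕ → ℂ} {x y : B} (h : HasSer c x y) (f : B →ₐ[ℂ] C) :
    HasSer c (f x) (f y) := fun φ => by
  simpa using h (φ ∘ₗ f.toLinearMap)

lemma HasSer.mul_shift {c : ℕ → ℂ} {x y y' : B} (h : HasSer c x y)
    (h' : HasSer (fun m => c (m + 1)) x y') : x * y' = y - algebraMap ℂ B (c 0) := by
  refine eq_of_forall_functional fun φ => ?_
  have h1 : HasSum (fun m => c (m + 1) * φ (x ^ (m + 1))) (φ (x * y')) := by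
    simpa [pow_succ'] using h' (φ ∘ₗ LinearMap.mulLeft ℂ x)
  rw [hasSum_nat_add_iff' (f := fun m => c m * φ (x ^ m)) 1 |>.mpr (h φ) |>.unique h1 |>.symm]
  simp [Algebra.algebraMap_eq_smul_one]

/-- The coefficients of a series dominated by the exponential series. -/
def ExpBounded (c : ℕ → ℂ) : Prop := ∀ m, ‖c m‖ ≤ ((m.factorial : ℝ))⁻¹

/-- The regular representation puts B inside a normed matrix algebra, where series can be summed. -/
lemma exists_banach_rep (B : Type*) [CommRing B] [Algebra ℂ B] [Module.Finite ℂ B] :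
    ∃ (M : Type) (_ : NormedRing M) (_ : NormedAlgebra ℂ M) (_ : FiniteDimensional ℂ M)
      (L : B →ₐ[ℂ] M), Function.Injective L :=
  ⟨Matrix (Fin (Module.finrank ℂ B)) (Fin (Module.finrank ℂ B)) ℂ, Matrix.linftyOpNormedRing,
    Matrix.linftyOpNormedAlgebra, inferInstanceAs (Module.Finite ℂ (Matrix _ _ ℂ)),
    Algebra.leftMulMatrix (Module.finBasis ℂ B), Algebra.leftMulMatrix_injective _⟩

lemma exists_hasSer_banach [Module.Finite ℂ B] {c : ℕ → ℂ} (hc : ExpBounded c) (x : B)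
    {M : Type} [NormedRing M] [NormedAlgebra ℂ M] [FiniteDimensional ℂ M]
    (L : B →ₐ[ℂ] M) (hL : Function.Injective L) :
    ∃ y : B, HasSer c x y ∧ HasSum (fun m => c m • L x ^ m) (L y) := by
  have : CompleteSpace M := FiniteDimensional.complete ℂ _
  have hs : Summable fun m => c m • L x ^ m := by
    refine Summable.of_norm_bounded (NormedSpace.norm_expSeries_summable' (𝕂 := ℂ) (L x))
      fun m => ?_
    rw [norm_smul, norm_smul, norm_inv, Complex.norm_natCast]
    exact mul_le_mul_of_nonneg_right (hc m) (norm_nonneg _)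
  obtain ⟨S, hS⟩ := hs
  -- L ∘ r is continuous and fixes every term of the series, so it fixes the sum, which therefore
  -- lies in the image of L.
  obtain ⟨r, hr⟩ := L.toLinearMap.exists_leftInverse_of_injective (LinearMap.ker_eq_bot.mpr hL)
  have hr' : ∀ b, r (L b) = b := fun b => congrArg (fun f => f b) hr
  have h1 := hS.mapL (LinearMap.toContinuousLinearMap (L.toLinearMap ∘ₗ r))
  have h2 : L (r S) = S := by
    refine HasSum.unique (f := fun m => c m • L x ^ m) ?_ hS
    refine Eq.mp (congrArg (HasSum · _) (funext fun m => ?_)) h1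
    change L (r (c m • L x ^ m)) = _
    rw [← map_pow, map_smul r, hr', map_smul]
  refine ⟨r S, fun φ => ?_, by rwa [h2]⟩
  have h3 := hS.mapL (LinearMap.toContinuousLinearMap (φ ∘ₗ r))
  refine Eq.mp (congrArg (HasSum · _) (funext fun m => ?_)) h3
  change φ (r (c m • L x ^ m)) = _
  rw [← map_pow, map_smul r, hr', map_smul, smul_eq_mul]

lemma exists_hasSer [Module.Finite ℂ B] {c : ℕ → ℂ} (hc : ExpBounded c) (x : B) :
    ∃ y : B, HasSer c x y := by
  obtain ⟨M, _, _, _, L, hL⟩ := exists_banach_rep B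
  obtain ⟨y, hy, -⟩ := exists_hasSer_banach hc x L hL
  exact ⟨y, hy⟩

/-- The coefficients of the exponential series and its shifts. -/
def expCoeff (l m : ℕ) : ℂ := ((m + l).factorial : ℂ)⁻¹

lemma expBounded_expCoeff (l : ℕ) : ExpBounded (expCoeff l) := fun m => by
  rw [expCoeff, norm_inv, Complex.norm_natCast]
  exact inv_anti₀ (by positivity) (by exact_mod_cast Nat.factorial_le (Nat.le_add_right m l))

lemma hasSer_exp_add [Module.Finite ℂ B] {x x' y y' : B} (h : HasSer (expCoeff 0) x y)
    (h' : HasSer (expCoeff 0) x' y') : HasSer (expCoeff 0) (x + x') (y * y') := by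
  obtain ⟨M, _, _, _, L, hL⟩ := exists_banach_rep B
  have : CompleteSpace M := FiniteDimensional.complete ℂ _
  have key : ∀ {x y : B}, HasSer (expCoeff 0) x y → L y = NormedSpace.exp (L x) := by
    intro x y h
    obtain ⟨z, hz, hz'⟩ := exists_hasSer_banach (expBounded_expCoeff 0) x L hL
    rw [h.unique hz]
    exact hz'.unique (NormedSpace.exp_series_hasSum_exp' (𝕂 := ℂ) (L x))
  obtain ⟨z, hz⟩ := exists_hasSer (expBounded_expCoeff 0) (x + x')
  have hcomm : Commute (L x) (L x') := (Commute.all x x').map L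
  let : NormedAlgebra ℚ M := NormedAlgebra.restrictScalars ℚ ℂ _
  have h1 : z = y * y' := hL (by
    rw [key hz, map_mul, map_add, NormedSpace.exp_add_of_commute hcomm, key h, key h'])
  rwa [← h1]

/-- The exponential in a finite-dimensional commutative algebra, and its shifts
`Σ x ^ m / (m + l)!`. -/
def fexp [Module.Finite ℂ B] (l : ℕ) (x : B) : B :=
  (exists_hasSer (expBounded_expCoeff l) x).choose

lemma hasSer_fexp [Module.Finite ℂ B] (l : ℕ) (x : B) : HasSer (expCoeff l) x (fexp l x) :=
  (exists_hasSer (expBounded_expCoeff l) x).choose_spec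

variable [Module.Finite ℂ B] [Module.Finite ℂ C]

lemma map_fexp (f : B →ₐ[ℂ] C) (l : ℕ) (x : B) : f (fexp l x) = fexp l (f x) :=
  ((hasSer_fexp l x).map f).unique (hasSer_fexp l (f x))

lemma fexp_add (x y : B) : fexp 0 (x + y) = fexp 0 x * fexp 0 y :=
  (hasSer_fexp 0 (x + y)).unique (hasSer_exp_add (hasSer_fexp 0 x) (hasSer_fexp 0 y))

lemma mul_fexp_succ (l : ℕ) (x : B) :
    x * fexp (l + 1) x = fexp l x - algebraMap ℂ B ((l.factorial : ℂ)⁻¹) := by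
  have h : (fun m => expCoeff l (m + 1)) = expCoeff (l + 1) := by
    funext m
    rw [expCoeff, expCoeff, add_right_comm, add_assoc]
  have := (hasSer_fexp l x).mul_shift (h ▸ hasSer_fexp (l + 1) x)
  rwa [expCoeff, zero_add] at this

lemma fexp_zero : fexp 0 (0 : B) = 1 := by
  have := mul_fexp_succ 0 (0 : B)
  rw [zero_mul, Nat.factorial_zero, Nat.cast_one, inv_one, map_one] at this
  exact (sub_eq_zero.mp this.symm)

lemma fexp_neg (x : B) : fexp 0 x * fexp 0 (-x) = 1 := by
  rw [← fexp_add, add_neg_cancel, fexp_zero]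

lemma fexp_complex (z : ℂ) : fexp 0 z = Complex.exp z := by
  have h := hasSer_fexp 0 z LinearMap.id
  have h2 := NormedSpace.exp_series_hasSum_exp' (𝕂 := ℂ) z
  rw [← Complex.exp_eq_exp_ℂ] at h2
  exact h.unique h2

omit [Module.Finite ℂ C] in
lemma algHom_fexp (χ : B →ₐ[ℂ] ℂ) (x : B) : χ (fexp 0 x) = Complex.exp (χ x) := by
  rw [map_fexp, fexp_complex]

lemma fexp_algebraMap (z : ℂ) : fexp 0 (algebraMap ℂ B z) = algebraMap ℂ B (Complex.exp z) := by
  rw [← fexp_complex, ← Algebra.ofId_apply, ← map_fexp, Algebra.ofId_apply]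

lemma exists_character (p : Ideal B) [hp : p.IsPrime] :
    ∃ χ : B →ₐ[ℂ] ℂ, ∀ b, χ b = 0 ↔ b ∈ p := by
  have h : Function.Bijective (algebraMap ℂ (B ⧸ p)) :=
    IsAlgClosed.algebraMap_bijective_of_isIntegral
  let e : ℂ ≃ₐ[ℂ] B ⧸ p := AlgEquiv.ofBijective (Algebra.ofId ℂ (B ⧸ p)) h
  refine ⟨e.symm.toAlgHom.comp (Ideal.Quotient.mkₐ ℂ p), fun b => ?_⟩
  change e.symm (Ideal.Quotient.mk p b) = 0 ↔ _
  rw [map_eq_zero_iff _ e.symm.injective, Ideal.Quotient.eq_zero_iff_mem]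

lemma isUnit_of_character {b : B} (h : ∀ χ : B →ₐ[ℂ] ℂ, χ b ≠ 0) : IsUnit b := by
  by_contra hb
  obtain ⟨p, hp, hbp⟩ := exists_max_ideal_of_mem_nonunits hb
  have := hp.isPrime
  obtain ⟨χ, hχ⟩ := exists_character p
  exact h χ ((hχ b).mpr hbp)

lemma isNilpotent_of_character {b : B} (h : ∀ χ : B →ₐ[ℂ] ℂ, χ b = 0) : IsNilpotent b := by
  rw [← mem_nilradical, nilradical_eq_sInf, Ideal.mem_sInf]
  intro p hp
  have : p.IsPrime := hp
  obtain ⟨χ, hχ⟩ := exists_character p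
  exact (hχ b).mp (h χ)

/-- Multiplying 1 + v by exp(-v) leaves an error divisible by v², so the exponent in the hypothesis
is halved at each step. -/
lemma exists_unipotent_log (k : ℕ) (v : B) (hv : v ^ 2 ^ k = 0) :
    ∃ n : B, IsNilpotent n ∧ fexp 0 n = 1 + v := by
  induction k generalizing v with
  | zero =>
    rw [pow_zero, pow_one] at hv
    exact ⟨0, IsNilpotent.zero, by rw [fexp_zero, hv, add_zero]⟩
  | succ k ih =>
    have h1 := mul_fexp_succ 0 (-v)
    have h2 := mul_fexp_succ 1 (-v)
    simp only [Nat.factorial_zero, Nat.factorial_one, Nat.cast_one, inv_one, map_one, zero_add,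
      one_add_one_eq_two] at h1 h2
    obtain ⟨n, hn, hn'⟩ := ih (fexp 0 (-v) * (1 + v) - 1) (by
      have : fexp 0 (-v) * (1 + v) - 1 = v ^ 2 * ((1 + v) * fexp 2 (-v) - 1) := by
        linear_combination (-(1 + v)) * h1 + v * (1 + v) * h2
      rw [this, mul_pow, ← pow_mul, ← pow_succ', hv, zero_mul])
    have hvn : IsNilpotent v := ⟨_, hv⟩
    refine ⟨n + v, Commute.isNilpotent_add (Commute.all n v) hn hvn, ?_⟩
    rw [fexp_add, hn']
    linear_combination (1 + v) * fexp_neg v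

/-- The difference d has exponential 1 and real values at all characters, so these vanish and d is
nilpotent. Then exp(d) - 1 is d times a unit. Without reality, periods 2πi would remain. -/
lemma log_unique {x y : B} (h : fexp 0 x = fexp 0 y)
    (hr : ∀ χ : B →ₐ[ℂ] ℂ, ∃ r : ℝ, χ x - χ y = r) : x = y := by
  set d := x - y with hd
  have h1 : fexp 0 d = 1 := by
    rw [hd, sub_eq_add_neg, fexp_add, h, fexp_neg]
  have h2 : IsNilpotent d := by
    refine isNilpotent_of_character fun χ => ?_
    obtain ⟨r, hr⟩ := hr χ
    rw [← map_sub] at hr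
    have h3 := algHom_fexp χ d
    rw [h1, map_one, hd, hr, ← Complex.ofReal_exp] at h3
    have h4 : Real.exp r = 1 := by exact_mod_cast h3.symm
    rw [hd, hr, (Real.exp_eq_one_iff r).mp h4, Complex.ofReal_zero]
  have h3 := mul_fexp_succ 0 d
  have h4 := mul_fexp_succ 1 d
  simp only [Nat.factorial_zero, Nat.factorial_one, Nat.cast_one, inv_one, map_one, zero_add,
    one_add_one_eq_two] at h3 h4
  have h5 : IsUnit (fexp 1 d) := by
    have h6 : fexp 1 d = d * fexp 2 d + 1 := by rw [h4]; ring
    rw [h6]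
    exact (Commute.isNilpotent_mul_right (Commute.all _ _) h2).isUnit_add_one
  rw [h1, sub_self] at h3
  exact sub_eq_zero.mp (h5.mul_left_eq_zero.mp h3)

/-- A polynomial in y interpolating the logarithm at the finitely many values χ(y) is right at every
character; the remaining factor is unipotent. -/
lemma exists_log {y : B} {c : ℂ} (hy : ∀ χ : B →ₐ[ℂ] ℂ, ∃ r : ℝ, χ y = Complex.exp (c + r)) :
    ∃ x : B, fexp 0 x = y ∧ ∀ χ : B →ₐ[ℂ] ℂ, ∃ r : ℝ, χ x = c + r := by
  classical
  have hint : IsIntegral ℂ y := Algebra.IsIntegral.isIntegral y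
  let s := (minpoly ℂ y).roots.toFinset
  have hs : ∀ χ : B →ₐ[ℂ] ℂ, χ y ∈ s := by
    intro χ
    rw [Multiset.mem_toFinset, Polynomial.mem_roots (minpoly.ne_zero hint), Polynomial.IsRoot]
    have h1 := congrArg χ (minpoly.aeval ℂ y)
    rwa [← Polynomial.aeval_algHom_apply, map_zero, Polynomial.coe_aeval_eq_eval] at h1
  -- The branch of the logarithm on the line c + ℝ: it sends e^(c + r) to c + r.
  let G : ℂ → ℂ := fun v => c + Real.log ‖v * Complex.exp (-c)‖
  let p := Lagrange.interpolate s id G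
  let a := Polynomial.aeval y p
  have ha : ∀ (χ : B →ₐ[ℂ] ℂ) (r : ℝ), χ y = Complex.exp (c + r) → χ a = c + r := by
    intro χ r hr
    have h1 : χ a = G (χ y) := by
      rw [← Polynomial.aeval_algHom_apply, Polynomial.coe_aeval_eq_eval]
      exact Lagrange.eval_interpolate_at_node G (Set.injOn_id _) (hs χ)
    rw [h1, hr]
    simp only [G]
    rw [← Complex.exp_add, add_neg_cancel_comm, Complex.norm_exp, Complex.ofReal_re, Real.log_exp]
  have hu : IsNilpotent (y * fexp 0 (-a) - 1) := by
    refine isNilpotent_of_character fun χ => ?_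
    obtain ⟨r, hr⟩ := hy χ
    rw [map_sub, map_mul, algHom_fexp, map_neg, ha χ r hr, hr, ← Complex.exp_add, add_neg_cancel,
      Complex.exp_zero, map_one, sub_self]
  obtain ⟨k, hk⟩ := hu
  obtain ⟨n, hn, hn'⟩ := exists_unipotent_log k _
    (pow_eq_zero_of_le (Nat.lt_two_pow_self).le hk)
  refine ⟨n + a, ?_, fun χ => ?_⟩
  · rw [fexp_add, hn']
    linear_combination y * fexp_neg a
  · obtain ⟨r, hr⟩ := hy χ
    exact ⟨r, by rw [map_add, ha χ r hr, (hn.map χ).eq_zero, zero_add]⟩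

end Series

universe u v

/-! ### The quotients A / JⁿA and the completion as their limit. -/

section Trunc

variable {Z : Type u} [CommRing Z] (J : Ideal Z) (A : Type u) [CommRing A] [Algebra Z A]

/-- The quotient `A / J ^ n A`. -/
abbrev Trunc (n : ℕ) : Type _ := (Z ⧸ J ^ n) ⊗[Z] A

/-- The quotient map. -/
def toTrunc (n : ℕ) : A →ₐ[Z] Trunc J A n := Algebra.TensorProduct.includeRight

/-- The transition maps between the quotients. -/
def truncMap {m n : ℕ} (h : m ≤ n) : Trunc J A n →ₐ[Z] Trunc J A m :=
  Algebra.TensorProduct.map (Ideal.Quotient.factorₐ Z (Ideal.pow_le_pow_right h)) (AlgHom.id Z A)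

variable {A}

lemma truncMap_toTrunc {m n : ℕ} (h : m ≤ n) (a : A) :
    truncMap J A h (toTrunc J A n a) = toTrunc J A m a := by
  simp [truncMap, toTrunc]

lemma toTrunc_surjective (n : ℕ) : Function.Surjective (toTrunc J A n) := by
  intro x
  obtain ⟨y, rfl⟩ := (TensorProduct.quotTensorEquivQuotSMul A (J ^ n)).symm.surjective x
  obtain ⟨a, rfl⟩ := Submodule.Quotient.mk_surjective _ y
  exact ⟨a, rfl⟩

lemma toTrunc_algebraMap {n : ℕ} {z : Z} (hz : z ∈ J ^ n) :
    toTrunc J A n (algebraMap Z A z) = 0 := by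
  rw [AlgHom.commutes, Algebra.TensorProduct.algebraMap_apply, Ideal.Quotient.algebraMap_eq,
    Ideal.Quotient.eq_zero_iff_mem.mpr hz, TensorProduct.zero_tmul]

lemma hatReduce_toHat (n : ℕ) (a : A) : hatReduce J A n (toHat J a) = toTrunc J A n a := by
  refine (Algebra.TensorProduct.map_tmul ..).trans ?_
  rw [map_one]
  rfl

lemma truncMap_hatReduce {m n : ℕ} (h : m ≤ n) (x : Hat J A) :
    truncMap J A h (hatReduce J A n x) = hatReduce J A m x := by
  induction x using hat_induction with
  | h r a =>
    change (Ideal.Quotient.factorₐ Z (Ideal.pow_le_pow_right h) (AdicCompletion.evalₐ J n r)) ⊗ₜ a =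
      (AdicCompletion.evalₐ J m r) ⊗ₜ[Z] a
    congr 1
    obtain ⟨r, rfl⟩ := AdicCompletion.mk_surjective J Z r
    rw [AdicCompletion.evalₐ_mk, AdicCompletion.evalₐ_mk]
    change Ideal.Quotient.mk (J ^ m) (r.val n) = _
    have := r.2 h
    rw [SModEq.sub_mem] at this
    rw [eq_comm, Ideal.Quotient.mk_eq_mk_iff_sub_mem]
    simpa using this
  | hadd x y hx hy => simp only [map_add, hx, hy]

/-- The completion as a completed module. -/
lemma quot_hatReduce [IsNoetherianRing Z] [Module.Finite Z A] (n : ℕ) (x : Hat J A) :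
    TensorProduct.quotTensorEquivQuotSMul A (J ^ n) (hatReduce J A n x) =
      (AdicCompletion.ofTensorProductEquivOfFiniteNoetherian J A x).val n := by
  induction x using hat_induction with
  | h r a =>
    change TensorProduct.quotTensorEquivQuotSMul A (J ^ n) ((AdicCompletion.evalₐ J n r) ⊗ₜ a) =
      (AdicCompletion.ofTensorProduct J A (r ⊗ₜ a)).val n
    rw [AdicCompletion.ofTensorProduct_tmul]
    obtain ⟨r, rfl⟩ := AdicCompletion.mk_surjective J Z r
    rw [AdicCompletion.evalₐ_mk, TensorProduct.quotTensorEquivQuotSMul_mk_tmul]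
    rfl
  | hadd x y hx hy =>
    rw [map_add, map_add, hx, hy]
    exact (congrArg (fun z : AdicCompletion J A => z.val n) (map_add
      (AdicCompletion.ofTensorProductEquivOfFiniteNoetherian J A) x y)).symm

variable [IsNoetherianRing Z] [Module.Finite Z A]

variable {J} in
-- For A finite over a noetherian Z, the tensor product with Ẑ is the J-adic completion of A, so
-- elements are determined by their reductions.
lemma hat_ext {x y : Hat J A} (h : ∀ n, hatReduce J A n x = hatReduce J A n y) : x = y := by
  apply (AdicCompletion.ofTensorProductEquivOfFiniteNoetherian J A).injective
  apply Subtype.ext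
  funext n
  exact (quot_hatReduce J n x).symm.trans ((congrArg _ (h n)).trans (quot_hatReduce J n y))

variable {J} in
lemma exists_hat {b : ∀ n, Trunc J A n}
    (hb : ∀ {m n : ℕ} (h : m ≤ n), truncMap J A h (b n) = b m) :
    ∃ x : Hat J A, ∀ n, hatReduce J A n x = b n := by
  let c : AdicCompletion J A :=
    ⟨fun n => TensorProduct.quotTensorEquivQuotSMul A (J ^ n) (b n), by
      intro m n h
      change AdicCompletion.transitionMap J A h (TensorProduct.quotTensorEquivQuotSMul A (J ^ n) (b n)) =
        TensorProduct.quotTensorEquivQuotSMul A (J ^ m) (b m)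
      rw [← hb h]
      obtain ⟨a, ha⟩ := toTrunc_surjective J n (b n)
      rw [← ha, truncMap_toTrunc]
      have h1 : ∀ n, TensorProduct.quotTensorEquivQuotSMul A (J ^ n) (toTrunc J A n a) =
          Submodule.Quotient.mk a := fun n =>
        TensorProduct.quotTensorEquivQuotSMul_mk_tmul (J ^ n) 1 a |>.trans (by rw [one_smul])
      rw [h1, h1]
      rfl⟩
  refine ⟨(AdicCompletion.ofTensorProductEquivOfFiniteNoetherian J A).symm c, fun n => ?_⟩
  apply (TensorProduct.quotTensorEquivQuotSMul A (J ^ n)).injective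
  refine (quot_hatReduce J n _).trans ?_
  rw [LinearEquiv.apply_symm_apply]

variable {J} in
lemma hat_isUnit {x : Hat J A} (h : ∀ n, IsUnit (hatReduce J A n x)) : IsUnit x := by
  choose u hu using h
  obtain ⟨y, hy⟩ := exists_hat (b := fun n => (↑(u n)⁻¹ : Trunc J A n)) (J := J) (A := A) (by
    intro m n h
    refine Units.eq_inv_of_mul_eq_one_left ?_
    rw [hu, ← truncMap_hatReduce J h, ← map_mul, ← hu, Units.mul_inv,
      map_one])
  refine IsUnit.of_mul_eq_one y (hat_ext fun n => ?_)
  rw [map_mul, hy, ← hu, Units.mul_inv, map_one]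

end Trunc

/-! ### Homomorphisms of completions from compatible homomorphisms of quotients. -/

section HatEquiv

variable {Z₁ A₁ : Type u} {Z₂ A₂ : Type v} [CommRing Z₁] [CommRing A₁]
  [Algebra Z₁ A₁] [CommRing Z₂] [CommRing A₂] [Algebra Z₂ A₂] [Algebra ℂ Z₁] [Algebra ℂ Z₂]
  [IsNoetherianRing Z₂] [Module.Finite Z₂ A₂]
  {I : Ideal Z₁} {J : Ideal Z₂}

instance truncTower {Z : Type u} [CommRing Z] [Algebra ℂ Z] (J : Ideal Z) (A : Type u) [CommRing A]
    [Algebra Z A] (n : ℕ) : IsScalarTower ℂ Z (Trunc J A n) :=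
  ⟨fun c z x => by
    induction x using TensorProduct.induction_on with
    | zero => simp only [smul_zero]
    | add x y hx hy => simp only [smul_add, hx, hy]
    | tmul r a => simp only [TensorProduct.smul_tmul', smul_assoc]⟩

lemma hatReduce_algebraMap {Z : Type u} [CommRing Z] [Algebra ℂ Z] (J : Ideal Z) (A : Type u)
    [CommRing A] [Algebra Z A] (n : ℕ) (c : ℂ) :
    hatReduce J A n (algebraMap ℂ _ c) = algebraMap ℂ _ c :=
  (AlgHom.restrictScalars ℂ (hatReduce J A n)).commutes c

lemma exists_hatHom (e : ∀ n, Trunc I A₁ n →ₐ[ℂ] Trunc J A₂ n)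
    (he : ∀ {m n : ℕ} (h : m ≤ n) x, truncMap J A₂ h (e n x) = e m (truncMap I A₁ h x)) :
    ∃ κ : Hat I A₁ →ₐ[ℂ] Hat J A₂, ∀ n x, hatReduce J A₂ n (κ x) = e n (hatReduce I A₁ n x) := by
  have h : ∀ x : Hat I A₁, ∃ y : Hat J A₂, ∀ n, hatReduce J A₂ n y = e n (hatReduce I A₁ n x) :=
    fun x => exists_hat fun {m n} h => by rw [he, truncMap_hatReduce]
  choose f hf using h
  refine ⟨{ toFun := f, map_one' := ?_, map_mul' := ?_, map_zero' := ?_, map_add' := ?_,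
            commutes' := ?_ }, fun n x => hf x n⟩
  · exact hat_ext fun n => by simp only [hf, map_one]
  · exact fun x y => hat_ext fun n => by simp only [hf, map_mul]
  · exact hat_ext fun n => by simp only [hf, map_zero]
  · exact fun x y => hat_ext fun n => by simp only [hf, map_add]
  · exact fun c => hat_ext fun n => by
      simp only [hf, hatReduce_algebraMap, AlgHom.commutes]

lemma exists_hatEquiv [IsNoetherianRing Z₁] [Module.Finite Z₁ A₁]
    (e : ∀ n, Trunc I A₁ n ≃ₐ[ℂ] Trunc J A₂ n)
    (he : ∀ {m n : ℕ} (h : m ≤ n) x, truncMap J A₂ h (e n x) = e m (truncMap I A₁ h x)) :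
    ∃ κ : Hat I A₁ ≃ₐ[ℂ] Hat J A₂, ∀ n x, hatReduce J A₂ n (κ x) = e n (hatReduce I A₁ n x) := by
  obtain ⟨κ, hκ⟩ := exists_hatHom (fun n => (e n).toAlgHom) he
  obtain ⟨κ', hκ'⟩ := exists_hatHom (fun n => (e n).symm.toAlgHom) fun {m n} h x => by
    apply (e m).injective
    change e m _ = e m ((e m).symm _)
    rw [← he, AlgEquiv.apply_symm_apply]
    exact congrArg _ ((e n).apply_symm_apply x)
  refine ⟨AlgEquiv.ofAlgHom κ κ' (AlgHom.ext fun x => hat_ext fun n => ?_)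
    (AlgHom.ext fun x => hat_ext fun n => ?_), hκ⟩
  · refine (hκ n _).trans ?_
    exact (congrArg (e n) (hκ' n x)).trans ((e n).apply_symm_apply _)
  · refine (hκ' n _).trans ?_
    exact (congrArg (e n).symm (hκ n x)).trans ((e n).symm_apply_apply _)

end HatEquiv

/-! ### Characters of the quotients at a point. -/

section TruncC

variable {Z : Type u} [CommRing Z] (J : Ideal Z) {A : Type u} [CommRing A] [Algebra Z A]
  [Algebra ℂ Z] [Algebra ℂ A] [IsScalarTower ℂ Z A]

/-- The quotient map, as a homomorphism of complex algebras. -/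
def toTruncC (n : ℕ) : A →ₐ[ℂ] Trunc J A n := (toTrunc J A n).restrictScalars ℂ

omit [Algebra ℂ Z] [Algebra ℂ A] [IsScalarTower ℂ Z A] in
variable {J} in
lemma mem_of_toTrunc_eq_zero {n : ℕ} {a : A} (ha : toTrunc J A n a = 0) :
    a ∈ (J ^ n • ⊤ : Submodule Z A) := by
  have h := congrArg (TensorProduct.quotTensorEquivQuotSMul A (J ^ n)) ha
  rw [map_zero] at h
  have h1 : TensorProduct.quotTensorEquivQuotSMul A (J ^ n) (toTrunc J A n a) =
      Submodule.Quotient.mk a :=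
    TensorProduct.quotTensorEquivQuotSMul_mk_tmul (J ^ n) 1 a |>.trans (by rw [one_smul])
  rw [h1] at h
  exact (Submodule.Quotient.mk_eq_zero _).mp h

variable {B : Type*} [CommRing B] [Algebra ℂ B]

variable {J} in
lemma exists_trunc_lift {n : ℕ} (f : A →ₐ[ℂ] B) (hf : ∀ z ∈ J ^ n, f (algebraMap Z A z) = 0) :
    ∃ g : Trunc J A n →ₐ[ℂ] B, ∀ a, g (toTrunc J A n a) = f a := by
  have hker : RingHom.ker (toTruncC J n : A →ₐ[ℂ] Trunc J A n) ≤ RingHom.ker f := by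
    intro a ha
    refine Submodule.smul_induction_on (mem_of_toTrunc_eq_zero ha) (fun z hz a _ => ?_)
      fun a b ha hb => add_mem ha hb
    rw [RingHom.mem_ker, Algebra.smul_def, map_mul, hf z hz, zero_mul]
  exact ⟨AlgHom.liftOfSurjective (toTruncC J n) (toTrunc_surjective J n) f hker,
    AlgHom.liftOfSurjective_apply (toTruncC J n) (toTrunc_surjective J n) f hker⟩

omit [Algebra ℂ Z] [Algebra ℂ A] [IsScalarTower ℂ Z A] in
lemma trunc_zero (x : Trunc J A 0) : x = 0 := by
  obtain ⟨a, rfl⟩ := toTrunc_surjective J 0 x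
  rw [← mul_one a, map_mul, ← map_one (algebraMap Z A),
    toTrunc_algebraMap (J := J) (by simp), mul_zero]

variable (ev : A →ₐ[ℂ] ℂ)

/-- The ideal of elements of `Z` vanishing at a character of `A`. -/
abbrev pointIdeal (Z : Type u) [CommRing Z] [Algebra ℂ Z] [Algebra Z A] [IsScalarTower ℂ Z A]
    (ev : A →ₐ[ℂ] ℂ) : Ideal Z :=
  RingHom.ker (ev.comp (IsScalarTower.toAlgHom ℂ Z A))

lemma sub_mem_pointIdeal (z : Z) : z - algebraMap ℂ Z (ev (algebraMap Z A z)) ∈ pointIdeal Z ev := by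
  rw [RingHom.mem_ker, map_sub, AlgHom.commutes, sub_eq_zero]
  rfl

/-- Every z is a root of (X - z(p))ⁿ, where z(p) is its value at the point p given by `ev`; integral
and of finite type together give finite. -/
lemma finite_quotient_pointIdeal [Algebra.FiniteType ℂ Z] (n : ℕ) :
    Module.Finite ℂ (Z ⧸ pointIdeal Z ev ^ n) := by
  have : Algebra.IsIntegral ℂ (Z ⧸ pointIdeal Z ev ^ n) := by
    refine ⟨fun x => ?_⟩
    obtain ⟨z, rfl⟩ := Ideal.Quotient.mk_surjective x
    refine ⟨(Polynomial.X - Polynomial.C (ev (algebraMap Z A z))) ^ n,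
      (Polynomial.monic_X_sub_C _).pow n, ?_⟩
    rw [Polynomial.eval₂_pow, Polynomial.eval₂_sub, Polynomial.eval₂_X, Polynomial.eval₂_C]
    exact Ideal.Quotient.eq_zero_iff_mem.mpr (Ideal.pow_mem_pow (sub_mem_pointIdeal ev z) n)
  exact Algebra.IsIntegral.finite

lemma finite_trunc [Algebra.FiniteType ℂ Z] [Module.Finite Z A] (n : ℕ) :
    Module.Finite ℂ (Trunc (pointIdeal Z ev) A n) := by
  have := finite_quotient_pointIdeal (Z := Z) ev n
  exact Module.Finite.trans (Z ⧸ pointIdeal Z ev ^ n) _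

variable {n : ℕ} (χ : Trunc (pointIdeal Z ev) A n →ₐ[ℂ] ℂ)

variable {ev} in
lemma character_center (z : Z) :
    χ (toTrunc (pointIdeal Z ev) A n (algebraMap Z A z)) = ev (algebraMap Z A z) := by
  have h1 : toTruncC (pointIdeal Z ev) n (algebraMap Z A (z - algebraMap ℂ Z (ev (algebraMap Z A z)))) ^ n
      = 0 := by
    rw [← map_pow, ← map_pow]
    exact toTrunc_algebraMap _ (Ideal.pow_mem_pow (sub_mem_pointIdeal ev z) n)
  have h2 := congrArg χ h1
  rw [map_pow, map_zero] at h2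
  have h3 := eq_zero_of_pow_eq_zero h2
  rw [map_sub, ← IsScalarTower.algebraMap_apply, map_sub, map_sub, AlgHom.commutes,
    AlgHom.commutes, sub_eq_zero] at h3
  exact h3

variable {W : Type*} [Group W] [Fintype W] (D : InvAction W Z A)

include D in
variable {ev} in
-- The norm of a - χ(a) is killed by χ. Being central it is also killed by `ev`, so some factor w(a)
-- - χ(a) vanishes at the point.
lemma exists_character_eq (a : A) : ∃ w, χ (toTrunc (pointIdeal Z ev) A n a) = ev (D.act w a) := by
  obtain ⟨z, hz⟩ := D.exists_norm (a - algebraMap ℂ A (χ (toTrunc (pointIdeal Z ev) A n a)))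
  have hact : ∀ (w : W) (c : ℂ), D.act w (algebraMap ℂ A c) = algebraMap ℂ A c := fun w c =>
    ((D.act w).restrictScalars ℂ).commutes c
  have h1 := character_center χ z
  rw [hz, map_prod, map_prod, map_prod,
    Finset.prod_eq_zero (Finset.mem_univ (1 : W)), eq_comm, Finset.prod_eq_zero_iff] at h1
  · obtain ⟨w, -, hw⟩ := h1
    rw [map_sub, map_sub, hact, AlgHom.commutes, sub_eq_zero] at hw
    exact ⟨w, hw.symm⟩
  · rw [D.act_one_apply]
    change χ (toTruncC (pointIdeal Z ev) n _) = 0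
    rw [map_sub, map_sub, AlgHom.commutes, AlgHom.commutes]
    exact sub_self _

/-- The action of the group on the quotients. -/
def truncAct (n : ℕ) (w : W) : Trunc J A n →ₐ[ℂ] Trunc J A n :=
  (Algebra.TensorProduct.map (AlgHom.id Z _) (D.act w)).restrictScalars ℂ

omit [Fintype W] [Algebra ℂ A] [IsScalarTower ℂ Z A] in
lemma hatReduce_act (n : ℕ) (w : W) (x : Hat J A) :
    hatReduce J A n (hatMap J (D.act w) x) = truncAct J D n w (hatReduce J A n x) := by
  induction x using hat_induction with
  | h r a => rfl
  | hadd x y hx hy => simp only [map_add, hx, hy]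

lemma exists_trunc_character (hn : n ≠ 0) :
    ∃ χ : Trunc (pointIdeal Z ev) A n →ₐ[ℂ] ℂ, ∀ a, χ (toTrunc (pointIdeal Z ev) A n a) = ev a :=
  exists_trunc_lift ev fun _ hz => Ideal.pow_le_self hn hz

lemma exists_trunc_invariant {x : Trunc J A n}
    (hx : ∀ w, truncAct J D n w x = x) : ∃ z : Z, toTrunc J A n (algebraMap Z A z) = x := by
  obtain ⟨a, rfl⟩ := toTrunc_surjective J n x
  have hc : (Nat.card W : ℂ) ≠ 0 := Nat.cast_ne_zero.mpr Nat.card_pos.ne'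
  refine ⟨(Nat.card W : ℂ)⁻¹ • D.trace a, ?_⟩
  have h1 : algebraMap Z A ((Nat.card W : ℂ)⁻¹ • D.trace a) =
      (Nat.card W : ℂ)⁻¹ • ∑ w, D.act w a := by
    rw [← D.algebraMap_trace]
    exact map_smul (IsScalarTower.toAlgHom ℂ Z A) _ _
  rw [h1]
  change toTruncC J n _ = _
  rw [map_smul, map_sum]
  have h2 : ∀ w, toTruncC J n (D.act w a) = toTrunc J A n a := hx
  simp only [h2]
  rw [Finset.sum_const, Finset.card_univ, ← Nat.card_eq_fintype_card, ← Nat.cast_smul_eq_nsmul ℂ,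
    smul_smul, inv_mul_cancel₀ hc, one_smul]

end TruncC

/-! ### Equivariant homomorphisms descend to the quotients. -/

section Descent

variable {Z₁ A₁ : Type u} {Z₂ A₂ : Type v} [CommRing Z₁] [CommRing A₁]
  [Algebra Z₁ A₁] [CommRing Z₂] [CommRing A₂] [Algebra Z₂ A₂] [Algebra ℂ Z₁] [Algebra ℂ Z₂]
  [Algebra ℂ A₁] [IsScalarTower ℂ Z₁ A₁] [Algebra ℂ A₂] [IsScalarTower ℂ Z₂ A₂]
  {W : Type*} [Group W] [Fintype W] (D₁ : InvAction W Z₁ A₁) (D₂ : InvAction W Z₂ A₂)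
  {ev₁ : A₁ →ₐ[ℂ] ℂ} {ev₂ : A₂ →ₐ[ℂ] ℂ} {n : ℕ}

/-- An equivariant homomorphism matching the base points descends to the quotients. -/
lemma exists_trunc_hom (f : A₁ →ₐ[ℂ] Trunc (pointIdeal Z₂ ev₂) A₂ n)
    (hf : ∀ w a, f (D₁.act w a) = truncAct (pointIdeal Z₂ ev₂) D₂ n w (f a))
    (hχ : ∀ χ : Trunc (pointIdeal Z₂ ev₂) A₂ n →ₐ[ℂ] ℂ, (∀ a, χ (toTrunc (pointIdeal Z₂ ev₂) A₂ n a) = ev₂ a) →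
      ∀ a, χ (f a) = ev₁ a) :
    ∃ g : Trunc (pointIdeal Z₁ ev₁) A₁ n →ₐ[ℂ] Trunc (pointIdeal Z₂ ev₂) A₂ n,
      ∀ a, g (toTrunc (pointIdeal Z₁ ev₁) A₁ n a) = f a := by
  refine exists_trunc_lift f fun z hz => ?_
  rcases eq_or_ne n 0 with rfl | hn
  · exact trunc_zero _ _
  obtain ⟨χ, hχ'⟩ := exists_trunc_character (Z := Z₂) ev₂ hn
  let F : Z₁ →+* Trunc (pointIdeal Z₂ ev₂) A₂ n := f.toRingHom.comp (algebraMap Z₁ A₁)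
  let K : Ideal (Trunc (pointIdeal Z₂ ev₂) A₂ n) :=
    (pointIdeal Z₂ ev₂).map ((toTrunc (pointIdeal Z₂ ev₂) A₂ n).toRingHom.comp (algebraMap Z₂ A₂))
  -- By equivariance central elements have invariant images, which lift to the other center by
  -- averaging; matching base points puts the lifts in its point ideal. The n-th power of that ideal
  -- dies in the quotient.
  have h1 : (pointIdeal Z₁ ev₁).map F ≤ K := by
    refine Ideal.map_le_iff_le_comap.mpr fun z hz => ?_
    obtain ⟨z', hz'⟩ := exists_trunc_invariant (J := pointIdeal Z₂ ev₂) (n := n) D₂ (x := F z)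
      fun w => by
        change truncAct (pointIdeal Z₂ ev₂) D₂ n w (f _) = f _
        rw [← hf, AlgHom.commutes]
    rw [Ideal.mem_comap, ← hz']
    refine Ideal.mem_map_of_mem ((toTrunc (pointIdeal Z₂ ev₂) A₂ n).toRingHom.comp (algebraMap Z₂ A₂)) ?_
    change ev₂ (algebraMap Z₂ A₂ z') = 0
    rw [← hχ', hz']
    exact (hχ χ hχ' _).trans hz
  have h2 : F z ∈ K ^ n := by
    have := Ideal.mem_map_of_mem F hz
    rw [Ideal.map_pow] at this
    exact Ideal.pow_right_mono h1 n this
  have h3 : K ^ n = ⊥ := by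
    rw [← Ideal.map_pow, eq_bot_iff, Ideal.map_le_iff_le_comap]
    exact fun z hz => toTrunc_algebraMap _ hz
  rw [h3] at h2
  exact h2

end Descent

/-! ### The exponential isomorphism of the completions. -/

section Comparison

/-- Algebras `A₁` and `A₂` generated by the exponentials of the elements of a lattice `X` and by
the elements themselves, with characters which correspond under `exp`. -/
structure ExpPair {W X Z₁ Z₂ : Type*} {A₁ : Type u} {A₂ : Type v} [Group W] [AddCommGroup X]
    [SMul W X] [CommRing Z₁] [CommRing A₁] [Algebra Z₁ A₁] [CommRing Z₂] [CommRing A₂]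
    [Algebra Z₂ A₂] [Algebra ℂ A₁] [Algebra ℂ A₂] (D₁ : InvAction W Z₁ A₁)
    (D₂ : InvAction W Z₂ A₂) (ev₁ : A₁ →ₐ[ℂ] ℂ) (ev₂ : A₂ →ₐ[ℂ] ℂ) (ζ : X →ₗ[ℤ] ℂ) where
  /-- The exponentials. -/
  ex : X → A₁
  /-- The elements. -/
  li : X → A₂
  ex_add : ∀ x y, ex (x + y) = ex x * ex y
  li_add : ∀ x y, li (x + y) = li x + li y
  adjoin_ex : Algebra.adjoin ℂ (Set.range ex) = ⊤
  adjoin_li : Algebra.adjoin ℂ (Set.range li) = ⊤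
  lift_ex : ∀ {B : Type v} [CommRing B] [Algebra ℂ B] (f : X → B), f 0 = 1 →
    (∀ x y, f (x + y) = f x * f y) → ∃ g : A₁ →ₐ[ℂ] B, ∀ x, g (ex x) = f x
  lift_li : ∀ {B : Type u} [CommRing B] [Algebra ℂ B] (f : X → B),
    (∀ x y, f (x + y) = f x + f y) → ∃ g : A₂ →ₐ[ℂ] B, ∀ x, g (li x) = f x
  act_ex : ∀ w x, D₁.act w (ex x) = ex (w • x)
  act_li : ∀ w x, D₂.act w (li x) = li (w • x)
  ev_ex : ∀ x, ev₁ (ex x) = Complex.exp (ζ x)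
  ev_li : ∀ x, ev₂ (li x) = ζ x
  real : ∀ (w : W) (x : X), ∃ r : ℝ, ζ (w • x) - ζ x = r

namespace ExpPair

variable {W X : Type*} {Z₁ A₁ : Type u} {Z₂ A₂ : Type v} [Group W] [Fintype W] [AddCommGroup X]
  [SMul W X] [CommRing Z₁] [CommRing A₁] [Algebra Z₁ A₁] [CommRing Z₂] [CommRing A₂]
  [Algebra Z₂ A₂] [Algebra ℂ Z₁] [Algebra ℂ Z₂] [Algebra ℂ A₁] [IsScalarTower ℂ Z₁ A₁]
  [Algebra ℂ A₂] [IsScalarTower ℂ Z₂ A₂]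
  {D₁ : InvAction W Z₁ A₁} {D₂ : InvAction W Z₂ A₂} {ev₁ : A₁ →ₐ[ℂ] ℂ} {ev₂ : A₂ →ₐ[ℂ] ℂ}
  {ζ : X →ₗ[ℤ] ℂ} (E : ExpPair D₁ D₂ ev₁ ev₂ ζ)

/-- The image of an exponential in a quotient. -/
def exTrunc (n : ℕ) (x : X) : Trunc (pointIdeal Z₁ ev₁) A₁ n :=
  toTruncC (pointIdeal Z₁ ev₁) n (E.ex x)

/-- The image of `x` in a quotient. -/
def liTrunc (n : ℕ) (x : X) : Trunc (pointIdeal Z₂ ev₂) A₂ n :=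
  toTruncC (pointIdeal Z₂ ev₂) n (E.li x)

omit [Algebra ℂ Z₁] [IsScalarTower ℂ Z₁ A₁] [Fintype W] in
lemma liTrunc_add (n : ℕ) (x y : X) :
    E.liTrunc n (x + y) = E.liTrunc n x + E.liTrunc n y := by
  rw [liTrunc, E.li_add, map_add]; rfl

omit [Algebra ℂ Z₂] [IsScalarTower ℂ Z₂ A₂] [Fintype W] in
lemma exTrunc_add (n : ℕ) (x y : X) :
    E.exTrunc n (x + y) = E.exTrunc n x * E.exTrunc n y := by
  rw [exTrunc, E.ex_add, map_mul]; rfl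

omit [Algebra ℂ Z₁] [Algebra ℂ Z₂] [IsScalarTower ℂ Z₁ A₁] [IsScalarTower ℂ Z₂ A₂] [Fintype W] in
include E in
lemma ext_ex {B : Type*} [CommRing B] [Algebra ℂ B] {φ ψ : A₁ →ₐ[ℂ] B}
    (h : ∀ x, φ (E.ex x) = ψ (E.ex x)) : φ = ψ :=
  AlgHom.ext_of_adjoin_eq_top E.adjoin_ex (by rintro _ ⟨x, rfl⟩; exact h x)

omit [Algebra ℂ Z₁] [Algebra ℂ Z₂] [IsScalarTower ℂ Z₁ A₁] [IsScalarTower ℂ Z₂ A₂] [Fintype W] in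
include E in
lemma ext_li {B : Type*} [CommRing B] [Algebra ℂ B] {φ ψ : A₂ →ₐ[ℂ] B}
    (h : ∀ x, φ (E.li x) = ψ (E.li x)) : φ = ψ :=
  AlgHom.ext_of_adjoin_eq_top E.adjoin_li (by rintro _ ⟨x, rfl⟩; exact h x)

variable {n : ℕ}

omit [Algebra ℂ Z₂] [IsScalarTower ℂ Z₂ A₂] [Fintype W] in
lemma truncAct_exTrunc (w : W) (x : X) : truncAct (pointIdeal Z₁ ev₁) D₁ n w (E.exTrunc n x) = E.exTrunc n (w • x) := by
  rw [exTrunc, exTrunc, ← E.act_ex]; rfl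

omit [Algebra ℂ Z₁] [IsScalarTower ℂ Z₁ A₁] [Fintype W] in
lemma truncAct_liTrunc (w : W) (x : X) : truncAct (pointIdeal Z₂ ev₂) D₂ n w (E.liTrunc n x) = E.liTrunc n (w • x) := by
  rw [liTrunc, liTrunc, ← E.act_li]; rfl

omit [Algebra ℂ Z₂] [IsScalarTower ℂ Z₂ A₂] in
lemma exists_character_ex (χ : Trunc (pointIdeal Z₁ ev₁) A₁ n →ₐ[ℂ] ℂ) (x : X) :
    ∃ r : ℝ, χ (E.exTrunc n x) = Complex.exp (ζ x + r) := by
  obtain ⟨w, hw⟩ := exists_character_eq χ D₁ (E.ex x)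
  rw [E.act_ex, E.ev_ex] at hw
  obtain ⟨r, hr⟩ := E.real w x
  exact ⟨r, by rw [← hr, add_sub_cancel]; exact hw⟩

omit [Algebra ℂ Z₁] [IsScalarTower ℂ Z₁ A₁] in
-- Characters take on x one of the values ζ(wx), and these differ from ζ(x) by real numbers.
lemma exists_character_li (χ : Trunc (pointIdeal Z₂ ev₂) A₂ n →ₐ[ℂ] ℂ) (x : X) :
    ∃ r : ℝ, χ (E.liTrunc n x) = ζ x + r := by
  obtain ⟨w, hw⟩ := exists_character_eq χ D₂ (E.li x)
  rw [E.act_li, E.ev_li] at hw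
  obtain ⟨r, hr⟩ := E.real w x
  exact ⟨r, by rw [← hr, add_sub_cancel]; exact hw⟩

variable [Algebra.FiniteType ℂ Z₁] [Algebra.FiniteType ℂ Z₂] [Module.Finite Z₁ A₁]
  [Module.Finite Z₂ A₂]

instance finite_trunc_pointIdeal {Z A : Type u} [CommRing Z] [CommRing A] [Algebra Z A]
    [Algebra ℂ Z] [Algebra ℂ A] [IsScalarTower ℂ Z A] [Algebra.FiniteType ℂ Z] [Module.Finite Z A]
    (ev : A →ₐ[ℂ] ℂ) (n : ℕ) : Module.Finite ℂ (Trunc (pointIdeal Z ev) A n) := finite_trunc ev n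

omit [Algebra.FiniteType ℂ Z₁] [Module.Finite Z₁ A₁] in
lemma exists_ex_to_li (n : ℕ) :
    ∃ f : Trunc (pointIdeal Z₁ ev₁) A₁ n →ₐ[ℂ] Trunc (pointIdeal Z₂ ev₂) A₂ n,
      ∀ x, f (E.exTrunc n x) = fexp 0 (E.liTrunc n x) := by
  obtain ⟨f, hf⟩ := E.lift_ex (fun x => fexp 0 (E.liTrunc n x)) (by
      have : E.liTrunc n 0 = 0 := by
        have := E.liTrunc_add n 0 0
        rwa [add_zero, left_eq_add] at this
      rw [this, fexp_zero])
    (fun x y => by rw [liTrunc_add, fexp_add])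
  obtain ⟨g, hg⟩ := exists_trunc_hom D₁ D₂ (ev₁ := ev₁) (ev₂ := ev₂) f (fun w a => by
    suffices h : f.comp ((D₁.act w).restrictScalars ℂ) = (truncAct (pointIdeal Z₂ ev₂) D₂ n w).comp f from
      AlgHom.congr_fun h a
    refine E.ext_ex fun x => ?_
    change f (D₁.act w (E.ex x)) = truncAct (pointIdeal Z₂ ev₂) D₂ n w (f (E.ex x))
    rw [E.act_ex, hf, hf, map_fexp, truncAct_liTrunc]) (fun χ hχ a => by
    suffices h : χ.comp f = ev₁ from AlgHom.congr_fun h a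
    refine E.ext_ex fun x => ?_
    rw [AlgHom.comp_apply, hf, algHom_fexp, E.ev_ex, ← E.ev_li, ← hχ]
    rfl)
  exact ⟨g, fun x => (hg _).trans (hf x)⟩

omit [Algebra.FiniteType ℂ Z₂] [Module.Finite Z₂ A₂] in
-- Logarithms of the exponentials are chosen on the line ζ(x) + ℝ. Their uniqueness makes the choice
-- additive and equivariant, so it extends to A₂ and descends to the quotient.
lemma exists_li_to_ex (n : ℕ) :
    ∃ g : Trunc (pointIdeal Z₂ ev₂) A₂ n →ₐ[ℂ] Trunc (pointIdeal Z₁ ev₁) A₁ n,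
      ∀ x, fexp 0 (g (E.liTrunc n x)) = E.exTrunc n x ∧
        ∀ χ : Trunc (pointIdeal Z₁ ev₁) A₁ n →ₐ[ℂ] ℂ, ∃ r : ℝ, χ (g (E.liTrunc n x)) = ζ x + r := by
  choose l hl hl' using fun x => exists_log fun χ => E.exists_character_ex (n := n) χ x
  obtain ⟨f, hf⟩ := E.lift_li l fun x y => by
    refine log_unique (by rw [hl, fexp_add, hl, hl, exTrunc_add]) fun χ => ?_
    obtain ⟨r, hr⟩ := hl' (x + y) χ
    obtain ⟨s, hs⟩ := hl' x χ
    obtain ⟨t, ht⟩ := hl' y χ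
    refine ⟨r - s - t, ?_⟩
    rw [map_add, hr, hs, ht, map_add]
    push_cast
    ring
  obtain ⟨g, hg⟩ := exists_trunc_hom D₂ D₁ (ev₁ := ev₂) (ev₂ := ev₁) f (fun w a => by
    suffices h : f.comp ((D₂.act w).restrictScalars ℂ) = (truncAct (pointIdeal Z₁ ev₁) D₁ n w).comp f from
      AlgHom.congr_fun h a
    refine E.ext_li fun x => ?_
    change f (D₂.act w (E.li x)) = truncAct (pointIdeal Z₁ ev₁) D₁ n w (f (E.li x))
    rw [E.act_li, hf, hf]
    refine log_unique ?_ fun χ => ?_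
    · rw [← map_fexp, hl, hl, truncAct_exTrunc]
    · obtain ⟨r, hr⟩ := hl' (w • x) χ
      obtain ⟨s, hs⟩ := hl' x (χ.comp (truncAct (pointIdeal Z₁ ev₁) D₁ n w))
      obtain ⟨t, ht⟩ := E.real w x
      refine ⟨r - s + t, ?_⟩
      rw [AlgHom.comp_apply] at hs
      rw [hr, hs]
      push_cast
      rw [← ht]
      ring) (fun χ hχ a => by
    suffices h : χ.comp f = ev₂ from AlgHom.congr_fun h a
    refine E.ext_li fun x => ?_
    have h1 := congrArg χ (hl x)
    have h2 : χ (E.exTrunc n x) = Complex.exp (ζ x) := (hχ _).trans (E.ev_ex x)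
    obtain ⟨r, hr⟩ := hl' x χ
    rw [algHom_fexp, h2, hr, Complex.exp_add, mul_eq_left₀ (Complex.exp_ne_zero _),
      ← Complex.ofReal_exp, Complex.ofReal_eq_one, Real.exp_eq_one_iff] at h1
    rw [AlgHom.comp_apply, hf, E.ev_li, hr, h1, Complex.ofReal_zero, add_zero])
  have hg' : ∀ x, g (E.liTrunc n x) = l x := fun x => (hg _).trans (hf x)
  exact ⟨g, fun x => by rw [hg']; exact ⟨hl x, hl' x⟩⟩

/-- One composite is the identity because exp(log) = id, the other by uniqueness of the logarithm.
-/
lemma exists_truncEquiv (n : ℕ) :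
    ∃ e : Trunc (pointIdeal Z₁ ev₁) A₁ n ≃ₐ[ℂ] Trunc (pointIdeal Z₂ ev₂) A₂ n,
      ∀ x, e (E.exTrunc n x) = fexp 0 (E.liTrunc n x) := by
  obtain ⟨f, hf⟩ := E.exists_ex_to_li n
  obtain ⟨g, hg⟩ := E.exists_li_to_ex n
  refine ⟨AlgEquiv.ofAlgHom f g ?_ ?_, hf⟩
  · refine AlgHom.ext fun y => ?_
    obtain ⟨a, rfl⟩ := toTrunc_surjective _ n y
    suffices h : (f.comp g).comp (toTruncC _ n) = toTruncC _ n from AlgHom.congr_fun h a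
    refine E.ext_li fun x => ?_
    change f (g (E.liTrunc n x)) = E.liTrunc n x
    refine log_unique ?_ fun χ => ?_
    · rw [← map_fexp, (hg x).1, hf]
    · obtain ⟨r, hr⟩ := (hg x).2 (χ.comp f)
      obtain ⟨s, hs⟩ := E.exists_character_li χ x
      rw [AlgHom.comp_apply] at hr
      exact ⟨r - s, by rw [hr, hs]; push_cast; ring⟩
  · refine AlgHom.ext fun y => ?_
    obtain ⟨a, rfl⟩ := toTrunc_surjective _ n y
    suffices h : (g.comp f).comp (toTruncC _ n) = toTruncC _ n from AlgHom.congr_fun h a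
    refine E.ext_ex fun x => ?_
    change g (f (E.exTrunc n x)) = E.exTrunc n x
    rw [hf, map_fexp, (hg x).1]

/-- The isomorphism of completions given by the exponential. -/
lemma exists_comparison [IsNoetherianRing Z₁] [IsNoetherianRing Z₂] :
    ∃ κ : Hat (pointIdeal Z₁ ev₁) A₁ ≃ₐ[ℂ] Hat (pointIdeal Z₂ ev₂) A₂,
      Equivariant D₁ D₂ κ ∧
      ∀ n x, hatReduce (pointIdeal Z₂ ev₂) A₂ n (κ (toHat _ (E.ex x))) = fexp 0 (E.liTrunc n x) := by
  choose e he using E.exists_truncEquiv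
  obtain ⟨κ, hκ⟩ := exists_hatEquiv e fun {m n} h y => by
    obtain ⟨a, rfl⟩ := toTrunc_surjective _ n y
    rw [truncMap_toTrunc]
    suffices h' : (((truncMap (pointIdeal Z₂ ev₂) (A := A₂) h).restrictScalars ℂ).comp
        (e n).toAlgHom).comp (toTruncC _ n) = (e m).toAlgHom.comp (toTruncC _ m) from
      AlgHom.congr_fun h' a
    refine E.ext_ex fun x => ?_
    change (truncMap (pointIdeal Z₂ ev₂) (A := A₂) h).restrictScalars ℂ (e n (E.exTrunc n x)) =
      e m (E.exTrunc m x)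
    rw [he, he, map_fexp]
    exact congrArg _ (truncMap_toTrunc _ h _)
  refine ⟨κ, fun w y => hat_ext fun n => ?_, fun n x => ?_⟩
  · rw [hatReduce_act, hκ, hκ, hatReduce_act]
    obtain ⟨a, ha⟩ := toTrunc_surjective (pointIdeal Z₁ ev₁) n (hatReduce (pointIdeal Z₁ ev₁) A₁ n y)
    rw [← ha]
    suffices h' : ((e n).toAlgHom.comp (truncAct (pointIdeal Z₁ ev₁) D₁ n w)).comp (toTruncC _ n) =
        ((truncAct (pointIdeal Z₂ ev₂) D₂ n w).comp (e n).toAlgHom).comp (toTruncC _ n) from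
      AlgHom.congr_fun h' a
    refine E.ext_ex fun x => ?_
    change e n (truncAct (pointIdeal Z₁ ev₁) D₁ n w (E.exTrunc n x)) = truncAct (pointIdeal Z₂ ev₂) D₂ n w (e n (E.exTrunc n x))
    rw [truncAct_exTrunc, he, he, map_fexp, truncAct_liTrunc]
  · rw [hκ, hatReduce_toHat]
    exact he n x

omit [Fintype W] [Algebra ℂ Z₁] [IsScalarTower ℂ Z₁ A₁] [Algebra.FiniteType ℂ Z₁]
  [Module.Finite Z₁ A₁] in
lemma isExp {x : X} {y : Hat (pointIdeal Z₂ ev₂) A₂}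
    (h : ∀ n, hatReduce (pointIdeal Z₂ ev₂) A₂ n y = fexp 0 (E.liTrunc n x)) :
    IsExp (pointIdeal Z₂ ev₂) (E.li x) y := by
  intro n φ
  rw [h, hatReduce_toHat]
  exact hasSer_fexp 0 (E.liTrunc n x) φ

section Units

variable {Z A : Type v} [CommRing Z] [CommRing A] [Algebra Z A] [Algebra ℂ Z] [Algebra ℂ A]
  [IsScalarTower ℂ Z A] [Algebra.FiniteType ℂ Z] [Module.Finite Z A] [IsNoetherianRing Z]
  {ev : A →ₐ[ℂ] ℂ}

/-- The unit `(exp(a) - 1) / a` of the completion. -/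
lemma exists_unit_mul_eq (a : A)
    (ha : ∀ n, ∀ χ : Trunc (pointIdeal Z ev) A n →ₐ[ℂ] ℂ, ∃ r : ℝ,
      χ (toTruncC (pointIdeal Z ev) n a) = r) :
    ∃ F : (Hat (pointIdeal Z ev) A)ˣ, ∀ n,
      toTruncC (pointIdeal Z ev) n a * hatReduce (pointIdeal Z ev) A n F =
        fexp 0 (toTruncC (pointIdeal Z ev) n a) - 1 := by
  obtain ⟨F, hF⟩ := exists_hat (J := pointIdeal Z ev) (A := A)
    (b := fun n => fexp 1 (toTruncC (pointIdeal Z ev) n a)) fun {m n} h => by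
      refine (map_fexp ((truncMap (pointIdeal Z ev) (A := A) h).restrictScalars ℂ) 1 _).trans ?_
      exact congrArg _ (truncMap_toTrunc _ h a)
  have h1 : ∀ n, toTruncC (pointIdeal Z ev) n a * fexp 1 (toTruncC (pointIdeal Z ev) n a) =
      fexp 0 (toTruncC (pointIdeal Z ev) n a) - 1 := fun n => by
    rw [mul_fexp_succ, Nat.factorial_zero, Nat.cast_one, inv_one, map_one]
  have hu : IsUnit F := hat_isUnit fun n => by
    rw [hF]
    refine isUnit_of_character fun χ h0 => ?_
    obtain ⟨r, hr⟩ := ha n χ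
    have h2 := congrArg χ (h1 n)
    have h3 := congrArg χ (mul_fexp_succ 1 (toTruncC (pointIdeal Z ev) n a))
    -- If (e^r - 1)/r vanished at a real value r, then e^r = 1 and r = 0; but at r = 0 the series
    -- has the value 1.
    rw [map_mul, h0, mul_zero, map_sub, map_one, algHom_fexp, hr, eq_comm, sub_eq_zero,
      ← Complex.ofReal_exp, Complex.ofReal_eq_one, Real.exp_eq_one_iff] at h2
    rw [map_mul, hr, h2, map_sub, h0, AlgHom.commutes, Nat.factorial_one] at h3
    norm_num at h3
  obtain ⟨F, rfl⟩ := hu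
  exact ⟨F, fun n => by rw [hF, h1]⟩

end Units

omit [Algebra.FiniteType ℂ Z₁] [Module.Finite Z₁ A₁] in
-- With F(a) = (e^a - 1)/a, the unit is F(x + k)/F(x). Reality of k and of ζ(x) keeps both factors
-- invertible.
lemma exists_unit_factor [IsNoetherianRing Z₁] [IsNoetherianRing Z₂]
    {κ : Hat (pointIdeal Z₁ ev₁) A₁ ≃ₐ[ℂ] Hat (pointIdeal Z₂ ev₂) A₂}
    (hκ : ∀ n x, hatReduce (pointIdeal Z₂ ev₂) A₂ n (κ (toHat _ (E.ex x))) =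
      fexp 0 (E.liTrunc n x))
    (x : X) (hx : ∃ r : ℝ, ζ x = r) (k : ℝ) :
    ∃ u : (Hat (pointIdeal Z₂ ev₂) A₂)ˣ,
      κ (toHat _ (Complex.exp k • E.ex x - 1)) * toHat _ (E.li x) =
        toHat _ (E.li x + algebraMap ℂ A₂ k) *
          κ (toHat _ (E.ex x - 1)) * (u : Hat (pointIdeal Z₂ ev₂) A₂) := by
  obtain ⟨s, hs⟩ := hx
  have hreal : ∀ n, ∀ χ : Trunc (pointIdeal Z₂ ev₂) A₂ n →ₐ[ℂ] ℂ, ∃ r : ℝ,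
      χ (E.liTrunc n x) = r := fun n χ => by
    obtain ⟨r, hr⟩ := E.exists_character_li χ x
    exact ⟨s + r, by rw [hr, hs]; push_cast; rfl⟩
  obtain ⟨F, hF⟩ := exists_unit_mul_eq (Z := Z₂) (ev := ev₂) (E.li x) hreal
  obtain ⟨G, hG⟩ := exists_unit_mul_eq (Z := Z₂) (ev := ev₂) (E.li x + algebraMap ℂ A₂ k)
    fun n χ => by
      obtain ⟨r, hr⟩ := hreal n χ
      refine ⟨r + k, ?_⟩
      rw [map_add, AlgHom.commutes, map_add, AlgHom.commutes]
      push_cast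
      exact congrArg (· + (k : ℂ)) hr
  refine ⟨G * F⁻¹, ?_⟩
  have h1 : κ (toHat _ (E.ex x - 1)) = toHat _ (E.li x) * (F : Hat (pointIdeal Z₂ ev₂) A₂) := hat_ext fun n => by
    rw [map_sub, map_sub, map_sub, map_one, map_one, map_one, hκ, map_mul, hatReduce_toHat]
    exact (hF n).symm
  have h2 : κ (toHat _ (Complex.exp k • E.ex x - 1)) =
      toHat _ (E.li x + algebraMap ℂ A₂ k) * (G : Hat (pointIdeal Z₂ ev₂) A₂) :=
    hat_ext fun n => by
      have h3 : toHat (pointIdeal Z₁ ev₁) (Complex.exp k • E.ex x) =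
          Complex.exp k • toHat (pointIdeal Z₁ ev₁) (E.ex x) :=
        map_smul ((toHat (B := A₁) (pointIdeal Z₁ ev₁)).restrictScalars ℂ) _ _
      have h4 : ∀ y, hatReduce (pointIdeal Z₂ ev₂) A₂ n (Complex.exp k • y) =
          Complex.exp k • hatReduce (pointIdeal Z₂ ev₂) A₂ n y :=
        fun y => map_smul ((hatReduce (pointIdeal Z₂ ev₂) A₂ n).restrictScalars ℂ) _ _
      rw [map_sub, map_sub, map_sub, map_one, map_one, map_one, h3, map_smul, h4, hκ, map_mul,
        hatReduce_toHat]
      refine Eq.trans ?_ (hG n).symm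
      rw [map_add, fexp_add, AlgHom.commutes, fexp_algebraMap]
      exact congrArg (· - 1) ((Algebra.smul_def (Complex.exp k) (fexp 0 (E.liTrunc n x))).trans
        (mul_comm _ _))
  rw [h1, h2, Units.val_mul]
  linear_combination (-toHat _ (E.li x + algebraMap ℂ A₂ k) * toHat _ (E.li x) * G) * F.mul_inv

end ExpPair
end Comparison

/-! ### Generators, homomorphisms and evaluation for ℂ[X] and S(V). -/

section Lattice

variable {X : Type*} [AddCommGroup X]

lemma adjoin_θ : Algebra.adjoin ℂ (Set.range (θ : X → GrpAlg X)) = ⊤ := by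
  refine eq_top_iff.mpr fun f _ => ?_
  induction f using AddMonoidAlgebra.induction_linear with
  | zero => exact zero_mem _
  | add f g hf hg => exact add_mem (hf trivial) (hg trivial)
  | single x c =>
    have hs : AddMonoidAlgebra.single x c = c • θ x := by simp [θ]
    rw [hs]
    exact Subalgebra.smul_mem _ (Algebra.subset_adjoin (Set.mem_range_self x)) c

lemma adjoin_lin : Algebra.adjoin ℂ (Set.range (lin : X → PolyAlg X)) = ⊤ := by
  refine eq_top_iff.mpr fun f _ => ?_
  induction f using SymmetricAlgebra.induction with
  | algebraMap c => exact Subalgebra.algebraMap_mem _ c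
  | mul f g hf hg => exact mul_mem (hf trivial) (hg trivial)
  | add f g hf hg => exact add_mem (hf trivial) (hg trivial)
  | ι v =>
    induction v using TensorProduct.induction_on with
    | zero => rw [map_zero]; exact zero_mem _
    | add u v hu hv => rw [map_add]; exact add_mem (hu trivial) (hv trivial)
    | tmul c x =>
      have hc : c ⊗ₜ[ℤ] x = c • (1 ⊗ₜ[ℤ] x : VC X) := by
        rw [TensorProduct.smul_tmul', smul_eq_mul, mul_one]
      rw [hc, LinearMap.map_smul]
      exact Subalgebra.smul_mem _ (Algebra.subset_adjoin (Set.mem_range_self x)) c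

lemma exists_polyAlg_hom {B : Type*} [CommRing B] [Algebra ℂ B] (f : X → B)
    (hf : ∀ x y, f (x + y) = f x + f y) : ∃ g : PolyAlg X →ₐ[ℂ] B, ∀ x, g (lin x) = f x := by
  let F : X →+ B := AddMonoidHom.mk' f hf
  refine ⟨SymmetricAlgebra.lift (LinearMap.liftBaseChange ℂ F.toIntLinearMap), fun x => ?_⟩
  rw [SymmetricAlgebra.lift_ι_apply, LinearMap.liftBaseChange_tmul, one_smul]
  rfl

lemma exists_grpAlg_hom {B : Type*} [CommRing B] [Algebra ℂ B] (f : X → B) (h0 : f 0 = 1)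
    (hf : ∀ x y, f (x + y) = f x * f y) : ∃ g : GrpAlg X →ₐ[ℂ] B, ∀ x, g (θ x) = f x := by
  let F : Multiplicative X →* B :=
    { toFun := fun x => f x.toAdd, map_one' := h0, map_mul' := fun x y => hf _ _ }
  refine ⟨AddMonoidAlgebra.lift ℂ B X F, fun x => ?_⟩
  rw [θ, AddMonoidAlgebra.lift_single, one_smul]
  rfl

lemma evGrp_θ (ζ : X →ₗ[ℤ] ℂ) (x : X) : evGrp (expPoint ζ) (θ x) = Complex.exp (ζ x) := by
  rw [evGrp, θ, AddMonoidAlgebra.lift_single, one_smul]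
  rfl

lemma evSym_lin (ζ : X →ₗ[ℤ] ℂ) (x : X) : evSym ζ (lin x) = ζ x := by
  rw [evSym, SymmetricAlgebra.lift_ι_apply, LinearMap.liftBaseChange_tmul, one_smul]

variable {ι Y : Type*} [AddCommGroup Y] {P : RootDatum ι X Y}

/-- A reflection changes ζ(x) by an integer multiple of the real number α(ζ). -/
lemma IsReal.exists_sub_eq {ζ : X →ₗ[ℤ] ℂ} (hζ : IsReal P ζ) (w : P.weylGroup) (x : X) :
    ∃ r : ℝ, ζ (w • x) - ζ x = r := by
  obtain ⟨w, hw⟩ := w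
  induction hw using RootPairing.weylGroup.induction generalizing x with
  | mem i =>
    obtain ⟨r, hr⟩ := hζ i
    refine ⟨-(P.toLinearMap x (P.coroot i) * r), ?_⟩
    change ζ (refl P i • x) - _ = _
    rw [refl_smul, map_sub, map_zsmul, hr, zsmul_eq_mul]
    push_cast
    ring
  | one => exact ⟨0, by change ζ x - ζ x = _; simp⟩
  | mul u v hu hv hu' hv' =>
    obtain ⟨r, hr⟩ := hu' ((⟨v, hv⟩ : P.weylGroup) • x)
    obtain ⟨s, hs⟩ := hv' x
    refine ⟨r + s, ?_⟩
    push_cast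
    rw [← hr, ← hs, sub_add_sub_cancel]
    rfl

end Lattice

/-! ### Existence of the isomorphism and the image of the sign projector. -/

section Existence

variable {ι X Y : Type*} [Finite ι] [AddCommGroup X] [AddCommGroup Y] [Module.Free ℤ X]
  {P : RootDatum ι X Y} {ζ : X →ₗ[ℤ] ℂ}

/-- The group algebra and the symmetric algebra of the lattice. -/
def expPair (hζ : IsReal P ζ) :
    ExpPair (grpAction P) (symAction P) (evGrp (expPoint ζ)) (evSym ζ) ζ where
  ex := θ
  li := lin
  ex_add := θ_add
  li_add x y := by rw [lin, TensorProduct.tmul_add]; exact map_add _ _ _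
  adjoin_ex := adjoin_θ
  adjoin_li := adjoin_lin
  lift_ex := exists_grpAlg_hom
  lift_li := exists_polyAlg_hom
  act_ex := grpAction_act_θ P
  act_li := symAction_act_lin P
  ev_ex := evGrp_θ ζ
  ev_li := evSym_lin ζ
  real := hζ.exists_sub_eq

variable [Module.Finite ℤ X]

instance finiteType_invGrp : Algebra.FiniteType ℂ (invGrp P) := by
  have := (grpAction P).moduleFinite ℂ
  exact ⟨fg_of_fg_of_fg ℂ _ (GrpAlg X) Algebra.FiniteType.out Module.Finite.fg_top
    Subtype.val_injective⟩

instance finiteType_invSym : Algebra.FiniteType ℂ (invSym P) := by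
  have := (symAction P).moduleFinite ℂ
  exact ⟨fg_of_fg_of_fg ℂ _ (PolyAlg X) Algebra.FiniteType.out Module.Finite.fg_top
    Subtype.val_injective⟩

instance moduleFinite_grpAlg : Module.Finite (invGrp P) (GrpAlg X) := (grpAction P).moduleFinite ℂ

instance moduleFinite_polyAlg : Module.Finite (invSym P) (PolyAlg X) := (symAction P).moduleFinite ℂ

variable (P ζ) in
omit [Finite ι] [Module.Free ℤ X] [Module.Finite ℤ X] in
lemma idealGrp_eq : idealGrp P (expPoint ζ) = pointIdeal (invGrp P) (evGrp (expPoint ζ)) := rfl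

variable (P ζ) in
omit [Finite ι] [Module.Free ℤ X] [Module.Finite ℤ X] in
lemma idealSym_eq : idealSym P ζ = pointIdeal (invSym P) (evSym ζ) := rfl

lemma exists_completion_iso (hζ : IsReal P ζ) :
    ∃ κ : Hat (idealGrp P (expPoint ζ)) (GrpAlg X) ≃ₐ[ℂ] Hat (idealSym P ζ) (PolyAlg X),
      Equivariant (grpAction P) (symAction P) κ ∧
      (∀ x, IsExp (idealSym P ζ) (lin x) (κ (toHat _ (θ x)))) ∧
      ∀ (i : ι) (k : ℝ), ∃ u : (Hat (idealSym P ζ) (PolyAlg X))ˣ,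
        κ (toHat _ (Complex.exp k • θ (P.root i) - 1)) * toHat _ (lin (P.root i)) =
          toHat _ (lin (P.root i) + algebraMap ℂ _ (k : ℂ)) * κ (toHat _ (θ (P.root i) - 1)) *
            (u : Hat (idealSym P ζ) (PolyAlg X)) := by
  rw [idealGrp_eq, idealSym_eq]
  obtain ⟨κ, h, hκ⟩ := (expPair hζ).exists_comparison
  exact ⟨κ, h, fun x => (expPair hζ).isExp fun n => hκ n x,
    fun i k => (expPair hζ).exists_unit_factor hκ _ (hζ i) k⟩

variable [P.IsReduced] (b : P.Base)

theorem exists_isLusztigIso {q : ℝ} (hq : 0 < q) (hζ : IsReal P ζ) :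
    ∃ j, IsLusztigIso b q (Real.log q) (idealGrp P (expPoint ζ)) (idealSym P ζ) j := by
  have hq' : (q : ℂ) ≠ 0 := Complex.ofReal_ne_zero.mpr hq.ne'
  have hexp : Complex.exp (Real.log q : ℝ) = q := by
    rw [← Complex.ofReal_exp, Real.exp_log hq]
  obtain ⟨κ, h, hexp', hu⟩ := exists_completion_iso (P := P) hζ
  -- With k = log q the unit compares (q e^α - 1)/(e^α - 1) with (α + log q)/α.
  choose u hu using fun i => hu i (Real.log q)
  rw [hexp] at hu
  obtain ⟨j, hj, hκ, hH⟩ := exists_hecke_iso (affData b hq') (grData b (Real.log q)) rfl h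
    (fun i => u i) fun i => hu i
  have hκ' : ∀ x, j (grpHatToF b _ q x) = symHatToF b _ _ (κ x) := hκ
  refine ⟨j, fun i hi => hj ⟨i, hi⟩, fun x => ⟨_, hexp' x, ?_⟩, image_center _ _ h hκ, ?_, hH⟩
  · rw [← hκ']
    exact congrArg j (hatToF_toHat (J := idealGrp P (expPoint ζ)) (grpToHecke b (q : ℂ) (θ x))).symm
  · rw [← Set.range_comp]
    refine Set.Subset.antisymm ?_ ?_
    · rintro _ ⟨x, rfl⟩
      exact ⟨κ x, (hκ' x).symm⟩
    · rintro _ ⟨y, rfl⟩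
      exact ⟨κ.symm y, (hκ' _).trans (congrArg _ (κ.apply_symm_apply y))⟩

omit [Module.Finite ℤ X] [Module.Free ℤ X] [P.IsReduced] in
-- The sum is a positive real number because q > 0, so the normalization of the affine projector is
-- legitimate.
lemma sum_pow_len_ne_zero {q : ℝ} (hq : 0 < q) :
    ∑ w : P.weylGroup, (1 / (q : ℂ)) ^ len b w ≠ 0 := by
  have h : 0 < ∑ w : P.weylGroup, (1 / q) ^ len b w :=
    Finset.sum_pos (fun w _ => pow_pos (one_div_pos.mpr hq) _) Finset.univ_nonempty
  have h2 : ∑ w : P.weylGroup, (1 / (q : ℂ)) ^ len b w =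
      ((∑ w : P.weylGroup, (1 / q) ^ len b w : ℝ) : ℂ) := by
    push_cast
    rfl
  rw [h2]
  exact Complex.ofReal_ne_zero.mpr h.ne'

theorem IsLusztigIso.exists_unit_sign {q : ℝ} (hq : 0 < q)
    {j : HatF (idealGrp P (expPoint ζ)) (AffineHecke b q) ≃ₐ[ℂ]
      HatF (idealSym P ζ) (GradedHecke b (Real.log q))}
    (hj : IsLusztigIso b q (Real.log q) (idealGrp P (expPoint ζ)) (idealSym P ζ) j) :
    ∃ a : (Hat (idealSym P ζ) (PolyAlg X))ˣ,
      j (hatToF (idealGrp P (expPoint ζ)) (AffineHecke b q)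
          (toHat (idealGrp P (expPoint ζ)) (signAff b q))) =
        symHatToF b (idealSym P ζ) (Real.log q) a *
          hatToF (idealSym P ζ) (GradedHecke b (Real.log q))
            (toHat (idealSym P ζ) (signGr b (Real.log q))) := by
  have hq' : (q : ℂ) ≠ 0 := Complex.ofReal_ne_zero.mpr hq.ne'
  refine exists_sign_unit (isSignProjector_aff b hq' (sum_pow_len_ne_zero b hq))
    (isSignProjector_gr b _) (fun i => hj.map_tau i i.2) (fun x => ?_) hj.map_hecke
  have h1 : j (grpHatToF b (idealGrp P (expPoint ζ)) q x) ∈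
      Set.range (symHatToF b (idealSym P ζ) (Real.log q)) := by
    rw [← hj.map_commutative]
    exact ⟨_, ⟨x, rfl⟩, rfl⟩
  exact h1

end Existence

end LusztigReduction

end

theorem proposition6p3 {ι X Y : Type*} [Finite ι] [AddCommGroup X] [AddCommGroup Y]
    [Module.Free ℤ X] [Module.Finite ℤ X] (P : RootDatum ι X Y) [P.IsReduced] (b : P.Base)
    (q : ℝ) (hq : 0 < q) (ζ : X →ₗ[ℤ] ℂ) (hζ : IsReal P ζ) :
    (∃ j, IsLusztigIso b q (Real.log q) (idealGrp P (expPoint ζ)) (idealSym P ζ) j) ∧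
    ∀ j, IsLusztigIso b q (Real.log q) (idealGrp P (expPoint ζ)) (idealSym P ζ) j →
      ∃ a : (Hat (idealSym P ζ) (PolyAlg X))ˣ,
        j (hatToF (idealGrp P (expPoint ζ)) (AffineHecke b q)
            (toHat (idealGrp P (expPoint ζ)) (signAff b q))) =
          symHatToF b (idealSym P ζ) (Real.log q) a *
            hatToF (idealSym P ζ) (GradedHecke b (Real.log q))
              (toHat (idealSym P ζ) (signGr b (Real.log q))) := by
  exact ⟨exists_isLusztigIso b hq hζ, fun _ hj => hj.exists_unit_sign b hq⟩
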